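/- Let $\eta: F\to Z$ be a smooth fibre bundle of (finite-dimensional, Hausdorff, $\sigma$-compact, boundaryless) smooth manifolds, with typical fibre a smooth manifold $S$, and suppose that the compactly supported de Rham cohomology $H^j_c(\eta^{-1}(z))$ (with complex coefficients) is finite-dimensional for every $z\in Z$ and $j\ge 0$. Let $V\to Z$ be a smooth complex vector bundle of finite rank and let $k\ge 0$. Let $\mathcal C^{1,0}=\eta^*(\mathcal E^1_Z)$ be the bundle of complex covectors on $F$ annihilating the vertical vectors $T_{\mathrm{vert}}F=\ker d\eta$, put $\mathcal C^{0,1}=\mathcal E^1_F/\mathcal C^{1,0}\cong (T_{\mathrm{vert}}F\otimes\mathbb C)^*$ and $\mathcal C^{0,k}=\wedge^k\mathcal C^{0,1}$, and let $d_\eta:\Gamma_c(F,\mathcal C^{0,k}\otimes\eta^*V)\to\Gamma_c(F,\mathcal C^{0,k+1}\otimes\eta^*V)$ be the relative exterior derivative, that is, on each fibre $\eta^{-1}(z)$, the exterior derivative of forms with values in the vector space $V_z$. Let $H^k_{\mathcal C,c}(F,\eta^*V)$ be the $k$-th cohomology of the complex $(\Gamma_c(F,\mathcal C^{0,\bullet}\otimes\eta^*V),d_\eta)$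 of smooth compactly supported sections. Then the spaces $H^k_c(\eta^{-1}(z))$, $z\in Z$, form a smooth complex vector bundle $\mathcal H^k_c\to Z$, with charts given by the identifications $H^k_c(\eta^{-1}(z))\cong H^k_c(\eta^{-1}(z_0))$ induced by the smooth local trivializations of $\eta$, and sending the class of a $d_\eta$-closed form $\omega$ to the section $z\mapsto[\omega|_{\eta^{-1}(z)}]\in H^k_c(\eta^{-1}(z))\otimes V_z$ is a well-defined isomorphism of complex vector spaces $$H^k_{\mathcal C,c}(F,\eta^*V)\;\cong\;\Gamma_c(Z,\mathcal H^k_c\otimes V),$$ where $\Gamma_c$ denotes smooth compactly supported sections. -/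

import Mathlib

open scoped Manifold ContDiff TensorProduct
open Bundle

noncomputable section

set_option linter.unusedSectionVars false

namespace RelDeRham

section Fibres

variable {EF EZ : Type*} [NormedAddCommGroup EF] [NormedSpace ℝ EF]
  [NormedAddCommGroup EZ] [NormedSpace ℝ EZ]
  {F Z : Type*} [TopologicalSpace F] [ChartedSpace EF F]
  [TopologicalSpace Z] [ChartedSpace EZ Z]

/-- The vertical tangent space `ker dη_p`. -/
def Vert (η : C^∞⟮𝓘(ℝ, EF), F; 𝓘(ℝ, EZ), Z⟯) (p : F) :
    Submodule ℝ (TangentSpace 𝓘(ℝ, EF) p) :=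
  LinearMap.ker (mfderiv 𝓘(ℝ, EF) 𝓘(ℝ, EZ) η p).toLinearMap

/-- The fibre `η⁻¹(z)`. -/
abbrev Fib (η : C^∞⟮𝓘(ℝ, EF), F; 𝓘(ℝ, EZ), Z⟯) (z : Z) : Type _ := {p : F // η p = z}

/-- Arbitrary (not necessarily continuous) `k`-forms on the fibre `η⁻¹(z)`, whose tangent space at `p`
is `Vert η p`, with values in a complex vector space `W` (below `W` will be `ℂ`). -/
def FibForm (η : C^∞⟮𝓘(ℝ, EF), F; 𝓘(ℝ, EZ), Z⟯) (z : Z) (k : ℕ) (W : Type*)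
    [NormedAddCommGroup W] [NormedSpace ℂ W] : Type _ :=
  ∀ p : Fib η z, Vert η p.1 [⋀^Fin k]→L[ℝ] W

instance (η : C^∞⟮𝓘(ℝ, EF), F; 𝓘(ℝ, EZ), Z⟯) (z : Z) (k : ℕ) (W : Type*)
    [NormedAddCommGroup W] [NormedSpace ℂ W] : AddCommGroup (FibForm η z k W) :=
  inferInstanceAs (AddCommGroup (∀ p : Fib η z, Vert η p.1 [⋀^Fin k]→L[ℝ] W))

instance (η : C^∞⟮𝓘(ℝ, EF), F; 𝓘(ℝ, EZ), Z⟯) (z : Z) (k : ℕ) (W : Type*)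
    [NormedAddCommGroup W] [NormedSpace ℂ W] : Module ℂ (FibForm η z k W) :=
  inferInstanceAs (Module ℂ (∀ p : Fib η z, Vert η p.1 [⋀^Fin k]→L[ℝ] W))

/-- A smooth map from an open subset of `ℝⁿ` into the fibre `η⁻¹(z)`; inverses of charts of the
fibre are examples. -/
structure FibPlot (η : C^∞⟮𝓘(ℝ, EF), F; 𝓘(ℝ, EZ), Z⟯) (z : Z) (n : ℕ) where
  /-- the open domain -/
  dom : Set (EuclideanSpace ℝ (Fin n))
  isOpen_dom : IsOpen dom
  /-- the map; its values outside `dom` are irrelevant -/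
  toFun : EuclideanSpace ℝ (Fin n) → F
  contMDiffOn : ContMDiffOn 𝓘(ℝ, EuclideanSpace ℝ (Fin n)) 𝓘(ℝ, EF) ∞ toFun dom
  mapsTo : ∀ x ∈ dom, η (toFun x) = z

variable {η : C^∞⟮𝓘(ℝ, EF), F; 𝓘(ℝ, EZ), Z⟯} {z : Z} {k n : ℕ}
  {W : Type*} [NormedAddCommGroup W] [NormedSpace ℂ W]

@[simp] theorem FibForm.zero_apply (p : Fib η z) : (0 : FibForm η z k W) p = 0 := rfl

@[simp] theorem FibForm.add_apply (α β : FibForm η z k W) (p : Fib η z) :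
    (α + β) p = α p + β p := rfl

@[simp] theorem FibForm.smul_apply (c : ℂ) (α : FibForm η z k W) (p : Fib η z) :
    (c • α) p = c • α p := rfl

/-- A map with constant composition with `η` near `x` has vertical derivative at `x`. -/
theorem mfderiv_mem_vert {EM M : Type*} [NormedAddCommGroup EM] [NormedSpace ℝ EM]
    [TopologicalSpace M] [ChartedSpace EM M] {g : M → F} {O : Set M} (hO : IsOpen O)
    (hg : ContMDiffOn 𝓘(ℝ, EM) 𝓘(ℝ, EF) ∞ g O) (h : ∀ x ∈ O, η (g x) = z)
    {x : M} (hx : x ∈ O) (v : TangentSpace 𝓘(ℝ, EM) x) :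
    mfderiv 𝓘(ℝ, EM) 𝓘(ℝ, EF) g x v ∈ Vert η (g x) := by
  have hg' : MDifferentiableAt 𝓘(ℝ, EM) 𝓘(ℝ, EF) g x :=
    (hg.contMDiffAt (hO.mem_nhds hx)).mdifferentiableAt (by simp)
  have hη : MDifferentiableAt 𝓘(ℝ, EF) 𝓘(ℝ, EZ) η (g x) :=
    (η.contMDiff (g x)).mdifferentiableAt (by simp)
  have hc := mfderiv_comp x hη hg'
  have he : (η ∘ g) =ᶠ[nhds x] fun _ => z := by
    filter_upwards [hO.mem_nhds hx] with y hy using h y hy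
  rw [he.mfderiv_eq, mfderiv_const] at hc
  have := congrArg (fun L => L v) hc
  exact this.symm

/-- The derivative of a plot of the fibre, as a map into the tangent space of the fibre. -/
def FibPlot.deriv (g : FibPlot η z n) (x : EuclideanSpace ℝ (Fin n)) (hx : x ∈ g.dom) :
    EuclideanSpace ℝ (Fin n) →L[ℝ] Vert η (g.toFun x) :=
  ContinuousLinearMap.codRestrict
    (mfderiv 𝓘(ℝ, EuclideanSpace ℝ (Fin n)) 𝓘(ℝ, EF) g.toFun x) (Vert η (g.toFun x))
    (mfderiv_mem_vert g.isOpen_dom g.contMDiffOn g.mapsTo hx)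

open Classical in
/-- The pullback `g^*α` on the domain of `g` (extended by `0`). -/
def FibPlot.pull (g : FibPlot η z n) (α : FibForm η z k W) :
    EuclideanSpace ℝ (Fin n) → EuclideanSpace ℝ (Fin n) [⋀^Fin k]→L[ℝ] W := fun x =>
  if hx : x ∈ g.dom then
    (α ⟨g.toFun x, g.mapsTo x hx⟩).compContinuousLinearMap (g.deriv x hx)
  else 0

theorem FibPlot.pull_zero (g : FibPlot η z n) : g.pull (0 : FibForm η z k W) = 0 := by
  funext x
  by_cases hx : x ∈ g.dom
  · ext v; simp [FibPlot.pull, hx]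
  · simp [FibPlot.pull, hx]

theorem FibPlot.pull_add (g : FibPlot η z n) (α θ : FibForm η z k W) :
    g.pull (α + θ) = g.pull α + g.pull θ := by
  funext x
  by_cases hx : x ∈ g.dom
  · ext v; simp [FibPlot.pull, hx]
  · simp [FibPlot.pull, hx]

theorem FibPlot.pull_smul (g : FibPlot η z n) (c : ℂ) (α : FibForm η z k W) :
    g.pull (c • α) = c • g.pull α := by
  funext x
  by_cases hx : x ∈ g.dom
  · ext v; simp [FibPlot.pull, hx]
  · simp [FibPlot.pull, hx]

/-- Smooth forms on the fibre. -/
def FibForm.IsSmooth (α : FibForm η z k W) : Prop :=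
  ∀ (n : ℕ) (g : FibPlot η z n), ContDiffOn ℝ ∞ (g.pull α) g.dom

/-- Compactly supported forms on the fibre. -/
def FibForm.IsCompactlySupported (α : FibForm η z k W) : Prop :=
  ∃ K : Set (Fib η z), IsCompact K ∧ ∀ p ∉ K, α p = 0

/-- `θ = dα` on the fibre: this holds after pulling back to Euclidean space along every smooth
map into the fibre (equivalently, in every chart of the fibre). -/
def FibForm.HasExtDeriv (α : FibForm η z k W) (θ : FibForm η z (k + 1) W) : Prop :=
  ∀ (n : ℕ) (g : FibPlot η z n), ∀ x ∈ g.dom,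
    DifferentiableAt ℝ (g.pull α) x ∧ extDeriv (g.pull α) x = g.pull θ x

theorem FibForm.hasExtDeriv_zero :
    FibForm.HasExtDeriv (0 : FibForm η z k W) (0 : FibForm η z (k + 1) W) := by
  intro n g x _
  rw [g.pull_zero, g.pull_zero]
  refine ⟨differentiableAt_const _, ?_⟩
  have := extDeriv_smul (x := x) (0 : ℝ)
    (0 : EuclideanSpace ℝ (Fin n) → EuclideanSpace ℝ (Fin n) [⋀^Fin k]→L[ℝ] W)
  simpa using this

theorem FibForm.HasExtDeriv.add {α α' : FibForm η z k W} {θ θ' : FibForm η z (k + 1) W}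
    (h : α.HasExtDeriv θ) (h' : α'.HasExtDeriv θ') : (α + α').HasExtDeriv (θ + θ') := by
  intro n g x hx
  obtain ⟨h1, h2⟩ := h n g x hx
  obtain ⟨h1', h2'⟩ := h' n g x hx
  rw [g.pull_add, g.pull_add]
  exact ⟨h1.add h1', by rw [extDeriv_add h1 h1', h2, h2']; rfl⟩

theorem extDeriv_complex_smul {E : Type*} [NormedAddCommGroup E] [NormedSpace ℝ E]
    (c : ℂ) {α : E → E [⋀^Fin k]→L[ℝ] W} {x : E} (h : DifferentiableAt ℝ α x) :
    extDeriv (c • α) x = c • extDeriv α x := by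
  have h' : DifferentiableAt ℝ (c • α) x := h.const_smul c
  ext v
  rw [extDeriv_apply h', ContinuousAlternatingMap.smul_apply, extDeriv_apply h, Finset.smul_sum]
  refine Finset.sum_congr rfl fun i _ => ?_
  have hd : DifferentiableAt ℝ (fun y => α y (i.removeNth v)) x :=
    h.continuousAlternatingMap_apply_const _
  have : (fun y => (c • α) y (i.removeNth v)) = c • fun y => α y (i.removeNth v) := by
    funext y; simp
  rw [this, fderiv_const_smul hd, _root_.smul_apply, smul_comm]

theorem FibForm.HasExtDeriv.smul {α : FibForm η z k W} {θ : FibForm η z (k + 1) W} (c : ℂ)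
    (h : α.HasExtDeriv θ) : (c • α).HasExtDeriv (c • θ) := by
  intro n g x hx
  obtain ⟨h1, h2⟩ := h n g x hx
  rw [g.pull_smul, g.pull_smul]
  exact ⟨h1.const_smul c, by rw [extDeriv_complex_smul c h1, h2]; rfl⟩

theorem FibForm.IsCompactlySupported.add {α α' : FibForm η z k W}
    (h : α.IsCompactlySupported) (h' : α'.IsCompactlySupported) :
    (α + α').IsCompactlySupported := by
  obtain ⟨K, hK, h⟩ := h
  obtain ⟨K', hK', h'⟩ := h'
  refine ⟨K ∪ K', hK.union hK', fun p hp => ?_⟩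
  rw [Set.mem_union, not_or] at hp
  simp [h p hp.1, h' p hp.2]

variable (η z k W) in
/-- `Ω^k_c(η⁻¹(z); W)`: smooth compactly supported `W`-valued `k`-forms on the fibre. -/
def FibOmegaC : Submodule ℂ (FibForm η z k W) where
  carrier := {α | α.IsSmooth ∧ α.IsCompactlySupported}
  zero_mem' := ⟨fun n g => by rw [g.pull_zero]; exact contDiffOn_const,
    ∅, isCompact_empty, fun _ _ => rfl⟩
  add_mem' h h' := ⟨fun n g => by rw [g.pull_add]; exact (h.1 n g).add (h'.1 n g), h.2.add h'.2⟩
  smul_mem' c α h := ⟨fun n g => by rw [g.pull_smul]; exact (h.1 n g).const_smul c, by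
    obtain ⟨K, hK, h⟩ := h.2
    exact ⟨K, hK, fun p hp => by simp [h p hp]⟩⟩

variable (η z k W) in
/-- Closed forms in `Ω^k_c(η⁻¹(z))`. -/
def FibCocycles : Submodule ℂ (FibForm η z k W) where
  carrier := {α | α ∈ FibOmegaC η z k W ∧ α.HasExtDeriv 0}
  zero_mem' := ⟨zero_mem _, FibForm.hasExtDeriv_zero⟩
  add_mem' h h' := ⟨add_mem h.1 h'.1, by simpa using h.2.add h'.2⟩
  smul_mem' c _ h := ⟨Submodule.smul_mem _ c h.1, by simpa using h.2.smul c⟩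

variable (η z W) in
/-- Exact forms: `d Ω^{k-1}_c(η⁻¹(z))`, which is `0` for `k = 0`. -/
def FibCoboundaries : (k : ℕ) → Submodule ℂ (FibForm η z k W)
  | 0 => ⊥
  | k + 1 =>
    { carrier := {α | ∃ θ ∈ FibOmegaC η z k W, FibForm.HasExtDeriv θ α}
      zero_mem' := ⟨0, zero_mem _, FibForm.hasExtDeriv_zero⟩
      add_mem' := by
        rintro _ _ ⟨θ, h1, h2⟩ ⟨θ', h1', h2'⟩
        exact ⟨θ + θ', add_mem h1 h1', h2.add h2'⟩
      smul_mem' := by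
        rintro c _ ⟨θ, h1, h2⟩
        exact ⟨c • θ, Submodule.smul_mem _ c h1, h2.smul c⟩ }

variable (η z k W) in
/-- The compactly supported de Rham cohomology `H^k_c(η⁻¹(z); W)`; for `W = ℂ` it is the
usual complex one. -/
abbrev FibHc : Type _ :=
  FibCocycles η z k W ⧸ (FibCoboundaries η z W k).submoduleOf (FibCocycles η z k W)

end Fibres

section Trivializations

variable {EF EZ : Type*} [NormedAddCommGroup EF] [NormedSpace ℝ EF]
  [NormedAddCommGroup EZ] [NormedSpace ℝ EZ]
  (ES : Type*) [NormedAddCommGroup ES] [NormedSpace ℝ ES]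
  {F Z : Type*} [TopologicalSpace F] [ChartedSpace EF F]
  [TopologicalSpace Z] [ChartedSpace EZ Z]
  (S : Type*) [TopologicalSpace S] [ChartedSpace ES S]

/-- A smooth local trivialization of `η` with typical fibre `S`: a diffeomorphism
`η⁻¹(U) ≅ U × S` over the open set `U = baseSet`. -/
structure SmoothTriv (η : C^∞⟮𝓘(ℝ, EF), F; 𝓘(ℝ, EZ), Z⟯)
    extends Trivialization S (η : F → Z) where
  smooth_toFun : ContMDiffOn 𝓘(ℝ, EF) (𝓘(ℝ, EZ).prod 𝓘(ℝ, ES)) ∞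
    toTrivialization.toOpenPartialHomeomorph toTrivialization.source
  smooth_invFun : ContMDiffOn (𝓘(ℝ, EZ).prod 𝓘(ℝ, ES)) 𝓘(ℝ, EF) ∞
    toTrivialization.toOpenPartialHomeomorph.symm toTrivialization.target

/-- `η` is a smooth fibre bundle with typical fibre `S`. -/
def IsSmoothFibreBundle (η : C^∞⟮𝓘(ℝ, EF), F; 𝓘(ℝ, EZ), Z⟯) : Prop :=
  ∀ z : Z, ∃ e : SmoothTriv ES S η, z ∈ e.baseSet

variable {ES S} {η : C^∞⟮𝓘(ℝ, EF), F; 𝓘(ℝ, EZ), Z⟯} {k n : ℕ}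
  {W : Type*} [NormedAddCommGroup W] [NormedSpace ℂ W]

/-- The map `η⁻¹(U) → η⁻¹(z)`, `e⁻¹(z₀, s) ↦ e⁻¹(z, s)`. For `z₀, z ∈ U` it restricts to the
diffeomorphism `η⁻¹(z₀) ≅ η⁻¹(z)` given by the trivialization. -/
def SmoothTriv.move (e : SmoothTriv ES S η) (z : Z) (p : F) : F :=
  e.toOpenPartialHomeomorph.symm (z, (e.toOpenPartialHomeomorph p).2)

variable (e : SmoothTriv ES S η) {z z₀ : Z}

theorem SmoothTriv.mem_target (hz : z ∈ e.baseSet) (s : S) :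
    (z, s) ∈ e.toTrivialization.target := by
  rw [e.target_eq]; exact ⟨hz, trivial⟩

theorem SmoothTriv.mem_source (hz : z ∈ e.baseSet) {p : F} (hp : η p = z) :
    p ∈ e.toTrivialization.source := by
  rw [e.source_eq]; subst hp; exact hz

theorem SmoothTriv.map_move (hz : z ∈ e.baseSet) (p : F) : η (e.move z p) = z := by
  have h := e.mem_target hz (e.toOpenPartialHomeomorph p).2
  have h2 := e.proj_toFun _ (e.toOpenPartialHomeomorph.map_target h)
  rw [e.toOpenPartialHomeomorph.right_inv h] at h2
  exact h2.symm

theorem SmoothTriv.move_smooth (hz : z ∈ e.baseSet) :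
    ContMDiffOn 𝓘(ℝ, EF) 𝓘(ℝ, EF) ∞ (e.move z) e.toTrivialization.source := by
  have h1 : ContMDiffOn 𝓘(ℝ, EF) (𝓘(ℝ, EZ).prod 𝓘(ℝ, ES)) ∞
      (fun p => (z, (e.toOpenPartialHomeomorph p).2)) e.toTrivialization.source :=
    contMDiffOn_const.prodMk (contMDiff_snd.comp_contMDiffOn e.smooth_toFun)
  exact e.smooth_invFun.comp h1 fun p _ => e.mem_target hz _

theorem SmoothTriv.move_move (hz : z ∈ e.baseSet) (hz₀ : z₀ ∈ e.baseSet) {p : F}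
    (hp : η p = z₀) : e.move z₀ (e.move z p) = p := by
  have hs := e.mem_source hz₀ hp
  have h := e.mem_target hz (e.toOpenPartialHomeomorph p).2
  unfold SmoothTriv.move
  rw [e.toOpenPartialHomeomorph.right_inv h]
  have : (z₀, (e.toOpenPartialHomeomorph p).2) = e.toOpenPartialHomeomorph p :=
    Prod.ext (by rw [e.proj_toFun p hs, hp]) rfl
  simp only
  rw [this, e.toOpenPartialHomeomorph.left_inv hs]

/-- The derivative of `η⁻¹(z₀) → η⁻¹(z)`. -/
def SmoothTriv.moveDeriv (hz₀ : z₀ ∈ e.baseSet) (hz : z ∈ e.baseSet) (p : Fib η z₀) :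
    Vert η p.1 →L[ℝ] Vert η (e.move z p.1) :=
  ContinuousLinearMap.codRestrict
    ((mfderiv 𝓘(ℝ, EF) 𝓘(ℝ, EF) (e.move z) p.1).comp (Vert η p.1).subtypeL)
    (Vert η (e.move z p.1))
    (fun v => mfderiv_mem_vert e.toTrivialization.open_source (e.move_smooth hz)
      (fun q _ => e.map_move hz q) (e.mem_source hz₀ p.2) v.1)

/-- Pullback of forms along the diffeomorphism `η⁻¹(z₀) ≅ η⁻¹(z)`. -/
def SmoothTriv.pullForm (hz₀ : z₀ ∈ e.baseSet) (hz : z ∈ e.baseSet) (k : ℕ)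
    (W : Type*) [NormedAddCommGroup W] [NormedSpace ℂ W] :
    FibForm η z k W →ₗ[ℂ] FibForm η z₀ k W where
  toFun α p := (α ⟨e.move z p.1, e.map_move hz p.1⟩).compContinuousLinearMap
    (e.moveDeriv hz₀ hz p)
  map_add' _ _ := rfl
  map_smul' _ _ := rfl

/-- The composite of a plot of `η⁻¹(z₀)` with `η⁻¹(z₀) ≅ η⁻¹(z)`. -/
def SmoothTriv.movePlot (hz₀ : z₀ ∈ e.baseSet) (hz : z ∈ e.baseSet) (g : FibPlot η z₀ n) :
    FibPlot η z n where
  dom := g.dom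
  isOpen_dom := g.isOpen_dom
  toFun := e.move z ∘ g.toFun
  contMDiffOn := (e.move_smooth hz).comp g.contMDiffOn
    fun x hx => e.mem_source hz₀ (g.mapsTo x hx)
  mapsTo x _ := e.map_move hz (g.toFun x)

theorem SmoothTriv.pull_pullForm (hz₀ : z₀ ∈ e.baseSet) (hz : z ∈ e.baseSet)
    (g : FibPlot η z₀ n) (α : FibForm η z k W) :
    g.pull (e.pullForm hz₀ hz k W α) = (e.movePlot hz₀ hz g).pull α := by
  funext x
  by_cases hx : x ∈ g.dom
  · have hx' : x ∈ (e.movePlot hz₀ hz g).dom := hx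
    have hs := e.mem_source hz₀ (g.mapsTo x hx)
    have hg : MDifferentiableAt 𝓘(ℝ, EuclideanSpace ℝ (Fin n)) 𝓘(ℝ, EF) g.toFun x :=
      (g.contMDiffOn.contMDiffAt (g.isOpen_dom.mem_nhds hx)).mdifferentiableAt (by simp)
    have hm : MDifferentiableAt 𝓘(ℝ, EF) 𝓘(ℝ, EF) (e.move z) (g.toFun x) :=
      ((e.move_smooth hz).contMDiffAt
        (e.toTrivialization.open_source.mem_nhds hs)).mdifferentiableAt (by simp)
    have hc := mfderiv_comp x hm hg
    simp only [FibPlot.pull, hx, hx', dif_pos]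
    ext v
    simp only [ContinuousAlternatingMap.compContinuousLinearMap_apply]
    refine congrArg (α ⟨e.move z (g.toFun x), e.map_move hz _⟩) ?_
    funext i
    apply Subtype.ext
    exact (congrArg (fun L => L (v i)) hc).symm
  · have hx' : x ∉ (e.movePlot hz₀ hz g).dom := hx
    simp [FibPlot.pull, hx, hx']

theorem SmoothTriv.pullForm_hasExtDeriv (hz₀ : z₀ ∈ e.baseSet) (hz : z ∈ e.baseSet)
    {α : FibForm η z k W} {θ : FibForm η z (k + 1) W} (h : α.HasExtDeriv θ) :
    FibForm.HasExtDeriv (e.pullForm hz₀ hz k W α) (e.pullForm hz₀ hz (k + 1) W θ) := by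
  intro n g x hx
  rw [e.pull_pullForm, e.pull_pullForm]
  exact h n (e.movePlot hz₀ hz g) x hx

theorem SmoothTriv.pullForm_omegaC (hz₀ : z₀ ∈ e.baseSet) (hz : z ∈ e.baseSet)
    {α : FibForm η z k W} (h : α ∈ FibOmegaC η z k W) :
    e.pullForm hz₀ hz k W α ∈ FibOmegaC η z₀ k W := by
  refine ⟨fun n g => ?_, ?_⟩
  · rw [e.pull_pullForm]
    exact h.1 n (e.movePlot hz₀ hz g)
  · obtain ⟨K, hK, hα⟩ := h.2
    have hcont : Continuous fun q : Fib η z => (⟨e.move z₀ q.1, e.map_move hz₀ q.1⟩ : Fib η z₀) := by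
      refine Continuous.subtype_mk ?_ _
      exact (e.move_smooth hz₀).continuousOn.comp_continuous continuous_subtype_val
        fun q => e.mem_source hz q.2
    refine ⟨_, hK.image hcont, fun p hp => ?_⟩
    have : (⟨e.move z p.1, e.map_move hz p.1⟩ : Fib η z) ∉ K := fun hmem =>
      hp ⟨_, hmem, Subtype.ext (e.move_move hz hz₀ p.2)⟩
    change (α ⟨e.move z p.1, e.map_move hz p.1⟩).compContinuousLinearMap
      (e.moveDeriv hz₀ hz p) = 0
    rw [hα _ this]
    rfl

theorem SmoothTriv.pullForm_cocycles (hz₀ : z₀ ∈ e.baseSet) (hz : z ∈ e.baseSet) :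
    ∀ α ∈ FibCocycles η z k W, e.pullForm hz₀ hz k W α ∈ FibCocycles η z₀ k W := fun α h =>
  ⟨e.pullForm_omegaC hz₀ hz h.1, by simpa using e.pullForm_hasExtDeriv hz₀ hz h.2⟩

theorem SmoothTriv.pullForm_coboundaries (hz₀ : z₀ ∈ e.baseSet) (hz : z ∈ e.baseSet) :
    ∀ {k : ℕ}, ∀ α ∈ FibCoboundaries η z W k,
      e.pullForm hz₀ hz k W α ∈ FibCoboundaries η z₀ W k
  | 0, α, h => by
    have h0 : α = 0 := h
    rw [h0, map_zero]; exact zero_mem _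
  | _ + 1, _, ⟨θ, h1, h2⟩ =>
    ⟨_, e.pullForm_omegaC hz₀ hz h1, e.pullForm_hasExtDeriv hz₀ hz h2⟩

open Classical in
/-- The identification `H^k_c(η⁻¹(z)) → H^k_c(η⁻¹(z₀))` given by the local trivialization `e`:
pullback along the diffeomorphism `η⁻¹(z₀) ≅ η⁻¹(z)` (and `0` unless `z₀` and `z` both lie in the
base set of `e`). -/
def SmoothTriv.transport (e : SmoothTriv ES S η) (k : ℕ) (W : Type*)
    [NormedAddCommGroup W] [NormedSpace ℂ W] (z₀ z : Z) :
    FibHc η z k W →ₗ[ℂ] FibHc η z₀ k W :=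
  if h : z₀ ∈ e.baseSet ∧ z ∈ e.baseSet then
    Submodule.mapQ _ _
      ((e.pullForm h.1 h.2 k W).restrict (e.pullForm_cocycles h.1 h.2))
      (fun α hα => e.pullForm_coboundaries h.1 h.2 α.1 hα)
  else 0

end Trivializations

section Bundles

variable {EF EZ : Type*} [NormedAddCommGroup EF] [NormedSpace ℝ EF]
  [NormedAddCommGroup EZ] [NormedSpace ℝ EZ]
  {F Z : Type*} [TopologicalSpace F] [ChartedSpace EF F] [IsManifold 𝓘(ℝ, EF) ∞ F]
  [TopologicalSpace Z] [ChartedSpace EZ Z]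
  (EV : Type*) [NormedAddCommGroup EV] [NormedSpace ℂ EV]
  {V : Z → Type*} [∀ z, AddCommGroup (V z)] [∀ z, Module ℂ (V z)]
  [∀ z, TopologicalSpace (V z)] [∀ z, IsTopologicalAddGroup (V z)]
  [∀ z, ContinuousSMul ℂ (V z)] [TopologicalSpace (TotalSpace EV V)]

section Smooth

variable [FiberBundle EV V] [VectorBundle ℂ EV V]

/-- A fibrewise complex-linear operation preserves smoothness: sums. -/
theorem contMDiffWithinAt_add {EM M : Type*} [NormedAddCommGroup EM] [NormedSpace ℝ EM]
    [TopologicalSpace M] [ChartedSpace EM M] {b : M → Z} {u v : ∀ x, V (b x)} {O : Set M} {x : M}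
    (hu : ContMDiffWithinAt 𝓘(ℝ, EM) (𝓘(ℝ, EZ).prod 𝓘(ℝ, EV)) ∞
      (fun x => (⟨b x, u x⟩ : TotalSpace EV V)) O x)
    (hv : ContMDiffWithinAt 𝓘(ℝ, EM) (𝓘(ℝ, EZ).prod 𝓘(ℝ, EV)) ∞
      (fun x => (⟨b x, v x⟩ : TotalSpace EV V)) O x) :
    ContMDiffWithinAt 𝓘(ℝ, EM) (𝓘(ℝ, EZ).prod 𝓘(ℝ, EV)) ∞
      (fun x => (⟨b x, u x + v x⟩ : TotalSpace EV V)) O x := by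
  rw [contMDiffWithinAt_totalSpace] at hu hv ⊢
  refine ⟨hu.1, ?_⟩
  have hmem : ∀ᶠ y in nhdsWithin x (insert x O), b y ∈ (trivializationAt EV V (b x)).baseSet := by
    have hb : ContinuousWithinAt b (insert x O) x := hu.1.continuousWithinAt.insert
    exact hb ((trivializationAt EV V (b x)).open_baseSet.mem_nhds
      (mem_baseSet_trivializationAt EV V (b x)))
  have key := (hu.2.add hv.2)
  refine ContMDiffWithinAt.congr_of_eventuallyEq key
    (Filter.Eventually.filter_mono (nhdsWithin_mono _ (Set.subset_insert x O))
      (hmem.mono fun y hy => ?_)) ?_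
  · exact ((trivializationAt EV V (b x)).linear ℂ hy).1 _ _
  · have hy := hmem.self_of_nhdsWithin (Set.mem_insert x O)
    exact ((trivializationAt EV V (b x)).linear ℂ hy).1 _ _

/-- A fibrewise complex-linear operation preserves smoothness: scalar multiples. -/
theorem contMDiffWithinAt_smul {EM M : Type*} [NormedAddCommGroup EM] [NormedSpace ℝ EM]
    [TopologicalSpace M] [ChartedSpace EM M] {b : M → Z} {u : ∀ x, V (b x)} {O : Set M} {x : M}
    (c : ℂ)
    (hu : ContMDiffWithinAt 𝓘(ℝ, EM) (𝓘(ℝ, EZ).prod 𝓘(ℝ, EV)) ∞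
      (fun x => (⟨b x, u x⟩ : TotalSpace EV V)) O x) :
    ContMDiffWithinAt 𝓘(ℝ, EM) (𝓘(ℝ, EZ).prod 𝓘(ℝ, EV)) ∞
      (fun x => (⟨b x, c • u x⟩ : TotalSpace EV V)) O x := by
  rw [contMDiffWithinAt_totalSpace] at hu ⊢
  refine ⟨hu.1, ?_⟩
  have hmem : ∀ᶠ y in nhdsWithin x (insert x O), b y ∈ (trivializationAt EV V (b x)).baseSet := by
    have hb : ContinuousWithinAt b (insert x O) x := hu.1.continuousWithinAt.insert
    exact hb ((trivializationAt EV V (b x)).open_baseSet.mem_nhds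
      (mem_baseSet_trivializationAt EV V (b x)))
  have hc : ContMDiff 𝓘(ℝ, EV) 𝓘(ℝ, EV) ∞ fun w : EV => c • w :=
    (contDiff_id.const_smul c).contMDiff
  have key := ((hc.contMDiffAt).comp_contMDiffWithinAt x hu.2)
  refine ContMDiffWithinAt.congr_of_eventuallyEq key
    (Filter.Eventually.filter_mono (nhdsWithin_mono _ (Set.subset_insert x O))
      (hmem.mono fun y hy => ?_)) ?_
  · exact ((trivializationAt EV V (b x)).linear ℂ hy).2 _ _
  · have hy := hmem.self_of_nhdsWithin (Set.mem_insert x O)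
    exact ((trivializationAt EV V (b x)).linear ℂ hy).2 _ _

theorem contMDiffWithinAt_zero {EM M : Type*} [NormedAddCommGroup EM] [NormedSpace ℝ EM]
    [TopologicalSpace M] [ChartedSpace EM M] {b : M → Z} {O : Set M} {x : M}
    (hb : ContMDiffWithinAt 𝓘(ℝ, EM) 𝓘(ℝ, EZ) ∞ b O x) :
    ContMDiffWithinAt 𝓘(ℝ, EM) (𝓘(ℝ, EZ).prod 𝓘(ℝ, EV)) ∞
      (fun x => (⟨b x, 0⟩ : TotalSpace EV V)) O x := by
  rw [contMDiffWithinAt_totalSpace]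
  refine ⟨hb, ?_⟩
  have hmem : ∀ᶠ y in nhdsWithin x (insert x O), b y ∈ (trivializationAt EV V (b x)).baseSet := by
    have hb : ContinuousWithinAt b (insert x O) x := hb.continuousWithinAt.insert
    exact hb ((trivializationAt EV V (b x)).open_baseSet.mem_nhds
      (mem_baseSet_trivializationAt EV V (b x)))
  have key : ContMDiffWithinAt 𝓘(ℝ, EM) 𝓘(ℝ, EV) ∞ (fun _ => (0 : EV)) O x :=
    contMDiffWithinAt_const
  refine ContMDiffWithinAt.congr_of_eventuallyEq key
    (Filter.Eventually.filter_mono (nhdsWithin_mono _ (Set.subset_insert x O))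
      (hmem.mono fun y hy => ?_)) ?_
  · exact ((trivializationAt EV V (b x)).linear ℂ hy).mk'.map_zero
  · have hy := hmem.self_of_nhdsWithin (Set.mem_insert x O)
    exact ((trivializationAt EV V (b x)).linear ℂ hy).mk'.map_zero

end Smooth

variable (V) in
/-- Arbitrary sections over `F` of `Λ^k C^{0,1} ⊗ η^*V`. Here `C^{1,0} = η^* E^1_Z` is the
annihilator of the complexified vertical tangent bundle, so `C^{0,1} = E^1_F / C^{1,0}` is the dual
of the latter, and an element of `(Λ^k C^{0,1})_p ⊗ V_{η(p)}` is the same as a real-multilinear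
alternating map from the (real) vertical tangent space to the complex vector space `V_{η(p)}`. -/
def RelForm (η : C^∞⟮𝓘(ℝ, EF), F; 𝓘(ℝ, EZ), Z⟯) (k : ℕ) : Type _ :=
  ∀ p : F, Vert η p [⋀^Fin k]→L[ℝ] V (η p)

instance (η : C^∞⟮𝓘(ℝ, EF), F; 𝓘(ℝ, EZ), Z⟯) (k : ℕ) : AddCommGroup (RelForm V η k) :=
  inferInstanceAs (AddCommGroup (∀ p : F, Vert η p [⋀^Fin k]→L[ℝ] V (η p)))

instance (η : C^∞⟮𝓘(ℝ, EF), F; 𝓘(ℝ, EZ), Z⟯) (k : ℕ) : Module ℂ (RelForm V η k) :=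
  inferInstanceAs (Module ℂ (∀ p : F, Vert η p [⋀^Fin k]→L[ℝ] V (η p)))

variable {η : C^∞⟮𝓘(ℝ, EF), F; 𝓘(ℝ, EZ), Z⟯} {k : ℕ}

@[simp] theorem RelForm.zero_apply (p : F) : (0 : RelForm V η k) p = 0 := rfl

@[simp] theorem RelForm.add_apply (α β : RelForm V η k) (p : F) : (α + β) p = α p + β p := rfl

@[simp] theorem RelForm.smul_apply (c : ℂ) (α : RelForm V η k) (p : F) :
    (c • α) p = c • α p := rfl

/-- The complex-valued form `l ∘ α` on the fibre over `z`, where `l` is a family of functionals on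
the fibres of `V` (only `l z` matters). -/
def RelForm.restrict (α : RelForm V η k) (l : ∀ z, V z →L[ℂ] ℂ) (z : Z) : FibForm η z k ℂ :=
  fun p => ((l (η p.1)).restrictScalars ℝ).compContinuousAlternatingMap (α p.1)

/-- `θ` is the image of `α` under the relative exterior derivative: on each fibre `η⁻¹(z)`, where
`η^*V` is the trivial bundle with fibre the vector space `V_z`, `θ` is the exterior derivative of
the `V_z`-valued form `α`, tested with all functionals on `V_z`. -/
def RelForm.HasRelDeriv (α : RelForm V η k) (θ : RelForm V η (k + 1)) : Prop :=
  ∀ (l : ∀ z, V z →L[ℂ] ℂ) (z : Z), (α.restrict l z).HasExtDeriv (θ.restrict l z)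

/-- Smooth sections: the value on any smooth vertical vector fields is smooth. -/
def RelForm.IsSmooth [FiberBundle EV V] (α : RelForm V η k) : Prop :=
  ∀ X : Fin k → ∀ p : F, Vert η p,
    (∀ i, ContMDiff 𝓘(ℝ, EF) 𝓘(ℝ, EF).tangent ∞
      (fun p => (⟨p, (X i p : TangentSpace 𝓘(ℝ, EF) p)⟩ : TangentBundle 𝓘(ℝ, EF) F))) →
    ContMDiff 𝓘(ℝ, EF) (𝓘(ℝ, EZ).prod 𝓘(ℝ, EV)) ∞
      (fun p => (⟨η p, α p fun i => X i p⟩ : TotalSpace EV V))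

/-- Compactly supported relative forms. -/
def RelForm.IsCompactlySupported (α : RelForm V η k) : Prop :=
  ∃ K : Set F, IsCompact K ∧ ∀ p ∉ K, α p = 0

theorem RelForm.hasRelDeriv_zero :
    RelForm.HasRelDeriv (0 : RelForm V η k) (0 : RelForm V η (k + 1)) := by
  intro l z
  have h : ∀ j, RelForm.restrict (0 : RelForm V η j) l z = 0 := by
    intro j; funext p; ext v; simp [RelForm.restrict]
  rw [h, h]
  exact FibForm.hasExtDeriv_zero

theorem RelForm.restrict_add (α θ : RelForm V η k) (l : ∀ z, V z →L[ℂ] ℂ) (z : Z) :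
    RelForm.restrict (α + θ) l z = α.restrict l z + θ.restrict l z := by
  funext p; ext v; simp [RelForm.restrict]

theorem RelForm.restrict_smul (c : ℂ) (α : RelForm V η k) (l : ∀ z, V z →L[ℂ] ℂ) (z : Z) :
    RelForm.restrict (c • α) l z = c • α.restrict l z := by
  funext p; ext v; simp [RelForm.restrict]

theorem RelForm.HasRelDeriv.add {α α' : RelForm V η k} {θ θ' : RelForm V η (k + 1)}
    (h : α.HasRelDeriv θ) (h' : α'.HasRelDeriv θ') :
    RelForm.HasRelDeriv (α + α') (θ + θ') := by
  intro l z
  rw [RelForm.restrict_add, RelForm.restrict_add]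
  exact (h l z).add (h' l z)

theorem RelForm.HasRelDeriv.smul {α : RelForm V η k} {θ : RelForm V η (k + 1)} (c : ℂ)
    (h : α.HasRelDeriv θ) : RelForm.HasRelDeriv (c • α) (c • θ) := by
  intro l z
  rw [RelForm.restrict_smul, RelForm.restrict_smul]
  exact (h l z).smul c

variable [FiberBundle EV V] [VectorBundle ℂ EV V]

variable (V η k) in
/-- `Γ_c(F, C^{0,k} ⊗ η^*V)`. -/
def RelOmegaC : Submodule ℂ (RelForm V η k) where
  carrier := {α | RelForm.IsSmooth EV α ∧ RelForm.IsCompactlySupported α}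
  zero_mem' := ⟨fun X _ p => contMDiffWithinAt_zero EV (η.contMDiff p).contMDiffWithinAt,
    ∅, isCompact_empty, fun _ _ => rfl⟩
  add_mem' h h' := ⟨fun X hX p => contMDiffWithinAt_add EV (h.1 X hX p) (h'.1 X hX p), by
    obtain ⟨K, hK, h⟩ := h.2
    obtain ⟨K', hK', h'⟩ := h'.2
    refine ⟨K ∪ K', hK.union hK', fun p hp => ?_⟩
    rw [Set.mem_union, not_or] at hp
    simp [h p hp.1, h' p hp.2]⟩
  smul_mem' c α h := ⟨fun X hX p => contMDiffWithinAt_smul EV c (h.1 X hX p), by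
    obtain ⟨K, hK, h⟩ := h.2
    exact ⟨K, hK, fun p hp => by simp [h p hp]⟩⟩

variable (V η k) in
/-- Relatively closed forms in `Γ_c(F, C^{0,k} ⊗ η^*V)`. -/
def RelCocycles : Submodule ℂ (RelForm V η k) where
  carrier := {α | α ∈ RelOmegaC EV V η k ∧ RelForm.HasRelDeriv α 0}
  zero_mem' := ⟨zero_mem _, RelForm.hasRelDeriv_zero⟩
  add_mem' h h' := ⟨add_mem h.1 h'.1, by simpa using h.2.add h'.2⟩
  smul_mem' c _ h := ⟨Submodule.smul_mem _ c h.1, by simpa using h.2.smul c⟩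

variable (V η) in
/-- The image of `Γ_c(F, C^{0,k-1} ⊗ η^*V)` under the relative derivative; `0` for `k = 0`. -/
def RelCoboundaries : (k : ℕ) → Submodule ℂ (RelForm V η k)
  | 0 => ⊥
  | k + 1 =>
    { carrier := {α | ∃ θ ∈ RelOmegaC EV V η k, RelForm.HasRelDeriv θ α}
      zero_mem' := ⟨0, zero_mem _, RelForm.hasRelDeriv_zero⟩
      add_mem' := by
        rintro _ _ ⟨θ, h1, h2⟩ ⟨θ', h1', h2'⟩
        exact ⟨θ + θ', add_mem h1 h1', h2.add h2'⟩
      smul_mem' := by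
        rintro c _ ⟨θ, h1, h2⟩
        exact ⟨c • θ, Submodule.smul_mem _ c h1, h2.smul c⟩ }

variable (V η k) in
/-- The compactly supported involutive (relative de Rham) cohomology `H^k_{C,c}(F, η^*V)`. -/
abbrev RelHc : Type _ :=
  RelCocycles EV V η k ⧸ (RelCoboundaries EV V η k).submoduleOf (RelCocycles EV V η k)

variable (ES : Type*) [NormedAddCommGroup ES] [NormedSpace ℝ ES]
  (S : Type*) [TopologicalSpace S] [ChartedSpace ES S]

/-- The local trivializations of `η` induce compatible smooth vector bundle charts on the family
`z ↦ H^k_c(η⁻¹(z))`: a local section that is constant in one of the charts is smooth in the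
others. (Each chart is a fibrewise linear isomorphism onto a fixed fibre `H^k_c(η⁻¹(z₀))`; a
function with values in this finite-dimensional space is smooth if all its compositions with linear
functionals are.) -/
def HcIsSmoothBundle (η : C^∞⟮𝓘(ℝ, EF), F; 𝓘(ℝ, EZ), Z⟯) (k : ℕ) : Prop :=
  ∀ (e e' : SmoothTriv ES S η) (z₀ z₁ : Z), z₀ ∈ e.baseSet → z₁ ∈ e'.baseSet →
    ∀ (c : FibHc η z₁ k ℂ) (l : FibHc η z₀ k ℂ →ₗ[ℂ] ℂ),
      ContMDiffOn 𝓘(ℝ, EZ) 𝓘(ℝ, ℂ) ∞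
        (fun z => l (e.transport k ℂ z₀ z (e'.transport k ℂ z z₁ c))) (e.baseSet ∩ e'.baseSet)

/-- For `u ∈ H^k_c(η⁻¹(z)) ⊗ V_z` and a functional `l` on `H^k_c(η⁻¹(z₀))`: the element of `V_z`
obtained by applying the chart `e` of the cohomology bundle, then `l`, to the first factor. -/
def chartCoord {ES S} [NormedAddCommGroup ES] [NormedSpace ℝ ES]
    [TopologicalSpace S] [ChartedSpace ES S] (e : SmoothTriv ES S η) {z₀ : Z}
    (l : FibHc η z₀ k ℂ →ₗ[ℂ] ℂ) (z : Z) : FibHc η z k ℂ ⊗[ℂ] V z →ₗ[ℂ] V z :=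
  (TensorProduct.lid ℂ (V z)).toLinearMap ∘ₗ
    LinearMap.rTensor (V z) (l ∘ₗ e.transport k ℂ z₀ z)

variable (V η k) in
/-- `Γ_c(Z, H^k_c ⊗ V)`: compactly supported sections that are smooth with respect to the bundle
charts of `H^k_c` induced by the local trivializations of `η`. -/
def CohSectionsC : Submodule ℂ (∀ z, FibHc η z k ℂ ⊗[ℂ] V z) where
  carrier := {s | (∀ (e : SmoothTriv ES S η) (z₀ : Z), z₀ ∈ e.baseSet →
      ∀ l : FibHc η z₀ k ℂ →ₗ[ℂ] ℂ,
        ContMDiffOn 𝓘(ℝ, EZ) (𝓘(ℝ, EZ).prod 𝓘(ℝ, EV)) ∞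
          (fun z => (⟨z, chartCoord e l z (s z)⟩ : TotalSpace EV V)) e.baseSet) ∧
    ∃ K : Set Z, IsCompact K ∧ ∀ z ∉ K, s z = 0}
  zero_mem' := ⟨fun e z₀ _ l z _ => by
    simpa using contMDiffWithinAt_zero EV (V := V) (b := fun z : Z => z) contMDiffWithinAt_id,
    ∅, isCompact_empty, fun _ _ => rfl⟩
  add_mem' h h' := ⟨fun e z₀ hz₀ l z hz => by
    simpa using contMDiffWithinAt_add EV (h.1 e z₀ hz₀ l z hz) (h'.1 e z₀ hz₀ l z hz), by
    obtain ⟨K, hK, h⟩ := h.2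
    obtain ⟨K', hK', h'⟩ := h'.2
    refine ⟨K ∪ K', hK.union hK', fun p hp => ?_⟩
    rw [Set.mem_union, not_or] at hp
    simp [h p hp.1, h' p hp.2]⟩
  smul_mem' c α h := ⟨fun e z₀ hz₀ l z hz => by
    simpa using contMDiffWithinAt_smul EV c (h.1 e z₀ hz₀ l z hz), by
    obtain ⟨K, hK, h⟩ := h.2
    exact ⟨K, hK, fun p hp => by simp [h p hp]⟩⟩

/-- `id ⊗ l : H^k_c(η⁻¹(z)) ⊗ V_z → H^k_c(η⁻¹(z))` for a functional `l` on `V_z`. -/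
def contractV (z : Z) (l : V z →L[ℂ] ℂ) : FibHc η z k ℂ ⊗[ℂ] V z →ₗ[ℂ] FibHc η z k ℂ :=
  (TensorProduct.rid ℂ (FibHc η z k ℂ)).toLinearMap ∘ₗ
    LinearMap.lTensor (FibHc η z k ℂ) (l : V z →ₗ[ℂ] ℂ)

end Bundles

end RelDeRham

end

noncomputable section

set_option linter.unusedSectionVars false

namespace RelDeRham

open MeasureTheory Set Filter Topology

/-! ### Calculus of forms on a vector space: parameters, contraction, translation -/

section Calculus

/-! Over the domain of a local trivialization and of a chart of the base, a compactly supported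
relative form, cut off by a function of the base and paired with a functional on the model fibre of
`V`, becomes a smooth family of forms on the typical fibre `S`, with parameter in a vector space and
supports in one compact set. Everything rests on a Künneth statement for such families (`Kun`,
`kun_univ`): a family that is closed for each parameter is the sum of a family of finite rank, `Σ
fᵢ(w) cᵢ` with fixed closed forms `cᵢ`, and of the exterior derivative of a smooth family with
common compact support.

The Künneth statement is proved by Mayer–Vietoris. On boxes in charts it is the Poincaré lemma for
compact supports with parameters (`box_poincare`), which integrates out one coordinate at a time.
`Kun.union` passes from `U`, `V`, `U ∩ V` to `U ∪ V`. Since supports are compact, finitely many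
boxes suffice for each family (`kun_of_basis`), whatever the size of `S`.

No topology on spaces of forms and no closed range theorem enters. They are replaced by an algebraic
device, `finiteRank_mem_span`: if all values of `Σ fᵢ cᵢ` lie in a subspace `N`, a linear projection
onto `N`, applied to the vectors `cᵢ` only, shows that the `cᵢ` may be taken in `N`. With `N` the
exact forms, a finite-rank family that is exact for each parameter has a smooth family of primitives
(`mem_famBd_of_slices`).

There are three consequences. The class of a closed family is `Σ fᵢ [cᵢ]`, which depends smoothly on
the parameter; so restriction to fibres yields smooth sections (`SmoothTriv.contMDiffAt_class`), and
applied to a fixed form times a cutoff this also shows that the transition maps of the cohomology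
bundle are smooth (`hcIsSmoothBundle`). If the class vanishes on every fibre, the finite-rank part
is exact for each parameter, hence smoothly exact; a partition of unity on `Z`, whose functions are
constant along the fibres, glues the primitives, so the kernel of restriction consists of
coboundaries (`mem_relCoboundaries_of_restrict`). Finally, a finite basis of the cohomology of a
fibre is represented by closed forms `cⱼ` on `S`; a section is locally `Σ [cⱼ] ⊗ bⱼ`, which lifts to
the closed relative form `Σ cⱼ ⊗ bⱼ`, and the lifts are glued in the same way
(`restrictSection_surjective`). -/

theorem contDiff_integral_zero_one {X Y : Type*} [NormedAddCommGroup X] [NormedSpace ℝ X]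
    [NormedAddCommGroup Y] [NormedSpace ℝ Y]
    {g : X → ℝ → Y} (hg : ContDiff ℝ ∞ (fun q : X × ℝ => g q.1 q.2)) :
    ContDiff ℝ ∞ (fun x => ∫ s in (0 : ℝ)..1, g x s) := by
  -- The integral is the value at `0` of the convolution of the indicator of `(0, 1]` with `t ↦ b t
  -- • g x (-t)`, and convolutions with a parameter are smooth. The bump is `1` on the ball of
  -- radius `2`, hence on `[-1, 0]`, and supplies the compact support that the convolution theorem
  -- requires.
  let b : ContDiffBump (0 : ℝ) := ⟨2, 3, by norm_num, by norm_num⟩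
  let h : X → ℝ → Y := fun x t => b t • g x (-t)
  let f : ℝ → ℝ := indicator (Ioc 0 1) 1
  have hf : LocallyIntegrable f volume := by
    apply Integrable.locallyIntegrable
    refine (integrable_indicator_iff measurableSet_Ioc).2 ?_
    exact integrableOn_const (by simp)
  have hh : ContDiffOn ℝ ∞ (Function.HasUncurry.uncurry h) (univ ×ˢ univ) := by
    have : ContDiff ℝ ∞ (fun q : X × ℝ => b q.2 • g q.1 (-q.2)) :=
      (b.contDiff.comp contDiff_snd).smul
        (hg.comp (contDiff_fst.prodMk contDiff_snd.neg))
    exact this.contDiffOn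
  have key := contDiffOn_convolution_right_with_param (μ := volume) (n := ⊤)
    (ContinuousLinearMap.lsmul ℝ ℝ) (f := f)
    (g := h) (s := univ) isOpen_univ (isCompact_closedBall (0 : ℝ) 3)
    (fun p x _ hx => by
      have : b x = 0 := by
        apply b.zero_of_le_dist
        rw [Metric.mem_closedBall, not_le] at hx
        exact hx.le
      simp [h, this]) hf hh
  rw [univ_prod_univ, contDiffOn_univ] at key
  have h2 := key.comp (contDiff_id.prodMk (contDiff_const (c := (0 : ℝ))) : ContDiff ℝ ∞ _)
  refine (congrArg (ContDiff ℝ ∞) ?_).mpr h2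
  funext x
  simp only [Function.comp, id, convolution_def, f]
  rw [intervalIntegral.integral_of_le zero_le_one, ← integral_indicator measurableSet_Ioc]
  congr 1
  funext t
  by_cases ht : t ∈ Ioc (0 : ℝ) 1
  · have : b (0 - t) = 1 := by
      apply b.one_of_mem_closedBall
      rw [Metric.mem_closedBall, Real.dist_eq, abs_le]
      change -2 ≤ _ ∧ _ ≤ (2 : ℝ)
      constructor <;> linarith [ht.1, ht.2]
    simp [ht, h]
    simpa using (by simpa using this : b (-t) = 1) ▸ (one_smul ℝ (g x t)).symm
  · simp [ht]

variable {E G X W : Type*} [NormedAddCommGroup E] [NormedSpace ℝ E] [NormedAddCommGroup G]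
  [NormedSpace ℝ G] [NormedAddCommGroup X] [NormedSpace ℝ X] [NormedAddCommGroup W]
  [NormedSpace ℝ W] {k : ℕ}

theorem contDiff_altMap_apply [CompleteSpace W] :
    ContDiff ℝ ∞ (fun q : (E [⋀^Fin k]→L[ℝ] W) × (Fin k → E) => q.1 q.2) := by
  have : ∀ q, AnalyticAt ℝ (fun q : (E [⋀^Fin k]→L[ℝ] W) × (Fin k → E) =>
      ContinuousAlternatingMap.toContinuousMultilinearMapCLM ℝ q.1 q.2) q := fun q =>
    ContinuousLinearMap.analyticAt_uncurry_of_multilinear _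
  exact contDiff_iff_contDiffAt.2 fun q => (this q).contDiffAt

/-- Evaluation at a tuple of vectors as a continuous linear map. -/
def altEval (W : Type*) [NormedAddCommGroup W] [NormedSpace ℝ W] (v : Fin k → E) :
    (E [⋀^Fin k]→L[ℝ] W) →L[ℝ] W :=
  (ContinuousMultilinearMap.apply ℝ (fun _ : Fin k => E) W v).comp
    (ContinuousAlternatingMap.toContinuousMultilinearMapCLM ℝ)

/-- An alternating map is determined by its values on tuples of basis vectors. These values embed
the alternating maps linearly into a finite product of copies of `W`, and a linear left inverse is
continuous there. -/
theorem contDiffWithinAt_altMap_iff [FiniteDimensional ℝ E] [FiniteDimensional ℝ W]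
    {f : X → E [⋀^Fin k]→L[ℝ] W} {s : Set X} {x : X} :
    ContDiffWithinAt ℝ ∞ f s x ↔ ∀ v, ContDiffWithinAt ℝ ∞ (fun y => f y v) s x := by
  constructor
  · intro h v
    exact (altEval W v).contDiff.contDiffAt.comp_contDiffWithinAt x h
  · intro h
    let b := Module.finBasis ℝ E
    let L : (E [⋀^Fin k]→L[ℝ] W) →ₗ[ℝ] ((Fin k → Fin (Module.finrank ℝ E)) → W) :=
      LinearMap.pi fun I => (altEval W fun i => b (I i)).toLinearMap
    have hL : LinearMap.ker L = ⊥ := by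
      rw [LinearMap.ker_eq_bot]
      intro f g hfg
      apply ContinuousAlternatingMap.toAlternatingMap_injective
      apply AlternatingMap.coe_multilinearMap_injective
      refine Module.Basis.ext_multilinear (fun _ => b) fun I => ?_
      exact congrFun hfg I
    have : FiniteDimensional ℝ (E [⋀^Fin k]→L[ℝ] W) :=
      FiniteDimensional.of_injective L (LinearMap.ker_eq_bot.1 hL)
    obtain ⟨M, hM⟩ := L.exists_leftInverse_of_injective hL
    have h1 : ContDiffWithinAt ℝ ∞ (fun y => L (f y)) s x := by
      rw [contDiffWithinAt_pi]
      intro I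
      exact h _
    have h2 := (LinearMap.toContinuousLinearMap M).contDiff.contDiffAt.comp_contDiffWithinAt x h1
    refine h2.congr (fun y _ => ?_) ?_ <;> exact (LinearMap.congr_fun hM _).symm

theorem minSmoothness_two_le : minSmoothness ℝ 2 ≤ (∞ : WithTop ℕ∞) := by
  rw [minSmoothness_of_isRCLikeNormedField]; exact WithTop.coe_le_coe.2 le_top

theorem extDeriv_zero_fun (x : E) : extDeriv (fun _ : E => (0 : E [⋀^Fin k]→L[ℝ] W)) x = 0 := by
  simp [extDeriv]
  ext v
  simp [ContinuousAlternatingMap.alternatizeUncurryFin_apply]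

set_option synthInstance.maxHeartbeats 200000 in
theorem contDiff_extDeriv {α : X → E → E [⋀^Fin k]→L[ℝ] W}
    (h : ContDiff ℝ ∞ fun q : X × E => α q.1 q.2) :
    ContDiff ℝ ∞ fun q : X × E => extDeriv (α q.1) q.2 := by
  have h1 : ContDiff ℝ ∞ (fun q : X × E => fderiv ℝ (α q.1) q.2) :=
    ContDiff.fderiv (f := fun (q : X × E) => α q.1)
      (h.comp ((contDiff_fst.comp contDiff_fst).prodMk contDiff_snd)) contDiff_snd le_rfl
  exact (ContinuousAlternatingMap.alternatizeUncurryFinCLM (n := k) ℝ E W).contDiff.comp h1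

/-- The form `α` is annihilated by contraction with `u`. -/
def Kills (u : E) (α : E [⋀^Fin k]→L[ℝ] W) : Prop := ∀ v : Fin k → E, ∀ m, v m = u → α v = 0

/-- By alternation, slot `m` can be swapped with slot `0` at the cost of a sign. -/
theorem Kills.of_head {u : E} {α : E [⋀^Fin (k + 1)]→L[ℝ] W}
    (h : ∀ v : Fin (k + 1) → E, v 0 = u → α v = 0) : Kills u α := by
  intro v m hm
  by_cases h0 : m = 0
  · subst h0; exact h v hm
  · have := α.toAlternatingMap.map_swap v (i := 0) (j := m) (Ne.symm h0)
    have h1 : α.toAlternatingMap (v ∘ Equiv.swap 0 m) = 0 := h _ (by simp [hm])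
    rw [h1] at this
    exact neg_eq_zero.1 this.symm

/-- In the alternating sum for `dα(v)`, the term that differentiates along `v l` with `l ≠ m` keeps
`v m = u` as an argument of `α`, so it vanishes. Only the derivative along `u` survives. -/
theorem extDeriv_apply_of_kills {α : E → E [⋀^Fin k]→L[ℝ] W} {x u : E}
    (hd : DifferentiableAt ℝ α x) (hk : ∀ y, Kills u (α y)) (v : Fin (k + 1) → E) (m : Fin (k + 1))
    (hm : v m = u) :
    extDeriv α x v = (-1) ^ m.val • fderiv ℝ (α · (m.removeNth v)) x u := by
  rw [extDeriv_apply hd, Finset.sum_eq_single m, hm]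
  · intro l _ hl
    have : (fun y => α y (l.removeNth v)) = fun _ => 0 := by
      funext y
      obtain ⟨m', hm'⟩ := Fin.exists_succAbove_eq (Ne.symm hl)
      exact hk y _ m' (by simp [Fin.removeNth, hm', hm])
    rw [this]
    simp
  · simp

theorem eq_of_fderiv_eq_zero_along {u : E} {g : E → W} (hg : Differentiable ℝ g)
    (h : ∀ x, fderiv ℝ g x u = 0) (x : E) (t : ℝ) : g (x + t • u) = g x := by
  have hd : ∀ s : ℝ, HasDerivAt (fun s : ℝ => g (x + s • u)) 0 s := by
    intro s
    have h1 : HasDerivAt (fun s : ℝ => x + s • u) u s := by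
      simpa using ((hasDerivAt_id s).smul_const u).const_add x
    have := (hg (x + s • u)).hasFDerivAt.comp_hasDerivAt s h1
    rwa [h] at this
  have := is_const_of_deriv_eq_zero (fun s => (hd s).differentiableAt) (fun s => (hd s).deriv) t 0
  simpa using this

/-- A closed form annihilated by contraction with `u` is invariant under translation along `u`. -/
theorem translate_eq_of_closed {u : E} {α : E → E [⋀^Fin k]→L[ℝ] W} (hs : Differentiable ℝ α)
    (hk : ∀ y, Kills u (α y)) (hc : ∀ y, extDeriv α y = 0) (x : E) (t : ℝ) :
    α (x + t • u) = α x := by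
  ext v
  refine eq_of_fderiv_eq_zero_along (g := fun y => α y v)
    (fun y => (altEval W v).differentiableAt.comp y (hs y)) (fun y => ?_) x t
  -- Cartan's formula in disguise: with `u` in slot `0`, `dα(u, v)` is the derivative of `α(v)`
  -- along `u`, and `dα = 0`.
  have := extDeriv_apply_of_kills (hs y) hk (Fin.cons u v) 0 (by simp)
  rw [hc] at this
  simpa using this.symm

end Calculus

/-! ### Basic families of forms on Euclidean space and their supports -/

section Euclidean

/-- Euclidean `n`-space. -/
abbrev Eu (n : ℕ) : Type := EuclideanSpace ℝ (Fin n)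

/-- Families of complex-valued `k`-forms on Euclidean space with parameters in `P`. -/
abbrev EuFam (P : Type*) (n k : ℕ) : Type _ := P → Eu n → Eu n [⋀^Fin k]→L[ℝ] ℂ

variable {P : Type*} [NormedAddCommGroup P] [NormedSpace ℝ P] {n k : ℕ}

/-- The exterior derivative of a family, taken for each value of the parameter. -/
def euD (α : EuFam P n k) : EuFam P n (k + 1) := fun w x => extDeriv (α w) x

/-- The `i`-th standard unit vector. -/
def unitVec (i : Fin n) : Eu n := EuclideanSpace.single i 1

@[simp] theorem unitVec_self (i : Fin n) : unitVec i i = 1 := by simp [unitVec]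

theorem unitVec_ne {i j : Fin n} (h : j ≠ i) : unitVec i j = 0 := by simp [unitVec, h]

/-- Smooth families which are pulled back from the quotient by the first `j` coordinates. -/
structure IsBasic (j : ℕ) (α : EuFam P n k) : Prop where
  smooth : ContDiff ℝ ∞ fun q : P × Eu n => α q.1 q.2
  inv : ∀ i : Fin n, i.val < j → ∀ w x (t : ℝ), α w (x + t • unitVec i) = α w x
  kills : ∀ i : Fin n, i.val < j → ∀ w x, Kills (unitVec i) (α w x)

/-- The support in the coordinates from the `j`-th on is in a compact subset of the open box with
corners `a`, `b`. -/
def SuppBox (a b : Fin n → ℝ) (j : ℕ) (α : EuFam P n k) : Prop :=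
  ∃ a' b' : Fin n → ℝ, (∀ i, a i < a' i) ∧ (∀ i, b' i < b i) ∧
    ∀ w x (i : Fin n), j ≤ i.val → (x i < a' i ∨ b' i < x i) → α w x = 0

theorem smooth_slice {α : EuFam P n k} (h : ContDiff ℝ ∞ fun q : P × Eu n => α q.1 q.2) (w : P) :
    ContDiff ℝ ∞ (α w) :=
  h.comp (contDiff_const.prodMk contDiff_id)

theorem smooth_slice_diff {α : EuFam P n k} (h : ContDiff ℝ ∞ fun q : P × Eu n => α q.1 q.2)
    (w : P) : Differentiable ℝ (α w) :=
  (smooth_slice h w).differentiable (by simp)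

theorem IsBasic.diff {j : ℕ} {α : EuFam P n k} (h : IsBasic j α) (w : P) :
    Differentiable ℝ (α w) := smooth_slice_diff h.smooth w

theorem SuppBox.add {a b : Fin n → ℝ} {j : ℕ} {α β : EuFam P n k} (hα : SuppBox a b j α)
    (hβ : SuppBox a b j β) : SuppBox a b j (α + β) := by
  obtain ⟨a', b', h1, h2, h3⟩ := hα
  obtain ⟨a'', b'', h1', h2', h3'⟩ := hβ
  refine ⟨fun i => min (a' i) (a'' i), fun i => max (b' i) (b'' i),
    fun i => lt_min (h1 i) (h1' i), fun i => max_lt (h2 i) (h2' i), fun w x i hi h => ?_⟩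
  rw [lt_min_iff, max_lt_iff] at h
  change α w x + β w x = 0
  rw [h3 w x i hi (h.imp And.left And.left), h3' w x i hi (h.imp And.right And.right), add_zero]

variable (P n k) in
/-- The space of basic families. -/
def basicM (j : ℕ) : Submodule ℂ (EuFam P n k) where
  carrier := {α | IsBasic j α}
  zero_mem' := ⟨contDiff_const, fun _ _ _ _ _ => rfl, fun _ _ _ _ _ _ _ => rfl⟩
  add_mem' h h' := ⟨h.smooth.add h'.smooth,
    fun i hi w x t => congrArg₂ (· + ·) (h.inv i hi w x t) (h'.inv i hi w x t),
    fun i hi w x v m hm => by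
      simp [h.kills i hi w x v m hm, h'.kills i hi w x v m hm]⟩
  smul_mem' c _ h := ⟨h.smooth.const_smul c,
    fun i hi w x t => congrArg (c • ·) (h.inv i hi w x t),
    fun i hi w x v m hm => by simp [h.kills i hi w x v m hm]⟩

variable (P k) in
/-- The space of basic families with support in a box modulo the first `j` coordinates. -/
def boxM (a b : Fin n → ℝ) (j : ℕ) : Submodule ℂ (EuFam P n k) where
  carrier := {α | IsBasic j α ∧ SuppBox a b j α}
  zero_mem' := ⟨(basicM P n k j).zero_mem, fun i => a i + 1, fun i => b i - 1, by simp, by simp,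
    fun _ _ _ _ _ => rfl⟩
  add_mem' h h' := ⟨(basicM P n k j).add_mem h.1 h'.1, h.2.add h'.2⟩
  smul_mem' c α h := ⟨(basicM P n k j).smul_mem c h.1, by
    obtain ⟨a', b', h1, h2, h3⟩ := h.2
    exact ⟨a', b', h1, h2, fun w x i hi hx => by simp [h3 w x i hi hx]⟩⟩

theorem euD_add {α β : EuFam P n k} (hα : ContDiff ℝ ∞ fun q : P × Eu n => α q.1 q.2)
    (hβ : ContDiff ℝ ∞ fun q : P × Eu n => β q.1 q.2) : euD (α + β) = euD α + euD β := by
  funext w x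
  exact extDeriv_add (smooth_slice_diff hα w x) (smooth_slice_diff hβ w x)

theorem euD_smul {α : EuFam P n k} (hα : ContDiff ℝ ∞ fun q : P × Eu n => α q.1 q.2) (f : P → ℂ) :
    euD (fun w => f w • α w) = fun w => f w • euD α w := by
  funext w x
  exact extDeriv_complex_smul (f w) (smooth_slice_diff hα w x)

theorem euD_const_smul {α : EuFam P n k} (hα : ContDiff ℝ ∞ fun q : P × Eu n => α q.1 q.2) (c : ℂ) :
    euD (c • α) = c • euD α := euD_smul hα fun _ => c

theorem euD_sub {α β : EuFam P n k} (hα : ContDiff ℝ ∞ fun q : P × Eu n => α q.1 q.2)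
    (hβ : ContDiff ℝ ∞ fun q : P × Eu n => β q.1 q.2) : euD (α - β) = euD α - euD β := by
  have h : α - β = α + (-1 : ℂ) • β := by
    rw [sub_eq_add_neg]; exact congrArg (α + ·) (neg_one_smul ℂ β).symm
  rw [h, euD_add hα (hβ.const_smul (-1 : ℂ)), euD_const_smul hβ, sub_eq_add_neg]
  exact congrArg (euD α + ·) (neg_one_smul ℂ (euD β))

theorem euD_euD {α : EuFam P n k} (hα : ContDiff ℝ ∞ fun q : P × Eu n => α q.1 q.2) :
    euD (euD α) = 0 := by
  funext w x
  exact extDeriv_extDeriv_apply (smooth_slice hα w).contDiffAt minSmoothness_two_le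

theorem euD_congr_nhds {α β : EuFam P n k} {w : P} {x : Eu n} (h : α w =ᶠ[𝓝 x] β w) :
    euD α w x = euD β w x := h.extDeriv_eq

theorem euD_eq_zero {α : EuFam P n k} {w : P} {x : Eu n} (h : ∀ᶠ y in 𝓝 x, α w y = 0) :
    euD α w x = 0 := by
  have : α w =ᶠ[𝓝 x] fun _ => 0 := h
  exact this.extDeriv_eq.trans (extDeriv_zero_fun x)

theorem extDeriv_comp_add {E W : Type*} [NormedAddCommGroup E] [NormedSpace ℝ E]
    [NormedAddCommGroup W] [NormedSpace ℝ W] (f : E → E [⋀^Fin k]→L[ℝ] W) (x u : E) :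
    extDeriv (fun y => f (y + u)) x = extDeriv f (x + u) := by
  simp [extDeriv, fderiv_comp_add_right]

/-- Translations commute with `d`, so invariance persists. The contraction of `dα` with a unit
vector is, up to sign, the derivative of `α` along it, which is `0` by invariance. -/
theorem IsBasic.euD {j : ℕ} {α : EuFam P n k} (h : IsBasic j α) : IsBasic j (euD α) where
  smooth := contDiff_extDeriv h.smooth
  inv i hi w x t := by
    have := extDeriv_comp_add (α w) x (t • unitVec i)
    simp only [h.inv i hi w _ t] at this
    exact this.symm
  kills i hi w x v m hm := by
    change extDeriv (α w) x v = 0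
    rw [extDeriv_apply_of_kills (h.diff w x) (h.kills i hi w) v m hm]
    have : HasFDerivAt (fun y => α w y (m.removeNth v))
        (fderiv ℝ (fun y => α w y (m.removeNth v)) x) x :=
      DifferentiableAt.hasFDerivAt ((altEval ℂ (m.removeNth v)).differentiableAt.comp x (h.diff w x))
    have h1 : HasDerivAt (fun t : ℝ => x + t • unitVec i) (unitVec i) 0 := by
      simpa using ((hasDerivAt_id (0 : ℝ)).smul_const (unitVec i)).const_add x
    have h2 := HasFDerivAt.comp_hasDerivAt (0 : ℝ) (by simpa using this) h1
    have h3 : ((fun y => α w y (m.removeNth v)) ∘ fun t : ℝ => x + t • unitVec i) =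
        fun _ => α w x (m.removeNth v) := by
      funext t
      simp [h.inv i hi w x t]
    rw [h3] at h2
    rw [h2.unique (hasDerivAt_const _ _), smul_zero]

theorem eventually_coord_lt {x : Eu n} {i : Fin n} {c : ℝ} (h : x i < c) :
    ∀ᶠ y : Eu n in 𝓝 x, y i < c :=
  (EuclideanSpace.proj (𝕜 := ℝ) i).continuous.continuousAt.eventually_lt
    (g := fun _ => c) continuousAt_const h

theorem eventually_coord_gt {x : Eu n} {i : Fin n} {c : ℝ} (h : c < x i) :
    ∀ᶠ y : Eu n in 𝓝 x, c < y i :=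
  continuousAt_const.eventually_lt (f := fun _ => c)
    (EuclideanSpace.proj (𝕜 := ℝ) i).continuous.continuousAt h

theorem SuppBox.euD {a b : Fin n → ℝ} {j : ℕ} {α : EuFam P n k} (h : SuppBox a b j α) :
    SuppBox a b j (euD α) := by
  obtain ⟨a', b', h1, h2, h3⟩ := h
  refine ⟨a', b', h1, h2, fun w x i hi hx => euD_eq_zero ?_⟩
  rcases hx with hx | hx
  · filter_upwards [eventually_coord_lt hx] with y hy using h3 w y i hi (.inl hy)
  · filter_upwards [eventually_coord_gt hx] with y hy using h3 w y i hi (.inr hy)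

variable (P) in
/-- Exact families in `boxM`. -/
def boxBd (a b : Fin n → ℝ) (j : ℕ) : (k : ℕ) → Submodule ℂ (EuFam P n k)
  | 0 => ⊥
  | k + 1 =>
    { carrier := {α | ∃ β ∈ boxM P k a b j, euD β = α}
      zero_mem' := ⟨0, zero_mem _, funext fun _ => funext fun x => extDeriv_zero_fun x⟩
      add_mem' := by
        rintro _ _ ⟨β, h, rfl⟩ ⟨β', h', rfl⟩
        exact ⟨β + β', add_mem h h', euD_add h.1.smooth h'.1.smooth⟩
      smul_mem' := by
        rintro c _ ⟨β, h, rfl⟩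
        exact ⟨c • β, Submodule.smul_mem _ c h, euD_const_smul h.1.smooth c⟩ }

variable (P k) in
/-- Families of finite rank: linear combinations of products of functions of the parameter with
closed forms. -/
def boxFin (a b : Fin n → ℝ) (j : ℕ) : Submodule ℂ (EuFam P n k) :=
  Submodule.span ℂ {α | ∃ f : P → ℂ, ContDiff ℝ ∞ f ∧ ∃ c : Eu n → Eu n [⋀^Fin k]→L[ℝ] ℂ,
    (fun _ => c) ∈ boxM P k a b j ∧ euD (fun _ : P => c) = 0 ∧ α = fun w => f w • c}

/-- Multiplication of a family by a function of the `i`-th coordinate. -/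
def cutMul (i : Fin n) (χ : ℝ → ℝ) (α : EuFam P n k) : EuFam P n k := fun w x => χ (x i) • α w x

theorem cutMul_smooth {i : Fin n} {χ : ℝ → ℝ} (hχ : ContDiff ℝ ∞ χ) {α : EuFam P n k}
    (h : ContDiff ℝ ∞ fun q : P × Eu n => α q.1 q.2) :
    ContDiff ℝ ∞ fun q : P × Eu n => cutMul i χ α q.1 q.2 :=
  (hχ.comp ((EuclideanSpace.proj (𝕜 := ℝ) i).contDiff.comp contDiff_snd)).smul h

theorem IsBasic.cutMul {j : ℕ} {i : Fin n} (hi : j ≤ i.val) {χ : ℝ → ℝ} (hχ : ContDiff ℝ ∞ χ)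
    {α : EuFam P n k} (h : IsBasic j α) : IsBasic j (cutMul i χ α) where
  smooth := cutMul_smooth hχ h.smooth
  inv l hl w x t := by
    have : i ≠ l := by rintro rfl; omega
    simp [RelDeRham.cutMul, h.inv l hl w x t, unitVec_ne this]
  kills l hl w x v m hm := by simp [RelDeRham.cutMul, h.kills l hl w x v m hm]

theorem IsBasic.mono {j j' : ℕ} (hj : j' ≤ j) {α : EuFam P n k} (h : IsBasic j α) : IsBasic j' α :=
  ⟨h.smooth, fun i hi => h.inv i (hi.trans_le hj), fun i hi => h.kills i (hi.trans_le hj)⟩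

end Euclidean

/-! ### Integration along one coordinate -/

section Poincare

/-- Contraction with `u` as a continuous linear map. -/
def contract {E : Type*} [NormedAddCommGroup E] [NormedSpace ℝ E] {k : ℕ} (u : E) :
    (E [⋀^Fin (k + 1)]→L[ℝ] ℂ) →L[ℝ] (E [⋀^Fin k]→L[ℝ] ℂ) :=
  (ContinuousLinearMap.apply ℝ (E [⋀^Fin k]→L[ℝ] ℂ) u).comp
    (ContinuousAlternatingMap.curryLeftLI (𝕜 := ℝ) (E := E) (F := ℂ) (n := k)).toContinuousLinearMap

theorem contract_apply {E : Type*} [NormedAddCommGroup E] [NormedSpace ℝ E] {k : ℕ} (u : E)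
    (f : E [⋀^Fin (k + 1)]→L[ℝ] ℂ) (v : Fin k → E) : contract u f v = f (Fin.cons u v) := rfl

variable {P : Type*} [NormedAddCommGroup P] [NormedSpace ℝ P] {n k : ℕ}

/-- Integration of the contraction with the `i`-th unit vector along the `i`-th coordinate. -/
def prim (i : Fin n) (a : ℝ) (α : EuFam P n (k + 1)) : EuFam P n k := fun w x =>
  ∫ τ in a..x i, contract (unitVec i) (α w (x + (τ - x i) • unitVec i))

variable {i : Fin n} {a : ℝ} {α : EuFam P n (k + 1)}

theorem prim_smooth (h : ContDiff ℝ ∞ fun q : P × Eu n => α q.1 q.2) :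
    ContDiff ℝ ∞ fun q : P × Eu n => prim i a α q.1 q.2 := by
  have hp : ContDiff ℝ ∞ fun x : Eu n => x i := (EuclideanSpace.proj (𝕜 := ℝ) i).contDiff
  -- The substitution `τ = a + (x i - a) s` makes the limits of integration constant, so that
  -- `contDiff_integral_zero_one` applies.
  have h1 : ∀ q : P × Eu n, prim i a α q.1 q.2 = (q.2 i - a) • ∫ s in (0 : ℝ)..1,
      contract (unitVec i) (α q.1 (q.2 + (a + (q.2 i - a) * s - q.2 i) • unitVec i)) := by
    intro q
    rw [intervalIntegral.smul_integral_comp_add_mul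
      (fun τ => contract (unitVec i) (α q.1 (q.2 + (τ - q.2 i) • unitVec i)))]
    simp [prim]
  rw [show (fun q : P × Eu n => prim i a α q.1 q.2) = _ from funext h1]
  refine ((hp.comp contDiff_snd).sub contDiff_const).smul (contDiff_integral_zero_one ?_)
  have h2 : ContDiff ℝ ∞ fun q : (P × Eu n) × ℝ => q.1.2 i :=
    hp.comp (contDiff_snd.comp contDiff_fst)
  have h3 : ContDiff ℝ ∞ fun q : (P × Eu n) × ℝ =>
      (q.1.1, q.1.2 + (a + (q.1.2 i - a) * q.2 - q.1.2 i) • unitVec i) :=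
    (contDiff_fst.comp contDiff_fst).prodMk ((contDiff_snd.comp contDiff_fst).add
      (((contDiff_const.add ((h2.sub contDiff_const).mul contDiff_snd)).sub h2).smul
        contDiff_const))
  exact (contract (unitVec i)).contDiff.comp (h.comp h3)

theorem continuous_prim_integrand (h : ContDiff ℝ ∞ fun q : P × Eu n => α q.1 q.2) (w : P)
    (x : Eu n) : Continuous fun τ : ℝ => contract (unitVec i) (α w (x + (τ - x i) • unitVec i)) :=
  (contract (unitVec i)).continuous.comp ((smooth_slice h w).continuous.comp (by fun_prop))

/-- The integrand depends only on the line through `x` in direction `i`, so moving `x` along this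
line changes only the upper limit. This prepares the fundamental theorem of calculus in
`fderiv_prim`. -/
theorem prim_translate (w : P) (x : Eu n) (t : ℝ) : prim i a α w (x + t • unitVec i) =
    ∫ τ in a..x i + t, contract (unitVec i) (α w (x + (τ - x i) • unitVec i)) := by
  simp only [prim, PiLp.add_apply, PiLp.smul_apply, unitVec_self, smul_eq_mul, mul_one]
  congr 1
  funext τ
  congr 2
  rw [add_assoc, ← add_smul]
  congr 2
  ring

theorem fderiv_prim (h : ContDiff ℝ ∞ fun q : P × Eu n => α q.1 q.2) (w : P) (x : Eu n) :
    fderiv ℝ (prim i a α w) x (unitVec i) = contract (unitVec i) (α w x) := by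
  have h1 : HasDerivAt (fun t : ℝ => x + t • unitVec i) (unitVec i) 0 := by
    simpa using ((hasDerivAt_id (0 : ℝ)).smul_const (unitVec i)).const_add x
  have h0 : HasFDerivAt (prim i a α w) (fderiv ℝ (prim i a α w) x) (x + (0 : ℝ) • unitVec i) := by
    simpa using (smooth_slice_diff (prim_smooth h) w x).hasFDerivAt
  have h2 := h0.comp_hasDerivAt (0 : ℝ) h1
  have h3 : (prim i a α w ∘ fun t : ℝ => x + t • unitVec i) = fun t : ℝ =>
      ∫ τ in a..x i + t, contract (unitVec i) (α w (x + (τ - x i) • unitVec i)) :=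
    funext fun t => prim_translate w x t
  rw [h3] at h2
  have hc := continuous_prim_integrand (i := i) h w x
  have h4 : HasDerivAt (fun r : ℝ => ∫ τ in a..r, contract (unitVec i)
      (α w (x + (τ - x i) • unitVec i))) _ (x i + 0) :=
    intervalIntegral.integral_hasDerivAt_right (hc.intervalIntegrable _ _)
      (hc.stronglyMeasurableAtFilter _ _) hc.continuousAt
  have h5 := h4.comp_const_add (x i) 0
  have h6 := h2.unique h5
  simpa using h6

theorem prim_apply (h : ContDiff ℝ ∞ fun q : P × Eu n => α q.1 q.2) (w : P) (x : Eu n)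
    (v : Fin k → Eu n) : prim i a α w x v =
      ∫ τ in a..x i, α w (x + (τ - x i) • unitVec i) (Fin.cons (unitVec i) v) := by
  have := (altEval ℂ v).intervalIntegral_comp_comm
    ((continuous_prim_integrand (i := i) h w x).intervalIntegrable (μ := volume) a (x i))
  exact this.symm

theorem prim_kills_self (h : ContDiff ℝ ∞ fun q : P × Eu n => α q.1 q.2) (w : P) (x : Eu n) :
    Kills (unitVec i) (prim i a α w x) := by
  intro v m hm
  rw [prim_apply h]
  have : ∀ τ : ℝ, α w (x + (τ - x i) • unitVec i) (Fin.cons (unitVec i) v) = 0 := fun τ =>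
    (α w (x + (τ - x i) • unitVec i)).toAlternatingMap.map_eq_zero_of_eq _
      (i := 0) (j := m.succ) (by simp [hm]) (Fin.succ_ne_zero m).symm
  simp [this]

theorem IsBasic.prim {j : ℕ} (hj : j ≤ i.val) (h : IsBasic j α) : IsBasic j (prim i a α) where
  smooth := prim_smooth h.smooth
  inv l hl w x t := by
    have hne : i ≠ l := by rintro rfl; omega
    have hx : (x + t • unitVec l) i = x i := by simp [unitVec_ne hne]
    simp only [RelDeRham.prim, hx]
    congr 1
    funext τ
    rw [add_right_comm, h.inv l hl]
  kills l hl w x v m hm := by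
    rw [prim_apply h.smooth]
    have : ∀ τ : ℝ, α w (x + (τ - x i) • unitVec i) (Fin.cons (unitVec i) v) = 0 := fun τ =>
      h.kills l hl w _ _ m.succ (by simp [hm])
    simp [this]

theorem prim_eq_zero_of_lt {a' : ℝ} (ha : a < a')
    (h : ∀ w x, x i < a' → α w x = 0) {w : P} {x : Eu n} (hx : x i < a') :
    prim i a α w x = 0 := by
  unfold prim
  rw [intervalIntegral.integral_congr (g := fun _ => 0)]
  · simp
  · intro τ hτ
    have : τ < a' := by
      rcases le_total a (x i) with h' | h'
      · rw [uIcc_of_le h'] at hτ; exact hτ.2.trans_lt hx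
      · rw [uIcc_of_ge h'] at hτ; exact hτ.2.trans_lt ha
    change contract _ (α w _) = 0
    rw [h w _ (by simpa using this), map_zero]

theorem prim_eq_zero_of_other {l : Fin n} (hl : l ≠ i) {s : Set ℝ}
    (h : ∀ w x, x l ∈ s → α w x = 0) {w : P} {x : Eu n} (hx : x l ∈ s) :
    prim i a α w x = 0 := by
  unfold prim
  rw [intervalIntegral.integral_congr (g := fun _ => 0)]
  · simp
  · intro τ _
    change contract _ (α w _) = 0
    rw [h w _ (by simpa [unitVec_ne hl] using hx), map_zero]

/-- The value of `prim` beyond the support is constant along the `i`-th coordinate. -/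
theorem prim_eq_of_gt (hs : ContDiff ℝ ∞ fun q : P × Eu n => α q.1 q.2) {b b' : ℝ} (hb : b' < b)
    (h : ∀ w x, b' < x i → α w x = 0) {w : P} {x : Eu n} (hx : b' < x i) :
    prim i a α w (x + (b - x i) • unitVec i) = prim i a α w x := by
  rw [prim_translate, prim, add_sub_cancel]
  have hc := continuous_prim_integrand (i := i) hs w x
  rw [← sub_eq_zero, intervalIntegral.integral_interval_sub_left (hc.intervalIntegrable _ _)
    (hc.intervalIntegrable _ _), intervalIntegral.integral_congr (g := fun _ => 0)]
  · simp
  · intro τ hτ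
    have : b' < τ := by
      rcases le_total b (x i) with h' | h'
      · rw [uIcc_of_ge h'] at hτ; exact hb.trans_le hτ.1
      · rw [uIcc_of_le h'] at hτ; exact hx.trans_le hτ.1
    change contract _ (α w _) = 0
    rw [h w _ (by simpa using this), map_zero]

/-- The integral of a closed form along the `i`-th coordinate is a primitive. -/
theorem euD_prim (hs : ContDiff ℝ ∞ fun q : P × Eu n => α q.1 q.2) (hc : euD α = 0) {a' : ℝ}
    (ha : a < a') (h : ∀ w x, x i < a' → α w x = 0) : euD (prim i a α) = α := by
  have hps := prim_smooth (i := i) (a := a) hs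
  -- The error `δ` is closed, and it is killed by the `i`-th unit vector because of `fderiv_prim`;
  -- so it is invariant along the `i`-th coordinate. It vanishes where this coordinate is less than
  -- `a'`, hence everywhere.
  set δ : EuFam P n (k + 1) := euD (prim i a α) - α with hδ
  have hds : ContDiff ℝ ∞ fun q : P × Eu n => δ q.1 q.2 := (contDiff_extDeriv hps).sub hs
  have hdk : ∀ w x, Kills (unitVec i) (δ w x) := by
    intro w x
    refine Kills.of_head fun v hv => ?_
    have h1 := extDeriv_apply_of_kills (smooth_slice_diff hps w x) (prim_kills_self hs w) v 0 hv
    have h2 : fderiv ℝ (fun y => prim i a α w y ((0 : Fin (k + 1)).removeNth v)) x (unitVec i) =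
        contract (unitVec i) (α w x) ((0 : Fin (k + 1)).removeNth v) := by
      rw [← fderiv_prim (a := a) hs w x]
      exact fderiv_continuousAlternatingMap_apply_const_apply (smooth_slice_diff hps w x) _ _
    rw [h2, contract_apply] at h1
    have h3 : Fin.cons (unitVec i) ((0 : Fin (k + 1)).removeNth v) = v := by
      rw [← hv]; exact Fin.cons_self_tail v
    rw [h3] at h1
    change extDeriv (prim i a α w) x v - α w x v = 0
    rw [h1]; simp
  have hdc : euD δ = 0 := by
    rw [hδ, euD_sub (contDiff_extDeriv hps) hs, euD_euD hps, hc, sub_zero]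
  have hz : ∀ w x, δ w x = 0 := by
    intro w x
    have h1 := translate_eq_of_closed (smooth_slice_diff hds w) (hdk w)
      (fun y => congrFun (congrFun hdc w) y) x (a' - 1 - x i)
    rw [← h1]
    have hlt : (x + (a' - 1 - x i) • unitVec i) i < a' := by simp
    change euD (prim i a α) w _ - α w _ = 0
    rw [h _ _ hlt, sub_zero]
    refine euD_eq_zero ?_
    filter_upwards [eventually_coord_lt hlt] with y hy using prim_eq_zero_of_lt ha h hy
  funext w x
  exact sub_eq_zero.1 (hz w x)

end Poincare

/-! ### Poincaré lemma with parameters for compact supports in a box -/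

section BoxLemma

variable {P : Type*} [NormedAddCommGroup P] [NormedSpace ℝ P] {n k : ℕ} {a b : Fin n → ℝ}

theorem cutMul_of_eq_zero {i : Fin n} {χ : ℝ → ℝ} {α : EuFam P n k} {w : P} {x : Eu n}
    (h : α w x = 0) : cutMul i χ α w x = 0 := by
  ext v; simp [cutMul, h]

theorem cutMul_of_cut_eq_zero {i : Fin n} {χ : ℝ → ℝ} {α : EuFam P n k} {w : P} {x : Eu n}
    (h : χ (x i) = 0) : cutMul i χ α w x = 0 := by
  ext v; simp [cutMul, h]

theorem cutMul_of_cut_eq_one {i : Fin n} {χ : ℝ → ℝ} {α : EuFam P n k} {w : P} {x : Eu n}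
    (h : χ (x i) = 1) : cutMul i χ α w x = α w x := by
  ext v; simp [cutMul, h]

theorem cutMul_add (i : Fin n) (χ : ℝ → ℝ) (α β : EuFam P n k) :
    cutMul i χ (α + β) = cutMul i χ α + cutMul i χ β := by
  funext w x; ext v; simp [cutMul]

theorem cutMul_smul (i : Fin n) (χ : ℝ → ℝ) (f : P → ℂ) (α : EuFam P n k) :
    cutMul i χ (fun w => f w • α w) = fun w => f w • cutMul i χ α w := by
  funext w x; ext v; simp [cutMul, mul_left_comm]

theorem euD_cutMul_zero (i : Fin n) (χ : ℝ → ℝ) : euD (cutMul i χ (0 : EuFam P n k)) = 0 := by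
  funext w x
  exact euD_eq_zero (Eventually.of_forall fun y => cutMul_of_eq_zero rfl)

theorem IsBasic.eq_at_zero {α : EuFam P n k} (h : IsBasic n α) (w : P) (x : Eu n) :
    α w x = α w 0 := by
  have key : ∀ s : Finset (Fin n), α w (∑ i ∈ s, x i • unitVec i) = α w 0 := by
    intro s
    induction s using Finset.induction_on with
    | empty => simp
    | insert i s hi ih =>
      rw [Finset.sum_insert hi, add_comm, h.inv i i.isLt, ih]
  have hx : ∑ i, x i • unitVec i = x := by
    ext l
    simp [unitVec, Finset.sum_apply, Pi.single_apply]
  rw [← key Finset.univ, hx]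

/-- Base of the induction. When all coordinates are basic, a `0`-form is a function of the parameter
times the constant `1`, and a form of positive degree is `0` because it vanishes on all tuples of
basis vectors. The support condition is vacuous for `j = n`. -/
theorem basic_all_mem_boxFin : ∀ {k : ℕ} {α : EuFam P n k}, IsBasic n α → α ∈ boxFin P k a b n
  | 0, α, h => by
    refine Submodule.subset_span ⟨fun w => α w 0 (fun i => i.elim0), ?_,
      fun _ => ContinuousAlternatingMap.constOfIsEmpty ℝ (Eu n) (Fin 0) 1, ?_, ?_, ?_⟩
    · have := h.smooth.comp (contDiff_id.prodMk (contDiff_const (c := (0 : Eu n))))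
      exact (altEval ℂ _).contDiff.comp this
    · exact ⟨⟨contDiff_const, fun _ _ _ _ _ => rfl, fun _ _ _ _ _ m => m.elim0⟩,
        fun i => a i + 1, fun i => b i - 1, by simp, by simp, fun _ _ i hi => by omega⟩
    · funext w x
      change extDeriv (fun y : Eu n => ContinuousAlternatingMap.constOfIsEmpty ℝ (Eu n)
        (Fin 0) ((fun _ => 1 : Eu n → ℂ) y)) x = 0
      rw [extDeriv_constOfIsEmpty]
      ext v
      simp
    · funext w x
      rw [h.eq_at_zero]
      ext v
      rw [Subsingleton.elim v (fun i => i.elim0)]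
      simp
  | k + 1, α, h => by
    have : α = 0 := by
      funext w x
      apply ContinuousAlternatingMap.toAlternatingMap_injective
      apply AlternatingMap.coe_multilinearMap_injective
      refine Module.Basis.ext_multilinear
        (fun _ => (EuclideanSpace.basisFun (Fin n) ℝ).toBasis) fun I => ?_
      refine h.kills (I 0) (I 0).isLt w x _ 0 ?_
      simp [unitVec]
    rw [this]
    exact zero_mem _

/-- A smooth function which is `0` near `a` and below and `1` near `b` and above. -/
theorem exists_step {a b : ℝ} (hab : a < b) : ∃ χ : ℝ → ℝ, ContDiff ℝ ∞ χ ∧ ∃ a' b', a < a' ∧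
    b' < b ∧ (∀ t < a', χ t = 0) ∧ ∀ t, b' < t → χ t = 1 := by
  refine ⟨fun t => Real.smoothTransition ((t - (a + (b - a) / 3)) / ((b - a) / 3)),
    Real.smoothTransition.contDiff.comp ((contDiff_id.sub contDiff_const).div_const _),
    a + (b - a) / 3, a + 2 * (b - a) / 3, by linarith, by linarith, fun t ht => ?_, fun t ht => ?_⟩
  · exact Real.smoothTransition.zero_of_nonpos
      (div_nonpos_of_nonpos_of_nonneg (by linarith) (by linarith))
  · exact Real.smoothTransition.one_of_one_le ((one_le_div (by linarith)).2 (by linarith))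

theorem smul_mem_boxM {f : P → ℂ} (hf : ContDiff ℝ ∞ f) {j : ℕ} {α : EuFam P n k}
    (h : α ∈ boxM P k a b j) : (fun w => f w • α w) ∈ boxM P k a b j := by
  refine ⟨⟨(hf.comp contDiff_fst).smul h.1.smooth, fun i hi w x t => ?_, fun i hi w x v m hm => ?_⟩,
    ?_⟩
  · simp [h.1.inv i hi w x t]
  · simp [h.1.kills i hi w x v m hm]
  · obtain ⟨a', b', h1, h2, h3⟩ := h.2
    exact ⟨a', b', h1, h2, fun w x i hi hx => by
      ext v; simp [h3 w x i hi hx]⟩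

/-- A criterion for membership in `boxM`, where the `j`-th coordinate is treated separately. -/
theorem mem_boxM_of_succ {j : ℕ} {α : EuFam P n k} (hb : IsBasic j α) {i : Fin n}
    (hi : i.val = j) (hs : SuppBox a b (j + 1) α) {a' b' : ℝ} (ha : a i < a') (hb' : b' < b i)
    (h : ∀ w x, (x i < a' ∨ b' < x i) → α w x = 0) : α ∈ boxM P k a b j := by
  refine ⟨hb, ?_⟩
  obtain ⟨a₁, b₁, h1, h2, h3⟩ := hs
  refine ⟨Function.update a₁ i a', Function.update b₁ i b', fun l => ?_, fun l => ?_,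
    fun w x l hl hx => ?_⟩
  · rcases eq_or_ne l i with rfl | hli
    · simpa using ha
    · simpa [hli] using h1 l
  · rcases eq_or_ne l i with rfl | hli
    · simpa using hb'
    · simpa [hli] using h2 l
  · rcases eq_or_ne l i with rfl | hli
    · exact h w x (by simpa using hx)
    · refine h3 w x l ?_ (by simpa [hli] using hx)
      have : l.val ≠ i.val := fun h => hli (Fin.ext h)
      omega

theorem SuppBox.cutMul {j : ℕ} {α : EuFam P n k} (i : Fin n) (χ : ℝ → ℝ) (h : SuppBox a b j α) :
    SuppBox a b j (cutMul i χ α) := by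
  obtain ⟨a', b', h1, h2, h3⟩ := h
  exact ⟨a', b', h1, h2, fun w x l hl hx => cutMul_of_eq_zero (h3 w x l hl hx)⟩

section Cut

variable {j : ℕ} {i : Fin n} (hi : i.val = j) {χ : ℝ → ℝ} (hχ : ContDiff ℝ ∞ χ) {a' b' : ℝ}
  (ha : a i < a') (hb : b' < b i) (h0 : ∀ t < a', χ t = 0) (h1 : ∀ t, b' < t → χ t = 1)

include h0 in
theorem euD_cutMul_of_lt (α : EuFam P n k) {w : P} {x : Eu n} (hx : x i < a') :
    euD (cutMul i χ α) w x = 0 := by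
  refine euD_eq_zero ?_
  filter_upwards [eventually_coord_lt hx] with y hy
  exact cutMul_of_cut_eq_zero (h0 _ hy)

include h1 in
theorem euD_cutMul_of_gt (α : EuFam P n k) {w : P} {x : Eu n} (hx : b' < x i) :
    euD (cutMul i χ α) w x = euD α w x := by
  refine euD_congr_nhds ?_
  filter_upwards [eventually_coord_gt hx] with y hy
  exact cutMul_of_cut_eq_one (h1 _ hy)

include hi hχ ha hb h0 h1

/-- For closed `α` one has `d(χα) = dχ ∧ α`, which lives where the step function `χ` is not locally
constant. On classes this is the product with a generator of the compactly supported `H¹` of a line,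
the inverse of integrating out the `i`-th coordinate. -/
theorem euD_cutMul_mem_boxM {α : EuFam P n k} (hα : α ∈ boxM P k a b (j + 1)) (hc : euD α = 0) :
    euD (cutMul i χ α) ∈ boxM P (k + 1) a b j := by
  refine mem_boxM_of_succ ((hα.1.mono (Nat.le_succ j)).cutMul hi.ge hχ).euD hi
    (hα.2.cutMul i χ).euD ha hb fun w x hx => ?_
  rcases hx with hx | hx
  · exact euD_cutMul_of_lt h0 α hx
  · rw [euD_cutMul_of_gt h1 α hx, hc]; rfl

/-- The coefficients depend on the parameter only, so they pass through `χ` and `d`, and each `d(χ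
c)` is again a fixed closed form. Basicness is carried along because additivity of `d` needs
smoothness. -/
theorem euD_cutMul_boxFin {α : EuFam P n k} (hα : α ∈ boxFin P k a b (j + 1)) :
    IsBasic (j + 1) α ∧ euD (cutMul i χ α) ∈ boxFin P (k + 1) a b j := by
  induction hα using Submodule.span_induction with
  | mem α h =>
    obtain ⟨f, hf, c, hc, hcc, rfl⟩ := h
    refine ⟨(smul_mem_boxM hf hc).1, Submodule.subset_span
      ⟨f, hf, fun x => extDeriv (fun y => χ (y i) • c y) x, ?_, ?_, ?_⟩⟩
    · exact euD_cutMul_mem_boxM hi hχ ha hb h0 h1 hc hcc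
    · exact euD_euD (cutMul_smooth (α := fun _ : P => c) hχ hc.1.smooth)
    · rw [cutMul_smul, euD_smul (cutMul_smooth (α := fun _ : P => c) hχ hc.1.smooth) f]
      rfl
  | zero => exact ⟨(basicM P n k (j + 1)).zero_mem, by rw [euD_cutMul_zero]; exact zero_mem _⟩
  | add α β _ _ h h' =>
    refine ⟨(basicM P n k (j + 1)).add_mem h.1 h'.1, ?_⟩
    rw [cutMul_add, euD_add (cutMul_smooth hχ h.1.smooth) (cutMul_smooth hχ h'.1.smooth)]
    exact add_mem h.2 h'.2
  | smul c α _ h =>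
    refine ⟨(basicM P n k (j + 1)).smul_mem c h.1, ?_⟩
    have : cutMul i χ (c • α) = c • cutMul i χ α := cutMul_smul i χ (fun _ => c) α
    rw [this, euD_const_smul (cutMul_smooth hχ h.1.smooth)]
    exact Submodule.smul_mem _ c h.2

theorem euD_cutMul_boxBd : ∀ {k : ℕ} {α : EuFam P n k}, α ∈ boxBd P a b (j + 1) k →
    IsBasic (j + 1) α ∧ euD (cutMul i χ α) ∈ boxBd P a b j (k + 1)
  | 0, α, hα => by
    have hα : α = 0 := hα
    subst hα
    refine ⟨(basicM P n 0 (j + 1)).zero_mem, ?_⟩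
    rw [euD_cutMul_zero]; exact zero_mem _
  | k + 1, α, hα => by
    obtain ⟨γ, hγ, rfl⟩ := hα
    -- The obvious primitive `χ dγ` need not have support in the box in coordinate `i`. Subtracting
    -- the closed form `d(χγ)` leaves `-dχ ∧ γ`, which has.
    refine ⟨hγ.1.euD, cutMul i χ (euD γ) - euD (cutMul i χ γ), ?_, ?_⟩
    · have hbas : cutMul i χ (euD γ) - euD (cutMul i χ γ) ∈ basicM P n (k + 1) j :=
        sub_mem ((hγ.1.euD.mono (Nat.le_succ j)).cutMul hi.ge hχ)
          ((hγ.1.mono (Nat.le_succ j)).cutMul hi.ge hχ).euD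
      have hsup : SuppBox a b (j + 1) (cutMul i χ (euD γ) - euD (cutMul i χ γ)) := by
        obtain ⟨a₁, b₁, h2, h3, h4⟩ := (hγ.2.euD).cutMul i χ
        obtain ⟨a₂, b₂, h2', h3', h4'⟩ := (hγ.2.cutMul i χ).euD
        refine ⟨fun i => min (a₁ i) (a₂ i), fun i => max (b₁ i) (b₂ i),
          fun i => lt_min (h2 i) (h2' i), fun i => max_lt (h3 i) (h3' i), fun w x i hi h => ?_⟩
        rw [lt_min_iff, max_lt_iff] at h
        simp only [Pi.sub_apply]
        rw [h4 w x i hi (h.imp And.left And.left), h4' w x i hi (h.imp And.right And.right),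
          sub_zero]
      refine mem_boxM_of_succ hbas hi hsup ha hb fun w x hx => ?_
      simp only [Pi.sub_apply]
      rcases hx with hx | hx
      · rw [euD_cutMul_of_lt h0 γ hx]
        rw [cutMul_of_cut_eq_zero (h0 _ hx), sub_zero]
      · rw [euD_cutMul_of_gt h1 γ hx]
        rw [cutMul_of_cut_eq_one (h1 _ hx), sub_self]
    · rw [euD_sub (cutMul_smooth hχ hγ.1.euD.smooth)
        (contDiff_extDeriv (cutMul_smooth hχ hγ.1.smooth)),
        euD_euD (cutMul_smooth hχ hγ.1.smooth), sub_zero]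

end Cut

/-- A closed function is constant along the `j`-th coordinate and vanishes for small values of it.
For `0`-forms the condition `Kills` is vacuous. -/
theorem closed_zero_form_eq_zero {α : EuFam P n 0} {j : ℕ} (hα : α ∈ boxM P 0 a b j)
    (hc : euD α = 0) (hj : j < n) : α = 0 := by
  obtain ⟨a', b', h1, h2, h3⟩ := hα.2
  funext w x
  have h := translate_eq_of_closed (u := unitVec ⟨j, hj⟩) (hα.1.diff w)
    (fun y v m => m.elim0) (fun y => congrFun (congrFun hc w) y) x (a' ⟨j, hj⟩ - 1 - x ⟨j, hj⟩)
  rw [← h]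
  exact h3 w _ ⟨j, hj⟩ le_rfl (.inl (by simp))

/-- Restriction of a family to the hyperplane where the `i`-th coordinate is `c`, pulled back along
the projection. -/
def slice (i : Fin n) (c : ℝ) (β : EuFam P n k) : EuFam P n k :=
  fun w x => β w (x + (c - x i) • unitVec i)

theorem slice_isBasic {j : ℕ} {i : Fin n} (hi : i.val = j) {c : ℝ} {β : EuFam P n k}
    (hβ : IsBasic j β) (hk : ∀ w x, Kills (unitVec i) (β w x)) :
    IsBasic (j + 1) (slice i c β) := by
  have hlt : ∀ l : Fin n, l.val < j + 1 → i ≠ l → l.val < j := fun l hl hne => by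
    have : l.val ≠ i.val := fun h => hne (Fin.ext h.symm)
    omega
  refine ⟨?_, ?_, ?_⟩
  · have h1 : ContDiff ℝ ∞ fun q : P × Eu n => (q.1, q.2 + (c - q.2 i) • unitVec i) :=
      contDiff_fst.prodMk (contDiff_snd.add ((contDiff_const.sub
        ((EuclideanSpace.proj (𝕜 := ℝ) i).contDiff.comp contDiff_snd)).smul contDiff_const))
    exact hβ.smooth.comp h1
  · intro l hl w x t
    rcases eq_or_ne i l with rfl | hne
    · have : x + t • unitVec i + (c - (x + t • unitVec i) i) • unitVec i =
          x + (c - x i) • unitVec i := by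
        simp only [PiLp.add_apply, PiLp.smul_apply, unitVec_self, smul_eq_mul, mul_one]
        rw [add_assoc, ← add_smul]
        congr 2
        ring
      simp only [slice, this]
    · have hx : (x + t • unitVec l) i = x i := by simp [unitVec_ne hne]
      simp only [slice, hx]
      rw [add_right_comm, hβ.inv l (hlt l hl hne)]
  · intro l hl w x
    rcases eq_or_ne i l with rfl | hne
    · exact hk w _
    · exact hβ.kills l (hlt l hl hne) w _

/-- A closed form is, up to an exact form with support in the box, of the form `d (χ τ)` with `τ`
closed and independent of one more coordinate. -/
theorem exists_reduction {j : ℕ} (hj : j < n) {α : EuFam P n (k + 1)}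
    (hα : α ∈ boxM P (k + 1) a b j) (hc : euD α = 0) {χ : ℝ → ℝ} (hχ : ContDiff ℝ ∞ χ) {a₀ b₀ : ℝ}
    (ha₀ : a ⟨j, hj⟩ < a₀) (hb₀ : b₀ < b ⟨j, hj⟩) (hχ0 : ∀ t < a₀, χ t = 0)
    (hχ1 : ∀ t, b₀ < t → χ t = 1) :
    ∃ τ ∈ boxM P k a b (j + 1), euD τ = 0 ∧
      α - euD (cutMul ⟨j, hj⟩ χ τ) ∈ boxBd P a b j (k + 1) := by
  obtain ⟨i, hi⟩ : ∃ i : Fin n, i = ⟨j, hj⟩ := ⟨_, rfl⟩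
  rw [← hi] at ha₀ hb₀ ⊢
  have hij : i.val = j := by rw [hi]
  obtain ⟨a', b', h1, h2, h3⟩ := hα.2
  have hlt : ∀ w x, x i < a' i → α w x = 0 := fun w x hx => h3 w x i hij.ge (.inl hx)
  have hgt : ∀ w x, b' i < x i → α w x = 0 := fun w x hx => h3 w x i hij.ge (.inr hx)
  have hli : ∀ l : Fin n, j + 1 ≤ l.val → l ≠ i := by
    rintro l hl rfl
    omega
  -- `β` is a primitive of `α` with the right support in the later coordinates. Beyond `b' i` it
  -- need not vanish, but there it is constant along coordinate `i`.
  obtain ⟨β, hβ⟩ : ∃ β, β = prim i (a i) α := ⟨_, rfl⟩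
  have hβb : IsBasic j β := hβ ▸ hα.1.prim (i := i) hij.ge
  have hβd : euD β = α := hβ ▸ euD_prim hα.1.smooth hc (h1 i) hlt
  have hβk : ∀ w x, Kills (unitVec i) (β w x) := fun w x => hβ ▸ prim_kills_self hα.1.smooth w x
  have hβ0 : ∀ w x, x i < a' i → β w x = 0 := fun w x hx =>
    hβ ▸ prim_eq_zero_of_lt (h1 i) hlt hx
  have hβl : ∀ w x (l : Fin n), j + 1 ≤ l.val → (x l < a' l ∨ b' l < x l) → β w x = 0 := by
    intro w x l hl hx
    rw [hβ]
    refine prim_eq_zero_of_other (l := l) (s := {t | t < a' l ∨ b' l < t}) (hli l hl) ?_ hx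
    exact fun w x hx => h3 w x l (by omega) hx
  -- `τ` is this constant value, the integral of `α` along the whole `i`-th line, pulled back to all
  -- of space; it is basic in one more coordinate.
  obtain ⟨τ, hτ⟩ : ∃ τ, τ = slice i (b i) β := ⟨_, rfl⟩
  have hτβ : ∀ w x, b' i < x i → τ w x = β w x := fun w x hx => by
    rw [hτ, hβ]; exact prim_eq_of_gt hα.1.smooth (h2 i) hgt hx
  have hτb : IsBasic (j + 1) τ := hτ ▸ slice_isBasic hij hβb hβk
  have hτs : ∀ w x (l : Fin n), j + 1 ≤ l.val → (x l < a' l ∨ b' l < x l) → τ w x = 0 := by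
    intro w x l hl hx
    rw [hτ]
    refine hβl w _ l hl ?_
    simpa [unitVec_ne (hli l hl)] using hx
  have hτc : euD τ = 0 := by
    funext w x
    -- `dτ` is invariant along coordinate `i`, so it may be computed beyond `b' i`, where `τ = β`
    -- and `dβ = α = 0`.
    rw [← hτb.euD.inv i (by omega) w x (b' i + 1 - x i)]
    have hx : b' i < (x + (b' i + 1 - x i) • unitVec i) i := by simp
    have : euD τ w (x + (b' i + 1 - x i) • unitVec i) =
        euD β w (x + (b' i + 1 - x i) • unitVec i) := by
      refine euD_congr_nhds ?_
      filter_upwards [eventually_coord_gt hx] with y hy using hτβ w y hy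
    rw [this, hβd, hgt w _ hx]
    rfl
  -- `β` and `χτ` both vanish for small `x i` and agree for large `x i`, so `β - χτ` has support in
  -- the box; its derivative is `α - d(χτ)`.
  refine ⟨τ, ⟨hτb, a', b', h1, h2, hτs⟩, hτc, β - cutMul i χ τ, ?_, ?_⟩
  · refine mem_boxM_of_succ (i := i) (a' := min (a' i) a₀) (b' := max (b' i) b₀)
      (show β - cutMul i χ τ ∈ basicM P n k j from sub_mem hβb
        ((hτb.mono (Nat.le_succ j)).cutMul (i := i) hij.ge hχ)) hij
      ⟨a', b', h1, h2, fun w x l hl hx => ?_⟩ (lt_min (h1 i) ha₀) (max_lt (h2 i) hb₀)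
      fun w x hx => ?_
    · simp only [Pi.sub_apply]
      rw [hβl w x l hl hx, cutMul_of_eq_zero (hτs w x l hl hx), sub_zero]
    · rw [lt_min_iff, max_lt_iff] at hx
      simp only [Pi.sub_apply]
      rcases hx with hx | hx
      · rw [hβ0 w x hx.1, cutMul_of_cut_eq_zero (hχ0 _ hx.2), sub_zero]
      · rw [cutMul_of_cut_eq_one (hχ1 _ hx.2), hτβ w x hx.1, sub_self]
  · rw [euD_sub hβb.smooth (cutMul_smooth hχ hτb.smooth), hβd]

/-- Poincaré lemma with parameters for compactly supported forms on a box. -/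
theorem box_poincare (hab : ∀ i, a i < b i) : ∀ (d j : ℕ), j + d = n → ∀ {k : ℕ}
    {α : EuFam P n k}, α ∈ boxM P k a b j → euD α = 0 →
    α ∈ boxFin P k a b j ⊔ boxBd P a b j k
  | 0, j, hj, k, α, hα, _ => by
    obtain rfl : j = n := by omega
    exact Submodule.mem_sup_left (basic_all_mem_boxFin hα.1)
  | d + 1, j, hj, 0, α, hα, hc => by
    rw [closed_zero_form_eq_zero hα hc (by omega)]
    exact zero_mem _
  | d + 1, j, hj, k + 1, α, hα, hc => by
    have hjn : j < n := by omega
    obtain ⟨χ, hχ, a₀, b₀, ha₀, hb₀, hχ0, hχ1⟩ := exists_step (hab ⟨j, hjn⟩)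
    obtain ⟨τ, hτm, hτc, hex⟩ := exists_reduction hjn hα hc hχ ha₀ hb₀ hχ0 hχ1
    rw [← add_sub_cancel (euD (cutMul ⟨j, hjn⟩ χ τ)) α]
    refine add_mem ?_ (Submodule.mem_sup_right hex)
    -- The induction applies to `τ`, of degree one less and basic in one more coordinate; the map `τ
    -- ↦ d(χτ)` respects both summands of its decomposition.
    obtain ⟨r, hr, s, hs, hrs⟩ := Submodule.mem_sup.1
      (box_poincare hab d (j + 1) (by omega) hτm hτc)
    obtain ⟨hr1, hr2⟩ := euD_cutMul_boxFin (i := ⟨j, hjn⟩) rfl hχ ha₀ hb₀ hχ0 hχ1 hr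
    obtain ⟨hs1, hs2⟩ := euD_cutMul_boxBd (i := ⟨j, hjn⟩) rfl hχ ha₀ hb₀ hχ0 hχ1 hs
    rw [← hrs, cutMul_add, euD_add (cutMul_smooth hχ hr1.smooth) (cutMul_smooth hχ hs1.smooth)]
    exact add_mem (Submodule.mem_sup_left hr2) (Submodule.mem_sup_right hs2)

end BoxLemma

/-! ### Derivatives of maps between manifolds, in the model spaces -/

section MDer

variable {E E' E'' M M' M'' : Type*} [NormedAddCommGroup E] [NormedSpace ℝ E]
  [NormedAddCommGroup E'] [NormedSpace ℝ E'] [NormedAddCommGroup E''] [NormedSpace ℝ E'']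
  [TopologicalSpace M] [ChartedSpace E M] [TopologicalSpace M'] [ChartedSpace E' M']
  [TopologicalSpace M''] [ChartedSpace E'' M'']

variable (E E') in
/-- The derivative of a map between manifolds, as a map between the model spaces. -/
def mder (g : M → M') (x : M) : E →L[ℝ] E' := mfderiv 𝓘(ℝ, E) 𝓘(ℝ, E') g x

theorem mder_comp {g : M' → M''} {f : M → M'} {x : M}
    (hg : MDifferentiableAt 𝓘(ℝ, E') 𝓘(ℝ, E'') g (f x))
    (hf : MDifferentiableAt 𝓘(ℝ, E) 𝓘(ℝ, E') f x) :
    mder E E'' (g ∘ f) x = (mder E' E'' g (f x)).comp (mder E E' f x) :=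
  mfderiv_comp x hg hf

theorem mder_eq_fderiv (g : E → E') (x : E) : mder E E' g x = fderiv ℝ g x := mfderiv_eq_fderiv

theorem mder_congr {g g' : M → M'} {x : M} (h : g =ᶠ[𝓝 x] g') :
    mder E E' g x = mder E E' g' x := h.mfderiv_eq

theorem mder_id (x : M) : mder E E (id : M → M) x = ContinuousLinearMap.id ℝ E :=
  mfderiv_id

end MDer

/-! ### Pullback of forms on the typical fibre and its charts -/

section Model

variable {ES : Type*} [NormedAddCommGroup ES] [NormedSpace ℝ ES] [FiniteDimensional ℝ ES]
  {S : Type*} [TopologicalSpace S] [ChartedSpace ES S] [IsManifold 𝓘(ℝ, ES) ∞ S]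

variable (ES) in
/-- The chart at `s`, composed with a linear isomorphism onto Euclidean space. -/
def ch (s : S) : OpenPartialHomeomorph S (Eu (Module.finrank ℝ ES)) :=
  (chartAt ES s).transHomeomorph (toEuclidean (E := ES)).toHomeomorph

variable (ES) in
theorem mem_ch_source (s : S) : s ∈ (ch ES s).source := mem_chart_source ES s

theorem ch_smooth (s : S) :
    ContMDiffOn 𝓘(ℝ, ES) 𝓘(ℝ, Eu (Module.finrank ℝ ES)) ∞ (ch ES s) (ch ES s).source :=
  ((toEuclidean (E := ES)).contDiff.contMDiff).comp_contMDiffOn (contMDiffOn_chart (x := s))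

theorem ch_symm_smooth (s : S) :
    ContMDiffOn 𝓘(ℝ, Eu (Module.finrank ℝ ES)) 𝓘(ℝ, ES) ∞ (ch ES s).symm (ch ES s).target :=
  (contMDiffOn_chart_symm (x := s)).comp
    ((toEuclidean (E := ES)).symm.contDiff.contMDiff).contMDiffOn fun _ hx => hx

theorem ContMDiffOn.mdiffAt {E E' M M' : Type*} [NormedAddCommGroup E] [NormedSpace ℝ E]
    [NormedAddCommGroup E'] [NormedSpace ℝ E']
    [TopologicalSpace M] [ChartedSpace E M] [TopologicalSpace M'] [ChartedSpace E' M']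
    {g : M → M'} {O : Set M} (hg : ContMDiffOn 𝓘(ℝ, E) 𝓘(ℝ, E') ∞ g O) (hO : IsOpen O) {x : M}
    (hx : x ∈ O) : MDifferentiableAt 𝓘(ℝ, E) 𝓘(ℝ, E') g x :=
  (hg.contMDiffAt (hO.mem_nhds hx)).mdifferentiableAt (by simp)

theorem mder_ch_comp_symm {s₀ : S} {x : Eu (Module.finrank ℝ ES)} (hx : x ∈ (ch ES s₀).target) :
    (mder ES (Eu (Module.finrank ℝ ES)) (ch ES s₀) ((ch ES s₀).symm x)).comp
      (mder (Eu (Module.finrank ℝ ES)) ES (ch ES s₀).symm x) =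
      ContinuousLinearMap.id ℝ _ := by
  rw [← mder_comp (ContMDiffOn.mdiffAt (ch_smooth s₀) (ch ES s₀).open_source
    ((ch ES s₀).map_target hx))
    (ContMDiffOn.mdiffAt (ch_symm_smooth s₀) (ch ES s₀).open_target hx), ← mder_id x]
  refine mder_congr ?_
  filter_upwards [(ch ES s₀).open_target.mem_nhds hx] with y hy using (ch ES s₀).right_inv hy

theorem mder_symm_comp_ch {s₀ s : S} (hs : s ∈ (ch ES s₀).source) :
    (mder (Eu (Module.finrank ℝ ES)) ES (ch ES s₀).symm (ch ES s₀ s)).comp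
      (mder ES (Eu (Module.finrank ℝ ES)) (ch ES s₀) s) =
      ContinuousLinearMap.id ℝ _ := by
  rw [← mder_comp (ContMDiffOn.mdiffAt (ch_symm_smooth s₀) (ch ES s₀).open_target
    ((ch ES s₀).map_source hs))
    (ContMDiffOn.mdiffAt (ch_smooth s₀) (ch ES s₀).open_source hs), ← mder_id s]
  refine mder_congr ?_
  filter_upwards [(ch ES s₀).open_source.mem_nhds hs] with y hy using (ch ES s₀).left_inv hy

variable (ES S) in
/-- Arbitrary complex-valued `k`-forms on the manifold `S`. -/
abbrev SForm (k : ℕ) : Type _ := S → ES [⋀^Fin k]→L[ℝ] ℂ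

variable {X : Type*} [NormedAddCommGroup X] [NormedSpace ℝ X]
  {P : Type*} [NormedAddCommGroup P] [NormedSpace ℝ P] {k : ℕ}

/-- Pullback of a form on `S` to a vector space. -/
def spull (g : X → S) (c : SForm ES S k) : X → X [⋀^Fin k]→L[ℝ] ℂ := fun x =>
  (c (g x)).compContinuousLinearMap (mder X ES g x)

@[simp] theorem spull_apply (g : X → S) (c : SForm ES S k) (x : X) (v : Fin k → X) :
    spull g c x v = c (g x) fun i => mder X ES g x (v i) := rfl

theorem spull_add (g : X → S) (c c' : SForm ES S k) : spull g (c + c') = spull g c + spull g c' := by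
  funext x; ext v; simp

theorem spull_smul (g : X → S) (a : ℂ) (c : SForm ES S k) : spull g (a • c) = a • spull g c := by
  funext x; ext v; simp

section Factor

variable {g : X → S} {O : Set X} (hO : IsOpen O) (hg : ContMDiffOn 𝓘(ℝ, X) 𝓘(ℝ, ES) ∞ g O)
  {x : X} (hx : x ∈ O) {s₀ : S} (hs : g x ∈ (ch ES s₀).source)

include hO hg hx hs

theorem contDiffAt_ch_comp : ContDiffAt ℝ ∞ (ch ES s₀ ∘ g) x :=
  (((ch_smooth s₀).contMDiffAt ((ch ES s₀).open_source.mem_nhds hs)).comp x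
    (hg.contMDiffAt (hO.mem_nhds hx))).contDiffAt

theorem eventually_mem_source : ∀ᶠ y in 𝓝 x, y ∈ O ∧ g y ∈ (ch ES s₀).source :=
  Filter.Eventually.and (hO.mem_nhds hx)
    ((hg.continuousOn.continuousAt (hO.mem_nhds hx)) ((ch ES s₀).open_source.mem_nhds hs))

/-- Pullback along `g` factors through the chart at `s₀`. The neighbourhood of `x` does not depend
on the form `c`, which allows forms varying with a parameter. -/
theorem spull_factor : ∀ᶠ y in 𝓝 x, ∀ c : SForm ES S k, spull g c y =
    (spull (ch ES s₀).symm c (ch ES s₀ (g y))).compContinuousLinearMap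
      (fderiv ℝ (ch ES s₀ ∘ g) y) := by
  filter_upwards [(eventually_mem_source hO hg hx hs)] with y hy c
  have h1 : MDifferentiableAt 𝓘(ℝ, X) 𝓘(ℝ, ES) g y := ContMDiffOn.mdiffAt hg hO hy.1
  have h2 := ContMDiffOn.mdiffAt (ch_smooth s₀) (ch ES s₀).open_source hy.2
  have h3 : fderiv ℝ (ch ES s₀ ∘ g) y =
      (mder ES (Eu (Module.finrank ℝ ES)) (ch ES s₀) (g y)).comp (mder X ES g y) := by
    rw [← mder_eq_fderiv, mder_comp h2 h1]
  ext v
  simp only [ContinuousAlternatingMap.compContinuousLinearMap_apply, spull_apply,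
    (ch ES s₀).left_inv hy.2, h3]
  refine congrArg (c (g y)) (funext fun i => ?_)
  exact (congrArg (fun L => L (mder X ES g y (v i))) (mder_symm_comp_ch hy.2)).symm

variable [FiniteDimensional ℝ X]

theorem contDiffAt_spull_of_chart {α : P → SForm ES S k} {w : P}
    (h : ContDiffAt ℝ ∞ (fun q : P × Eu (Module.finrank ℝ ES) =>
      spull (ch ES s₀).symm (α q.1) q.2) (w, ch ES s₀ (g x))) :
    ContDiffAt ℝ ∞ (fun q : P × X => spull g (α q.1) q.2) (w, x) := by
  have hh := contDiffAt_ch_comp hO hg hx hs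
  have hh2 : ContDiffAt ℝ ∞ (fun q : P × X => ch ES s₀ (g q.2)) (w, x) :=
    ContDiffAt.comp (w, x) (g := ch ES s₀ ∘ g) (f := Prod.snd) hh contDiffAt_snd
  have h1 : ContDiffAt ℝ ∞ (fun q : P × X =>
      spull (ch ES s₀).symm (α q.1) (ch ES s₀ (g q.2))) (w, x) :=
    ContDiffAt.comp (w, x) (f := fun q : P × X => (q.1, ch ES s₀ (g q.2))) h
      (contDiffAt_fst.prodMk hh2)
  have h2 : ContDiffAt ℝ ∞ (fun q : P × X => fderiv ℝ (ch ES s₀ ∘ g) q.2) (w, x) :=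
    ContDiffAt.comp (w, x) (hh.fderiv_right le_rfl) contDiffAt_snd
  have h3 : ContDiffAt ℝ ∞ (fun q : P × X =>
      (spull (ch ES s₀).symm (α q.1) (ch ES s₀ (g q.2))).compContinuousLinearMap
      (fderiv ℝ (ch ES s₀ ∘ g) q.2)) (w, x) := by
    rw [← contDiffWithinAt_univ, contDiffWithinAt_altMap_iff]
    intro v
    rw [contDiffWithinAt_univ]
    exact contDiff_altMap_apply.contDiffAt.comp (w, x) (h1.prodMk (contDiffAt_pi.2 fun i =>
      h2.clm_apply contDiffAt_const))
  refine h3.congr_of_eventuallyEq ?_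
  have := spull_factor (k := k) hO hg hx hs
  have h4 : ∀ᶠ q : P × X in 𝓝 (w, x), ∀ c : SForm ES S k, spull g c q.2 =
    (spull (ch ES s₀).symm c (ch ES s₀ (g q.2))).compContinuousLinearMap
      (fderiv ℝ (ch ES s₀ ∘ g) q.2) := (continuous_snd.tendsto (w, x)).eventually this
  filter_upwards [h4] with q hq using hq _

theorem extDeriv_spull_of_chart {c : SForm ES S k}
    (h : DifferentiableAt ℝ (spull (ch ES s₀).symm c) (ch ES s₀ (g x))) :
    extDeriv (spull g c) x = (extDeriv (spull (ch ES s₀).symm c)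
      (ch ES s₀ (g x))).compContinuousLinearMap (fderiv ℝ (ch ES s₀ ∘ g) x) := by
  have he : spull g c =ᶠ[𝓝 x] fun y => (spull (ch ES s₀).symm c
      ((ch ES s₀ ∘ g) y)).compContinuousLinearMap (fderiv ℝ (ch ES s₀ ∘ g) y) := by
    filter_upwards [spull_factor (k := k) hO hg hx hs] with y hy using hy c
  rw [he.extDeriv_eq]
  exact extDeriv_pullback (f := ch ES s₀ ∘ g) h (contDiffAt_ch_comp hO hg hx hs)
    minSmoothness_two_le

end Factor

end Model

set_option synthInstance.maxHeartbeats 200000 in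
theorem contDiffAt_extDeriv {E W X : Type*} [NormedAddCommGroup E] [NormedSpace ℝ E]
    [NormedAddCommGroup W] [NormedSpace ℝ W] [NormedAddCommGroup X] [NormedSpace ℝ X] {k : ℕ}
    {α : X → E → E [⋀^Fin k]→L[ℝ] W} {w : X} {x : E}
    (h : ContDiffAt ℝ ∞ (fun q : X × E => α q.1 q.2) (w, x)) :
    ContDiffAt ℝ ∞ (fun q : X × E => extDeriv (α q.1) q.2) (w, x) := by
  have h1 : ContDiffAt ℝ ∞ (fun q : X × E => fderiv ℝ (α q.1) q.2) (w, x) := by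
    refine ContDiffAt.fderiv (f := fun (q : X × E) => α q.1) (g := Prod.snd) (n := ∞)
      ?_ contDiffAt_snd le_rfl
    exact ContDiffAt.comp ((w, x), x) (f := fun r : (X × E) × E => (r.1.1, r.2)) h
      (contDiff_fst.comp contDiff_fst |>.prodMk contDiff_snd).contDiffAt
  exact (ContinuousAlternatingMap.alternatizeUncurryFinCLM (n := k) ℝ E W).contDiff.contDiffAt.comp
    (w, x) h1

/-! ### Smooth families of forms on the typical fibre and the Künneth property -/

section Model

variable {ES : Type*} [NormedAddCommGroup ES] [NormedSpace ℝ ES] [FiniteDimensional ℝ ES]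
  {S : Type*} [TopologicalSpace S] [ChartedSpace ES S] [IsManifold 𝓘(ℝ, ES) ∞ S]
  {X : Type*} [NormedAddCommGroup X] [NormedSpace ℝ X] [FiniteDimensional ℝ X]
  {P : Type*} [NormedAddCommGroup P] [NormedSpace ℝ P] {k : ℕ}

/-- Smooth families of forms on `S`. -/
def FamSmooth (α : P → SForm ES S k) : Prop :=
  ∀ (w : P) (s : S), ContDiffAt ℝ ∞ (fun q : P × Eu (Module.finrank ℝ ES) =>
    spull (ch ES s).symm (α q.1) q.2) (w, ch ES s s)

/-- Smooth forms on `S`, as constant families. -/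
def SmoothForm (c : SForm ES S k) : Prop :=
  ∀ s : S, ContDiffAt ℝ ∞ (spull (ch ES s).symm c) (ch ES s s)

/-- The exterior derivative of a form on `S`. -/
def sD (c : SForm ES S k) : SForm ES S (k + 1) := fun s =>
  (extDeriv (spull (ch ES s).symm c) (ch ES s s)).compContinuousLinearMap
    (mder ES (Eu (Module.finrank ℝ ES)) (ch ES s) s)

theorem FamSmooth.slice {α : P → SForm ES S k} (h : FamSmooth α) (w : P) : SmoothForm (α w) :=
  fun s => ContDiffAt.comp (ch ES s s)
    (f := fun x : Eu (Module.finrank ℝ ES) => (w, x)) (h w s)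
    (contDiffAt_const.prodMk contDiffAt_id)

theorem SmoothForm.famSmooth {c : SForm ES S k} (h : SmoothForm c) :
    FamSmooth (fun _ : P => c) :=
  fun w s => ContDiffAt.comp (w, ch ES s s)
    (g := spull (ch ES s).symm c) (f := Prod.snd) (h s) contDiffAt_snd

theorem SmoothForm.diff {c : SForm ES S k} (h : SmoothForm c) (s : S) :
    DifferentiableAt ℝ (spull (ch ES s).symm c) (ch ES s s) := (h s).differentiableAt (by simp)

/-- `FamSmooth` asks for smoothness only at the base point of each preferred chart. Factoring
through the chart at `g x` gives it for pullbacks along all smooth maps, in particular at every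
point of every chart. -/
theorem FamSmooth.spull {α : P → SForm ES S k} (h : FamSmooth α) {g : X → S} {O : Set X}
    (hO : IsOpen O) (hg : ContMDiffOn 𝓘(ℝ, X) 𝓘(ℝ, ES) ∞ g O) {x : X} (hx : x ∈ O) (w : P) :
    ContDiffAt ℝ ∞ (fun q : P × X => spull g (α q.1) q.2) (w, x) :=
  contDiffAt_spull_of_chart hO hg hx (mem_ch_source ES (g x)) (h w (g x))

theorem SmoothForm.spull {c : SForm ES S k} (h : SmoothForm c) {g : X → S} {O : Set X}
    (hO : IsOpen O) (hg : ContMDiffOn 𝓘(ℝ, X) 𝓘(ℝ, ES) ∞ g O) {x : X} (hx : x ∈ O) :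
    ContDiffAt ℝ ∞ (spull g c) x :=
  ContDiffAt.comp x (f := fun x : X => ((0 : ℝ), x))
    (h.famSmooth.spull hO hg hx (0 : ℝ)) (contDiffAt_const.prodMk contDiffAt_id)

/-- Naturality of `d`: although `sD` is computed at each point in the preferred chart there, any
other chart or smooth map computes it as well. -/
theorem spull_sD {c : SForm ES S k} {g : X → S} {O : Set X} (hO : IsOpen O)
    (hg : ContMDiffOn 𝓘(ℝ, X) 𝓘(ℝ, ES) ∞ g O) {x : X} (hx : x ∈ O)
    (hc : DifferentiableAt ℝ (RelDeRham.spull (ch ES (g x)).symm c) (ch ES (g x) (g x))) :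
    RelDeRham.spull g (sD c) x = extDeriv (RelDeRham.spull g c) x := by
  rw [extDeriv_spull_of_chart hO hg hx (mem_ch_source ES (g x)) hc]
  have h2 := mder_comp (ContMDiffOn.mdiffAt (ch_smooth (g x)) (ch ES (g x)).open_source
    (mem_ch_source ES (g x))) (ContMDiffOn.mdiffAt hg hO hx)
  rw [mder_eq_fderiv] at h2
  rw [h2]
  rfl

theorem SmoothForm.spull_sD {c : SForm ES S k} (h : SmoothForm c) {g : X → S} {O : Set X}
    (hO : IsOpen O) (hg : ContMDiffOn 𝓘(ℝ, X) 𝓘(ℝ, ES) ∞ g O) {x : X} (hx : x ∈ O) :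
    RelDeRham.spull g (sD c) x = extDeriv (RelDeRham.spull g c) x :=
  RelDeRham.spull_sD hO hg hx (h.diff (g x))

theorem eventually_target (s : S) : ∀ᶠ x in 𝓝 (ch ES s s), x ∈ (ch ES s).target :=
  (ch ES s).open_target.mem_nhds ((ch ES s).map_source (mem_ch_source ES s))

theorem FamSmooth.sD {α : P → SForm ES S k} (h : FamSmooth α) :
    FamSmooth (fun w => sD (α w)) := by
  intro w s
  refine (contDiffAt_extDeriv (α := fun w => RelDeRham.spull (ch ES s).symm (α w))
    (h w s)).congr_of_eventuallyEq ?_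
  have h1 : ∀ᶠ q : P × Eu (Module.finrank ℝ ES) in 𝓝 (w, ch ES s s), q.2 ∈ (ch ES s).target :=
    (continuous_snd.tendsto (w, ch ES s s)).eventually (eventually_target s)
  filter_upwards [h1] with q hq
  exact (h.slice q.1).spull_sD (ch ES s).open_target (ch_symm_smooth s) hq

theorem sD_congr {c c' : SForm ES S k} {s : S} (h : c =ᶠ[𝓝 s] c') : sD c s = sD c' s := by
  have h1 : RelDeRham.spull (ch ES s).symm c =ᶠ[𝓝 (ch ES s s)]
      RelDeRham.spull (ch ES s).symm c' := by
    have hc : ContinuousAt (ch ES s).symm (ch ES s s) :=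
      (ch ES s).symm.continuousAt ((ch ES s).map_source (mem_ch_source ES s))
    have h2 : ∀ᶠ x in 𝓝 (ch ES s s), c ((ch ES s).symm x) = c' ((ch ES s).symm x) := by
      refine hc.eventually (p := fun t => c t = c' t) ?_
      rw [(ch ES s).left_inv (mem_ch_source ES s)]
      exact h
    filter_upwards [h2] with x hx
    ext v
    simp [hx]
  unfold RelDeRham.sD
  rw [h1.extDeriv_eq]

theorem sD_zero : sD (0 : SForm ES S k) = 0 := by
  funext s
  have : RelDeRham.spull (ch ES s).symm (0 : SForm ES S k) = fun _ => 0 := by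
    funext x; ext v; simp
  unfold RelDeRham.sD
  rw [this, extDeriv_zero_fun]
  rfl

theorem sD_eq_zero_of_eventually {c : SForm ES S k} {s : S} (h : ∀ᶠ t in 𝓝 s, c t = 0) :
    sD c s = 0 := by
  have : c =ᶠ[𝓝 s] 0 := h
  rw [sD_congr this, sD_zero]
  rfl

theorem sD_add {c c' : SForm ES S k} (h : SmoothForm c) (h' : SmoothForm c') :
    sD (c + c') = sD c + sD c' := by
  funext s
  unfold RelDeRham.sD
  rw [spull_add, extDeriv_add (h.diff s) (h'.diff s)]
  rfl

theorem sD_smul {c : SForm ES S k} (h : SmoothForm c) (a : ℂ) : sD (a • c) = a • sD c := by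
  funext s
  unfold RelDeRham.sD
  rw [spull_smul, extDeriv_complex_smul a (h.diff s)]
  rfl

theorem SmoothForm.sD_sD {c : SForm ES S k} (h : SmoothForm c) :
    RelDeRham.sD (RelDeRham.sD c) = 0 := by
  funext s
  have h1 : RelDeRham.spull (ch ES s).symm (RelDeRham.sD c) =ᶠ[𝓝 (ch ES s s)]
      extDeriv (RelDeRham.spull (ch ES s).symm c) := by
    filter_upwards [eventually_target s] with x hx
    exact h.spull_sD (ch ES s).open_target (ch_symm_smooth s) hx
  change (extDeriv (RelDeRham.spull (ch ES s).symm (RelDeRham.sD c))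
    (ch ES s s)).compContinuousLinearMap _ = 0
  rw [h1.extDeriv_eq, extDeriv_extDeriv_apply (h s) minSmoothness_two_le]
  rfl

theorem FamSmooth.add {α β : P → SForm ES S k} (h : FamSmooth α) (h' : FamSmooth β) :
    FamSmooth (α + β) := fun w s => by
  simpa only [Pi.add_apply, spull_add] using (h w s).add (h' w s)

theorem FamSmooth.smul {α : P → SForm ES S k} (h : FamSmooth α) {f : P → ℂ}
    (hf : ContDiff ℝ ∞ f) : FamSmooth (fun w => f w • α w) := fun w s => by
  simp only [spull_smul]
  exact ((hf.comp contDiff_fst).contDiffAt (x := (w, ch ES s s))).smul (h w s)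

theorem famSmooth_zero : FamSmooth (0 : P → SForm ES S k) := fun w s => by
  have : (fun q : P × Eu (Module.finrank ℝ ES) =>
    RelDeRham.spull (ch ES s).symm ((0 : P → SForm ES S k) q.1) q.2) = fun _ => 0 := by
    funext x; ext v; simp
  rw [this]
  exact contDiffAt_const

/-- Multiplication by a smooth function on `S` preserves smoothness. -/
theorem FamSmooth.mul {α : P → SForm ES S k} (h : FamSmooth α) {ρ : S → ℝ}
    (hρ : ContMDiff 𝓘(ℝ, ES) 𝓘(ℝ, ℝ) ∞ ρ) : FamSmooth (fun w s => ρ s • α w s) := fun w s => by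
  have h1 : ContDiffAt ℝ ∞ (ρ ∘ (ch ES s).symm) (ch ES s s) :=
    ((hρ _).comp (ch ES s s) ((ch_symm_smooth s).contMDiffAt (eventually_target s))).contDiffAt
  have h2 : ContDiffAt ℝ ∞ (fun q : P × Eu (Module.finrank ℝ ES) => ρ ((ch ES s).symm q.2))
      (w, ch ES s s) := ContDiffAt.comp (w, ch ES s s) (f := Prod.snd) h1 contDiffAt_snd
  have h3 := h2.smul (h w s)
  have h4 : (fun q : P × Eu (Module.finrank ℝ ES) =>
      RelDeRham.spull (ch ES s).symm (fun s => ρ s • α q.1 s) q.2) =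
      fun q => ρ ((ch ES s).symm q.2) • RelDeRham.spull (ch ES s).symm (α q.1) q.2 := by
    funext q; ext v; simp
  rw [h4]
  exact h3

variable (P k) in
/-- Smooth families of forms with support in a fixed compact subset of `U`. -/
def famOm (U : Set S) : Submodule ℂ (P → SForm ES S k) where
  carrier := {α | FamSmooth α ∧ ∃ K : Set S, IsCompact K ∧ K ⊆ U ∧ ∀ w, ∀ s ∉ K, α w s = 0}
  zero_mem' := ⟨famSmooth_zero, ∅, isCompact_empty, empty_subset _, fun _ _ _ => rfl⟩
  add_mem' := by
    rintro α β ⟨h, K, hK, hKU, h0⟩ ⟨h', K', hK', hKU', h0'⟩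
    refine ⟨h.add h', K ∪ K', hK.union hK', union_subset hKU hKU', fun w s hs => ?_⟩
    rw [mem_union, not_or] at hs
    simp [h0 w s hs.1, h0' w s hs.2]
  smul_mem' := by
    rintro c α ⟨h, K, hK, hKU, h0⟩
    refine ⟨h.smul contDiff_const, K, hK, hKU, fun w s hs => ?_⟩
    change c • α w s = 0
    rw [h0 w s hs]
    ext v; simp

theorem famOm_mono {U U' : Set S} (h : U ⊆ U') :
    famOm (ES := ES) P k U ≤ famOm P k U' := by
  rintro α ⟨h1, K, hK, hKU, h0⟩
  exact ⟨h1, K, hK, hKU.trans h, h0⟩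

variable (P) in
/-- Exact families. -/
def famBd (U : Set S) : (k : ℕ) → Submodule ℂ (P → SForm ES S k)
  | 0 => ⊥
  | k + 1 =>
    { carrier := {α | ∃ β ∈ famOm P k U, (fun w => sD (β w)) = α}
      zero_mem' := ⟨0, zero_mem _, funext fun _ => sD_zero⟩
      add_mem' := by
        rintro _ _ ⟨β, h, rfl⟩ ⟨β', h', rfl⟩
        exact ⟨β + β', add_mem h h', funext fun w => sD_add (h.1.slice w) (h'.1.slice w)⟩
      smul_mem' := by
        rintro c _ ⟨β, h, rfl⟩
        exact ⟨c • β, Submodule.smul_mem _ c h, funext fun w => sD_smul (h.1.slice w) c⟩ }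

theorem famBd_mono {U U' : Set S} (h : U ⊆ U') : ∀ {k : ℕ},
    famBd (ES := ES) P U k ≤ famBd P U' k
  | 0 => le_rfl
  | k + 1 => by
    rintro _ ⟨β, hβ, rfl⟩
    exact ⟨β, famOm_mono h hβ, rfl⟩

variable (ES k) in
/-- Smooth closed forms on `S` with compact support in `U`. -/
def closedForms (U : Set S) : Set (SForm ES S k) :=
  {c | (fun _ => c) ∈ famOm ℝ k U ∧ sD c = 0}

variable (P ES k) in
/-- Families of finite rank: linear combinations of products of smooth functions of the parameter
with fixed closed forms. -/
def famFin (U : Set S) : Submodule ℂ (P → SForm ES S k) :=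
  Submodule.span ℂ {α | ∃ f : P → ℂ, ContDiff ℝ ∞ f ∧ ∃ c ∈ closedForms ES k U,
    α = fun w => f w • c}

theorem famFin_mono {U U' : Set S} (h : U ⊆ U') : famFin ES P k U ≤ famFin ES P k U' := by
  refine Submodule.span_mono ?_
  rintro _ ⟨f, hf, c, hc, rfl⟩
  exact ⟨f, hf, c, ⟨famOm_mono h hc.1, hc.2⟩, rfl⟩

/-- For constant families the parameter space is immaterial. Single forms are treated throughout as
constant families over `ℝ`. -/
theorem const_mem_famOm {c : SForm ES S k} {U : Set S} {P' : Type*} [NormedAddCommGroup P']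
    [NormedSpace ℝ P'] (h : (fun _ : P => c) ∈ famOm P k U) :
    (fun _ : P' => c) ∈ famOm P' k U := by
  obtain ⟨h1, K, hK, hKU, h0⟩ := h
  exact ⟨(h1.slice 0).famSmooth, K, hK, hKU, fun _ => h0 0⟩

theorem slice_mem_famOm {α : P → SForm ES S k} {U : Set S} {P' : Type*} [NormedAddCommGroup P']
    [NormedSpace ℝ P'] (h : α ∈ famOm P k U) (w : P) :
    (fun _ : P' => α w) ∈ famOm P' k U := by
  obtain ⟨h1, K, hK, hKU, h0⟩ := h
  exact ⟨(h1.slice w).famSmooth, K, hK, hKU, fun _ => h0 w⟩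

theorem smul_mem_famOm {α : P → SForm ES S k} {U : Set S} (h : α ∈ famOm P k U) {f : P → ℂ}
    (hf : ContDiff ℝ ∞ f) : (fun w => f w • α w) ∈ famOm P k U := by
  obtain ⟨h1, K, hK, hKU, h0⟩ := h
  refine ⟨h1.smul hf, K, hK, hKU, fun w s hs => ?_⟩
  change f w • α w s = 0
  rw [h0 w s hs]
  ext v; simp

theorem famFin_le_famOm (U : Set S) : famFin ES P k U ≤ famOm P k U := by
  refine Submodule.span_le.2 ?_
  rintro _ ⟨f, hf, c, hc, rfl⟩
  exact smul_mem_famOm (const_mem_famOm hc.1) hf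

/-- The Künneth property of `U`: every closed family with compact support in `U` is a sum of a
family of finite rank and an exact family. -/
def Kun (P ES : Type*) [NormedAddCommGroup P] [NormedSpace ℝ P] [NormedAddCommGroup ES]
    [NormedSpace ℝ ES] [FiniteDimensional ℝ ES] {S : Type*} [TopologicalSpace S]
    [ChartedSpace ES S] [IsManifold 𝓘(ℝ, ES) ∞ S] (U : Set S) : Prop :=
  ∀ (k : ℕ) (α : P → SForm ES S k), α ∈ famOm P k U → (∀ w, sD (α w) = 0) →
    α ∈ famFin ES P k U ⊔ famBd P U k

end Model

/-! ### Mayer–Vietoris for the Künneth property -/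

section MayerVietoris

variable {ES : Type*} [NormedAddCommGroup ES] [NormedSpace ℝ ES] [FiniteDimensional ℝ ES]
  {S : Type*} [TopologicalSpace S] [ChartedSpace ES S] [IsManifold 𝓘(ℝ, ES) ∞ S]
  {P : Type*} [NormedAddCommGroup P] [NormedSpace ℝ P] {k : ℕ}

/-- A family of finite rank with values in a subspace `N` is a combination of elements of `N`. -/
theorem finiteRank_mem_span {X : Type*} [AddCommGroup X] [Module ℂ X] {A : Set (P → ℂ)}
    {C : Set X} {r : P → X}
    (hr : r ∈ Submodule.span ℂ {α : P → X | ∃ f ∈ A, ∃ c ∈ C, α = fun w => f w • c})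
    (N : Submodule ℂ X) (hN : ∀ w, r w ∈ N) :
    r ∈ Submodule.span ℂ {α : P → X | ∃ f ∈ A, ∃ c ∈ N, α = fun w => f w • c} := by
  -- `q` is a linear projection onto `N`, with no continuity. Applied to a finite-rank family it
  -- changes only the fixed vectors and leaves the coefficient functions in `A`; on `r` itself it is
  -- the identity.
  obtain ⟨q, hq⟩ := N.subtype.exists_leftInverse_of_injective N.ker_subtype
  have key : ∀ r ∈ Submodule.span ℂ {α : P → X | ∃ f ∈ A, ∃ c ∈ C, α = fun w => f w • c},
      (fun w => (q (r w) : X)) ∈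
        Submodule.span ℂ {α : P → X | ∃ f ∈ A, ∃ c ∈ N, α = fun w => f w • c} := by
    intro r hr
    induction hr using Submodule.span_induction with
    | mem α h =>
      obtain ⟨f, hf, c, -, rfl⟩ := h
      refine Submodule.subset_span ⟨f, hf, q c, (q c).2, ?_⟩
      funext w
      simp
    | zero =>
      have h0 : (fun w : P => (q ((0 : P → X) w) : X)) = 0 := by funext w; simp
      rw [h0]
      exact zero_mem _
    | add α β _ _ h h' =>
      have := add_mem h h'
      simpa using! this
    | smul c α _ h =>
      have := Submodule.smul_mem _ c h
      simpa using! this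
  have h1 := key r hr
  have h2 : (fun w => (q (r w) : X)) = r := by
    funext w
    have := LinearMap.congr_fun hq ⟨r w, hN w⟩
    exact congrArg Subtype.val this
  rwa [h2] at h1

theorem mem_sup_mono {U U' : Set S} (h : U ⊆ U') {α : P → SForm ES S k}
    (hα : α ∈ famFin ES P k U ⊔ famBd P U k) : α ∈ famFin ES P k U' ⊔ famBd P U' k := by
  have : famFin ES P k U ⊔ famBd P U k ≤ famFin ES P k U' ⊔ famBd P U' k :=
    sup_le_sup (famFin_mono h) (famBd_mono h)
  exact this hα

variable (ES k) in
/-- Exterior derivatives of forms on `S` with compact support in `U`. -/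
def bdForms (U : Set S) : Submodule ℂ (SForm ES S k) :=
  (famBd ℝ U k).comap (LinearMap.pi fun _ => LinearMap.id)

theorem mem_bdForms_succ {U : Set S} {c : SForm ES S (k + 1)} :
    c ∈ bdForms ES (k + 1) U ↔ ∃ b : SForm ES S k, (fun _ : ℝ => b) ∈ famOm ℝ k U ∧ sD b = c := by
  constructor
  · rintro ⟨β, hβ, h⟩
    exact ⟨β 0, slice_mem_famOm hβ 0, congrFun h 0⟩
  · rintro ⟨b, hb, rfl⟩
    exact ⟨_, hb, rfl⟩

theorem slice_mem_bdForms {U : Set S} : ∀ {k : ℕ} {α : P → SForm ES S k}, α ∈ famBd P U k →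
    ∀ w, α w ∈ bdForms ES k U
  | 0, α, h, w => by
    have h : α = 0 := h
    rw [h]; exact zero_mem _
  | k + 1, _, ⟨β, hβ, h⟩, w => mem_bdForms_succ.2 ⟨β w, slice_mem_famOm hβ w, congrFun h w⟩

theorem smul_mem_famBd {U : Set S} : ∀ {k : ℕ} {c : SForm ES S k}, c ∈ bdForms ES k U →
    ∀ {f : P → ℂ}, ContDiff ℝ ∞ f → (fun w => f w • c) ∈ famBd P U k
  | 0, c, h, f, _ => by
    have h : (fun _ : ℝ => c) = 0 := h
    have h : c = 0 := congrFun h 0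
    subst h
    have : (fun w => f w • (0 : SForm ES S 0)) = 0 := by
      funext w; exact smul_zero (A := SForm ES S 0) (f w)
    rw [this]
    exact zero_mem _
  | k + 1, c, h, f, hf => by
    obtain ⟨b, hb, rfl⟩ := mem_bdForms_succ.1 h
    exact ⟨fun w => f w • b, smul_mem_famOm (const_mem_famOm hb) hf,
      funext fun w => sD_smul (hb.1.slice 0) (f w)⟩

/-- Elements of `famFin` all of whose members are exact are exact. -/
theorem mem_famBd_of_slices {U : Set S} {r : P → SForm ES S k} (hr : r ∈ famFin ES P k U)
    (h : ∀ w, r w ∈ bdForms ES k U) : r ∈ famBd P U k := by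
  -- The fixed forms may be taken exact; the coefficient functions times fixed primitives of these
  -- forms then give a smooth primitive.
  have h1 := finiteRank_mem_span (A := {f | ContDiff ℝ ∞ f}) hr (bdForms ES k U) h
  refine (Submodule.span_le (p := famBd P U k)).2 ?_ h1
  rintro _ ⟨f, hf, c, hc, rfl⟩
  exact smul_mem_famBd hc hf

/-- If `c = da` with `a` supported in `U` and `-c = db` with `b` supported in `V`, then `a + b` is a
closed form supported in `U ∪ V`. Multiplied by the coefficient functions, this supplies the part of
a closed family that the connecting map sees, and that part still has finite rank. -/
theorem exists_primitives {U V : Set S} {r : P → SForm ES S (k + 1)}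
    (hr : r ∈ Submodule.span ℂ {α : P → SForm ES S (k + 1) | ∃ f ∈ {f : P → ℂ | ContDiff ℝ ∞ f},
      ∃ c ∈ bdForms ES (k + 1) U ⊓ bdForms ES (k + 1) V, α = fun w => f w • c}) :
    ∃ A ∈ famOm P k U, ∃ B ∈ famOm P k V, (∀ w, sD (A w) = r w) ∧ (∀ w, sD (B w) = - r w) ∧
      A + B ∈ famFin ES P k (U ∪ V) := by
  induction hr using Submodule.span_induction with
  | mem α h =>
    obtain ⟨f, hf, c, ⟨hcU, hcV⟩, rfl⟩ := h
    obtain ⟨a, ha, hac⟩ := mem_bdForms_succ.1 hcU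
    obtain ⟨b, hb, hbc⟩ := mem_bdForms_succ.1 hcV
    have hb' : (fun _ : ℝ => (-1 : ℂ) • b) ∈ famOm ℝ k V := Submodule.smul_mem _ (-1 : ℂ) hb
    have hbd : sD ((-1 : ℂ) • b) = - c := by
      rw [sD_smul (hb.1.slice 0), hbc]; exact neg_one_smul ℂ c
    refine ⟨fun w => f w • a, smul_mem_famOm (const_mem_famOm ha) hf,
      fun w => f w • ((-1 : ℂ) • b), smul_mem_famOm (const_mem_famOm hb') hf,
      fun w => ?_, fun w => ?_, Submodule.subset_span ⟨f, hf, a + (-1 : ℂ) • b, ⟨?_, ?_⟩, ?_⟩⟩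
    · rw [sD_smul (ha.1.slice 0), hac]
    · rw [sD_smul (hb'.1.slice 0), hbd]; exact smul_neg _ _
    · exact add_mem (famOm_mono subset_union_left ha) (famOm_mono subset_union_right hb')
    · rw [sD_add (ha.1.slice 0) (hb'.1.slice 0), hac, hbd, add_neg_cancel]
    · funext w
      exact (smul_add (f w) a ((-1 : ℂ) • b)).symm
  | zero =>
    refine ⟨0, zero_mem _, 0, zero_mem _, fun w => sD_zero, fun w => ?_, ?_⟩
    · rw [show (0 : P → SForm ES S k) w = 0 from rfl, sD_zero]; exact neg_zero.symm
    · rw [add_zero]; exact zero_mem _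
  | add α β _ _ h h' =>
    obtain ⟨A, hA, B, hB, h1, h2, h3⟩ := h
    obtain ⟨A', hA', B', hB', h1', h2', h3'⟩ := h'
    refine ⟨A + A', add_mem hA hA', B + B', add_mem hB hB', fun w => ?_, fun w => ?_, ?_⟩
    · exact (sD_add (hA.1.slice w) (hA'.1.slice w)).trans (congrArg₂ (· + ·) (h1 w) (h1' w))
    · refine (sD_add (hB.1.slice w) (hB'.1.slice w)).trans ?_
      rw [h2, h2']; exact (neg_add _ _).symm
    · rw [add_add_add_comm]; exact add_mem h3 h3'
  | smul c α _ h =>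
    obtain ⟨A, hA, B, hB, h1, h2, h3⟩ := h
    refine ⟨c • A, Submodule.smul_mem _ c hA, c • B, Submodule.smul_mem _ c hB, fun w => ?_,
      fun w => ?_, ?_⟩
    · exact (sD_smul (hA.1.slice w) c).trans (congrArg (c • ·) (h1 w))
    · refine (sD_smul (hB.1.slice w) c).trans ?_
      rw [h2]; exact smul_neg _ _
    · have e : c • A + c • B = c • (A + B) := (smul_add c A B).symm
      rw [e]; exact Submodule.smul_mem _ c h3

theorem kun_empty : Kun P ES (∅ : Set S) := by
  rintro k α ⟨-, K, -, hK, h0⟩ -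
  have : α = 0 := by
    funext w s
    exact h0 w s fun h => hK h
  rw [this]
  exact zero_mem _

section Cutoff

variable [T2Space S] [SigmaCompactSpace S]

/-- Such a `ρ` splits a form `α` supported in `K` as `ρα + (1 - ρ)α`, with compact supports in `U`
and in `V`. -/
theorem exists_cutoff {U V K : Set S} (hU : IsOpen U) (hV : IsOpen V) (hK : IsCompact K)
    (hKUV : K ⊆ U ∪ V) : ∃ ρ : S → ℝ, ContMDiff 𝓘(ℝ, ES) 𝓘(ℝ, ℝ) ∞ ρ ∧
      ∃ K₁ K₂ : Set S, IsCompact K₁ ∧ K₁ ⊆ U ∧ IsCompact K₂ ∧ K₂ ⊆ V ∧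
        (∀ s ∉ K₁, ρ s = 0) ∧ ∀ s ∈ K, s ∉ K₂ → ρ s = 1 := by
  have : LocallyCompactSpace S := ChartedSpace.locallyCompactSpace ES S
  obtain ⟨L, hL, hKL, hLU⟩ := exists_compact_between (hK.diff hV) hU
    (fun s hs => (hKUV hs.1).resolve_right hs.2)
  obtain ⟨ρ, h1, h0, -⟩ := exists_contMDiffMap_one_nhds_of_subset_interior (n := ⊤) 𝓘(ℝ, ES)
    (hK.diff hV).isClosed hKL
  -- `ρ` is `1` on a neighbourhood `O` of `K \ V`, so within `K` the function `1 - ρ` lives on the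
  -- compact set `K \ O ⊆ V`.
  obtain ⟨O, hO, hKO, hO1⟩ := mem_nhdsSet_iff_exists.1 h1
  refine ⟨ρ, ρ.contMDiff, L, K \ O, hL, hLU, hK.diff hO, fun s hs => ?_, h0, fun s hs hs' => ?_⟩
  · by_contra hsV
    exact hs.2 (hKO ⟨hs.1, hsV⟩)
  · by_contra h
    exact hs' ⟨hs, fun hsO => h (hO1 hsO)⟩

theorem sD_sub {c c' : SForm ES S k} (h : SmoothForm c) (h' : SmoothForm c') :
    sD (c - c') = sD c - sD c' := by
  have h2 : SmoothForm ((-1 : ℂ) • c') :=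
    ((h'.famSmooth (P := ℝ)).smul (contDiff_const (c := (-1 : ℂ)))).slice 0
  have e : c - c' = c + (-1 : ℂ) • c' := by
    rw [sub_eq_add_neg]; exact congrArg (c + ·) (neg_one_smul ℂ c').symm
  rw [e, sD_add h h2, sD_smul h', sub_eq_add_neg]
  exact congrArg (sD c + ·) (neg_one_smul ℂ (sD c'))

/-- The Mayer–Vietoris step. -/
theorem Kun.union {U V : Set S} (hU : IsOpen U) (hV : IsOpen V) (kU : Kun P ES U)
    (kV : Kun P ES V) (kUV : Kun P ES (U ∩ V)) : Kun P ES (U ∪ V) := by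
  intro k α hα hc
  obtain ⟨hαs, K, hK, hKUV, hα0⟩ := hα
  obtain ⟨ρ, hρ, K₁, K₂, hK₁, hK₁U, hK₂, hK₂V, hρ0, hρ1⟩ :=
    exists_cutoff (ES := ES) hU hV hK hKUV
  obtain ⟨α₁, hα₁⟩ : ∃ α₁ : P → SForm ES S k, α₁ = fun w s => ρ s • α w s := ⟨_, rfl⟩
  obtain ⟨α₂, hα₂⟩ : ∃ α₂ : P → SForm ES S k, α₂ = α - α₁ := ⟨_, rfl⟩
  have hs₁ : FamSmooth α₁ := hα₁ ▸ hαs.mul hρ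
  have z₁ : ∀ w, ∀ s ∉ K₁, α₁ w s = 0 := fun w s hs => by
    rw [hα₁]; ext v; simp [hρ0 s hs]
  have m₁ : α₁ ∈ famOm P k U := ⟨hs₁, K₁, hK₁, hK₁U, z₁⟩
  have z₂ : ∀ w, ∀ s ∉ K₂, α₂ w s = 0 := fun w s hs => by
    rw [hα₂, hα₁]
    ext v
    by_cases hsK : s ∈ K
    · simp [hρ1 s hsK hs]
    · simp [hα0 w s hsK]
  have hs₂ : FamSmooth α₂ := by
    have h1 : α ∈ famOm P k (univ : Set S) := ⟨hαs, K, hK, subset_univ _, hα0⟩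
    rw [hα₂]
    exact (sub_mem h1 (famOm_mono (subset_univ U) m₁)).1
  have m₂ : α₂ ∈ famOm P k V := ⟨hs₂, K₂, hK₂, hK₂V, z₂⟩
  have hsum : α = α₁ + α₂ := by rw [hα₂]; abel
  have hd : ∀ w, sD (α₁ w) + sD (α₂ w) = 0 := fun w => by
    rw [← sD_add (hs₁.slice w) (hs₂.slice w), ← hc w, hsum]; rfl
  -- Since `dα₁ = -dα₂`, this family has support in both `K₁` and `K₂`. It represents the image of
  -- `α` under the connecting map.
  have hθ : (fun w => sD (α₁ w)) ∈ famOm P (k + 1) (U ∩ V) := by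
    refine ⟨hs₁.sD, K₁ ∩ K₂, hK₁.inter_right hK₂.isClosed, inter_subset_inter hK₁U hK₂V,
      fun w s hs => ?_⟩
    by_cases h1 : s ∈ K₁
    · have h2 : s ∉ K₂ := fun h => hs ⟨h1, h⟩
      have h3 : sD (α₂ w) s = 0 := sD_eq_zero_of_eventually
        (by filter_upwards [hK₂.isClosed.isOpen_compl.mem_nhds h2] with t ht using z₂ w t ht)
      have h4 : sD (α₁ w) s + sD (α₂ w) s = 0 := congrFun (hd w) s
      rwa [h3, add_zero] at h4
    · exact sD_eq_zero_of_eventually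
        (by filter_upwards [hK₁.isClosed.isOpen_compl.mem_nhds h1] with t ht using z₁ w t ht)
  -- Write `dα₁ = r + dβ` with `r` of finite rank. Then `r = d(α₁ - β)` on `U` and `-r = d(α₂ + β)`
  -- on `V`, so each value of `r` is exact in both sets.
  obtain ⟨r, hr, s, ⟨β, hβ, rfl⟩, hrs⟩ := Submodule.mem_sup.1
    (kUV (k + 1) _ hθ fun w => (hs₁.slice w).sD_sD)
  have hβU := famOm_mono (inter_subset_left (s := U) (t := V)) hβ
  have hβV := famOm_mono (inter_subset_right (s := U) (t := V)) hβ
  have hrw : ∀ w, r w + sD (β w) = sD (α₁ w) := fun w => congrFun hrs w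
  have hrN : ∀ w, r w ∈ bdForms ES (k + 1) U ⊓ bdForms ES (k + 1) V := by
    intro w
    constructor
    · refine mem_bdForms_succ.2 ⟨α₁ w - β w, slice_mem_famOm (sub_mem m₁ hβU) w, ?_⟩
      rw [sD_sub (hs₁.slice w) (hβ.1.slice w), ← hrw w, add_sub_cancel_right]
    · have h2 := slice_mem_famOm (P' := ℝ) (add_mem m₂ hβV) w
      have h3 : sD (α₂ w + β w) = - r w := by
        rw [sD_add (hs₂.slice w) (hβ.1.slice w)]
        have h4 := hd w
        rw [← hrw w] at h4
        rw [eq_neg_iff_add_eq_zero, ← h4]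
        abel
      have h5 : - r w ∈ bdForms ES (k + 1) V := mem_bdForms_succ.2 ⟨_, h2, h3⟩
      exact (Submodule.neg_mem_iff _).1 h5
  -- The fixed forms in `r` can now be taken exact in both `U` and `V`; hence `dA = r`, `dB = -r`,
  -- and `A + B` has finite rank.
  obtain ⟨A, hA, B, hB, hAr, hBr, hAB⟩ := exists_primitives
    (finiteRank_mem_span (A := {f | ContDiff ℝ ∞ f}) hr _ hrN)
  -- The first two summands are closed families supported in `U` and in `V`, to which the hypotheses
  -- apply.
  have e : α = (α₁ - β - A) + (α₂ + β - B) + (A + B) := by rw [hsum]; abel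
  have n₁ := sub_mem (sub_mem m₁ hβU) hA
  have n₂ := sub_mem (add_mem m₂ hβV) hB
  have c₁ := kU k _ n₁ fun w => by
    change sD (α₁ w - β w - A w) = 0
    rw [sD_sub (c := α₁ w - β w) ((sub_mem m₁ hβU).1.slice w) (hA.1.slice w),
      sD_sub (hs₁.slice w) (hβ.1.slice w), hAr, ← hrw w]
    abel
  have c₂ := kV k _ n₂ fun w => by
    change sD (α₂ w + β w - B w) = 0
    rw [sD_sub (c := α₂ w + β w) ((add_mem m₂ hβV).1.slice w) (hB.1.slice w),
      sD_add (hs₂.slice w) (hβ.1.slice w), hBr]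
    have h4 := hd w
    rw [← hrw w] at h4
    rw [← h4]
    abel
  rw [e]
  exact add_mem (add_mem
    (mem_sup_mono subset_union_left c₁)
    (mem_sup_mono subset_union_right c₂))
    (Submodule.mem_sup_left hAB)

/-- The union of a list of sets. -/
def listUnion (t : List (Set S)) : Set S := t.foldr (· ∪ ·) ∅

theorem mem_listUnion {t : List (Set S)} {s : S} : s ∈ listUnion t ↔ ∃ U ∈ t, s ∈ U := by
  induction t with
  | nil => simp [listUnion]
  | cons U t ih =>
    have : listUnion (U :: t) = U ∪ listUnion t := rfl
    simp [this, ih]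

/-- Induction on the length and not on the list: `U ∩ listUnion t` is the union of `t.map (U ∩ ·)`,
a list with other members but the same length as `t`. -/
theorem kun_listUnion {𝓑 : Set (Set S)} (ho : ∀ U ∈ 𝓑, IsOpen U)
    (hi : ∀ U ∈ 𝓑, ∀ V ∈ 𝓑, U ∩ V ∈ 𝓑) (hk : ∀ U ∈ 𝓑, Kun P ES U) :
    ∀ (n : ℕ) (t : List (Set S)), t.length = n → (∀ U ∈ t, U ∈ 𝓑) → Kun P ES (listUnion t)
  | 0, t, hn, _ => by
    rw [List.length_eq_zero_iff.1 hn]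
    exact kun_empty
  | n + 1, [], hn, _ => by simp at hn
  | n + 1, U :: t, hn, ht => by
    have hU : U ∈ 𝓑 := ht U (by simp)
    have ht' : ∀ V ∈ t, V ∈ 𝓑 := fun V hV => ht V (by simp [hV])
    have hlen : t.length = n := by simpa using hn
    have hopen : IsOpen (listUnion t) := by
      have : listUnion t = ⋃ V ∈ t, V := by ext s; simp [mem_listUnion]
      rw [this]
      exact isOpen_biUnion fun V hV => ho V (ht' V hV)
    have hinter : U ∩ listUnion t = listUnion (t.map (U ∩ ·)) := by
      ext s
      simp only [mem_inter_iff, mem_listUnion, List.mem_map]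
      constructor
      · rintro ⟨hs, V, hV, hsV⟩
        exact ⟨_, ⟨V, hV, rfl⟩, hs, hsV⟩
      · rintro ⟨_, ⟨V, hV, rfl⟩, hs, hsV⟩
        exact ⟨hs, V, hV, hsV⟩
    refine Kun.union (ho U hU) hopen (hk U hU) (kun_listUnion ho hi hk n t hlen ht') ?_
    change Kun P ES (U ∩ listUnion t)
    rw [hinter]
    refine kun_listUnion ho hi hk n _ (by simpa using hlen) ?_
    intro V hV
    obtain ⟨V', hV', rfl⟩ := List.mem_map.1 hV
    exact hi U hU V' (ht' V' hV')

/-- If the members of a class of open sets that is closed under intersections have the Künneth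
property, then so does every union of such sets. -/
theorem kun_of_basis {𝓑 : Set (Set S)} (ho : ∀ U ∈ 𝓑, IsOpen U)
    (hi : ∀ U ∈ 𝓑, ∀ V ∈ 𝓑, U ∩ V ∈ 𝓑) (hk : ∀ U ∈ 𝓑, Kun P ES U) {U : Set S}
    (hU : ∀ s ∈ U, ∃ B ∈ 𝓑, s ∈ B ∧ B ⊆ U) : Kun P ES U := by
  intro k α hα hc
  obtain ⟨hαs, K, hK, hKU, h0⟩ := hα
  -- The support is compact, so finitely many members of `𝓑` inside `U` cover it. An arbitrary union
  -- is thus reduced to a finite one.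
  have hcov : ∃ t : List (Set S), (∀ B ∈ t, B ∈ 𝓑 ∧ B ⊆ U) ∧ K ∩ U ⊆ listUnion t := by
    refine hK.induction_on (p := fun K => ∃ t : List (Set S), (∀ B ∈ t, B ∈ 𝓑 ∧ B ⊆ U) ∧
      K ∩ U ⊆ listUnion t) ⟨[], by simp, by simp⟩ ?_ ?_ ?_
    · rintro s t hst ⟨l, h1, h2⟩
      exact ⟨l, h1, (inter_subset_inter_left _ hst).trans h2⟩
    · rintro s t ⟨l, h1, h2⟩ ⟨l', h1', h2'⟩
      refine ⟨l ++ l', fun B hB => ?_, ?_⟩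
      · rcases List.mem_append.1 hB with h | h
        · exact h1 B h
        · exact h1' B h
      · rintro x ⟨hx | hx, hxU⟩
        · obtain ⟨B, hB, hxB⟩ := mem_listUnion.1 (h2 ⟨hx, hxU⟩)
          exact mem_listUnion.2 ⟨B, List.mem_append_left _ hB, hxB⟩
        · obtain ⟨B, hB, hxB⟩ := mem_listUnion.1 (h2' ⟨hx, hxU⟩)
          exact mem_listUnion.2 ⟨B, List.mem_append_right _ hB, hxB⟩
    · intro s hs
      obtain ⟨B, hB, hsB, hBU⟩ := hU s (hKU hs)
      exact ⟨B, mem_nhdsWithin_of_mem_nhds ((ho B hB).mem_nhds hsB), [B], by simp [hB, hBU],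
        fun x hx => mem_listUnion.2 ⟨B, by simp, hx.1⟩⟩
  obtain ⟨t, ht, hKt⟩ := hcov
  have htU : listUnion t ⊆ U := fun s hs => by
    obtain ⟨B, hB, hsB⟩ := mem_listUnion.1 hs
    exact (ht B hB).2 hsB
  have := kun_listUnion ho hi hk _ t rfl (fun B hB => (ht B hB).1) k α
    ⟨hαs, K, hK, fun s hs => hKt ⟨hs, hKU hs⟩, h0⟩ hc
  exact mem_sup_mono htU this

end Cutoff

end MayerVietoris

/-! ### Boxes in charts, and the Künneth theorem for the typical fibre -/

section ChartBoxes

variable {ES : Type*} [NormedAddCommGroup ES] [NormedSpace ℝ ES] [FiniteDimensional ℝ ES]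
  {S : Type*} [TopologicalSpace S] [ChartedSpace ES S] [IsManifold 𝓘(ℝ, ES) ∞ S]
  {P : Type*} [NormedAddCommGroup P] [NormedSpace ℝ P] {k n : ℕ}

/-- The open box with corners `a` and `b`. -/
def openBox (a b : Fin n → ℝ) : Set (Eu n) := {x | ∀ i, a i < x i ∧ x i < b i}

/-- The closed box with corners `a` and `b`. -/
def closedBox (a b : Fin n → ℝ) : Set (Eu n) := {x | ∀ i, a i ≤ x i ∧ x i ≤ b i}

theorem isOpen_openBox (a b : Fin n → ℝ) : IsOpen (openBox a b) := by
  have : openBox a b = ⋂ i, {x : Eu n | a i < x i} ∩ {x : Eu n | x i < b i} := by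
    ext x; simp [openBox]
  rw [this]
  refine isOpen_iInter_of_finite fun i => ?_
  have hc : Continuous fun x : Eu n => x i := (EuclideanSpace.proj (𝕜 := ℝ) i).continuous
  exact (isOpen_lt continuous_const hc).inter (isOpen_lt hc continuous_const)

theorem isCompact_closedBox (a b : Fin n → ℝ) : IsCompact (closedBox a b) := by
  have h := (isCompact_Icc (a := a) (b := b)).image
    (EuclideanSpace.equiv (Fin n) ℝ).symm.continuous
  convert h using 1
  ext x
  simp only [closedBox, mem_ofPred_eq, mem_image, mem_Icc, Pi.le_def]
  constructor
  · intro hx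
    exact ⟨x, ⟨fun i => (hx i).1, fun i => (hx i).2⟩, rfl⟩
  · rintro ⟨y, ⟨h1, h2⟩, rfl⟩ i
    exact ⟨h1 i, h2 i⟩

theorem exists_openBox {O : Set (Eu n)} (hO : IsOpen O) {x : Eu n} (hx : x ∈ O) :
    ∃ a b : Fin n → ℝ, x ∈ openBox a b ∧ openBox a b ⊆ O := by
  -- Boxes around `x` are obtained as balls for the sup norm of `Fin n → ℝ`.
  let e := (EuclideanSpace.equiv (Fin n) ℝ).symm
  have h1 : IsOpen (e ⁻¹' O) := hO.preimage e.continuous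
  obtain ⟨ε, hε, hb⟩ := Metric.isOpen_iff.1 h1 (x : Fin n → ℝ) hx
  refine ⟨fun i => x i - ε, fun i => x i + ε, fun i => ⟨by linarith, by linarith⟩, fun y hy => ?_⟩
  have : (y : Fin n → ℝ) ∈ Metric.ball (x : Fin n → ℝ) ε := by
    rw [Metric.mem_ball, dist_pi_lt_iff hε]
    intro i
    rw [Real.dist_eq, abs_lt]
    constructor <;> linarith [(hy i).1, (hy i).2]
  exact hb this

theorem exists_closedBox {a b : Fin n → ℝ} {K : Set (Eu n)} (hK : IsCompact K)
    (hKb : K ⊆ openBox a b) : ∃ a' b' : Fin n → ℝ, (∀ i, a i < a' i) ∧ (∀ i, b' i < b i) ∧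
      K ⊆ closedBox a' b' := by
  rcases K.eq_empty_or_nonempty with rfl | hne
  · exact ⟨fun i => a i + 1, fun i => b i - 1, by simp, by simp, empty_subset _⟩
  have hc : ∀ i, ContinuousOn (fun x : Eu n => x i) K := fun i =>
    (EuclideanSpace.proj (𝕜 := ℝ) i).continuous.continuousOn
  choose m hm hmin using fun i => hK.exists_isMinOn hne (hc i)
  choose M hM hmax using fun i => hK.exists_isMaxOn hne (hc i)
  exact ⟨fun i => m i i, fun i => M i i, fun i => (hKb (hm i) i).1, fun i => (hKb (hM i) i).2,
    fun x hx i => ⟨hmin i hx, hmax i hx⟩⟩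

open Classical in
/-- Pushforward of a family of forms on Euclidean space along the chart at `s₀`. -/
def push (s₀ : S) (γ : EuFam P (Module.finrank ℝ ES) k) : P → SForm ES S k := fun w s =>
  if s ∈ (ch ES s₀).source then (γ w (ch ES s₀ s)).compContinuousLinearMap
    (mder ES (Eu (Module.finrank ℝ ES)) (ch ES s₀) s) else 0

theorem push_of_mem {s₀ s : S} (hs : s ∈ (ch ES s₀).source) (γ : EuFam P (Module.finrank ℝ ES) k)
    (w : P) : push s₀ γ w s = (γ w (ch ES s₀ s)).compContinuousLinearMap
      (mder ES (Eu (Module.finrank ℝ ES)) (ch ES s₀) s) := if_pos hs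

theorem spull_push {s₀ : S} (γ : EuFam P (Module.finrank ℝ ES) k) (w : P)
    {x : Eu (Module.finrank ℝ ES)} (hx : x ∈ (ch ES s₀).target) :
    spull (ch ES s₀).symm (push s₀ γ w) x = γ w x := by
  ext v
  rw [spull_apply, push_of_mem ((ch ES s₀).map_target hx), (ch ES s₀).right_inv hx]
  simp only [ContinuousAlternatingMap.compContinuousLinearMap_apply]
  refine congrArg (γ w x) (funext fun i => ?_)
  exact congrArg (fun L => L (v i)) (mder_ch_comp_symm hx)

theorem push_eq_of_spull {s₀ : S} {α : SForm ES S k} {γ : EuFam P (Module.finrank ℝ ES) k} {w : P}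
    {s : S} (hs : s ∈ (ch ES s₀).source)
    (h : γ w (ch ES s₀ s) = spull (ch ES s₀).symm α (ch ES s₀ s)) : push s₀ γ w s = α s := by
  ext v
  rw [push_of_mem hs, h]
  simp only [ContinuousAlternatingMap.compContinuousLinearMap_apply, spull_apply,
    (ch ES s₀).left_inv hs]
  refine congrArg (α s) (funext fun i => ?_)
  exact congrArg (fun L => L (v i)) (mder_symm_comp_ch hs)

theorem push_add (s₀ : S) (γ γ' : EuFam P (Module.finrank ℝ ES) k) :
    push (ES := ES) s₀ (γ + γ') = push s₀ γ + push s₀ γ' := by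
  funext w s
  by_cases hs : s ∈ (ch ES s₀).source
  · ext v; simp [push, hs]
  · simp [push, hs]

theorem push_smul (s₀ : S) (f : P → ℂ) (γ : EuFam P (Module.finrank ℝ ES) k) :
    push (ES := ES) s₀ (fun w => f w • γ w) = fun w => f w • push s₀ γ w := by
  funext w s
  by_cases hs : s ∈ (ch ES s₀).source
  · ext v; simp [push, hs]
  · ext v; simp [push, hs]

theorem push_zero (s₀ : S) : push (ES := ES) s₀ (0 : EuFam P (Module.finrank ℝ ES) k) = 0 := by
  funext w s
  by_cases hs : s ∈ (ch ES s₀).source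
  · ext v; simp [push, hs]
  · simp [push, hs]

variable [T2Space S]

/-- The support of the pushforward of a family. -/
theorem push_eventually_zero {s₀ s : S} {γ : EuFam P (Module.finrank ℝ ES) k}
    {K : Set (Eu (Module.finrank ℝ ES))} (hK : IsCompact K) (hKt : K ⊆ (ch ES s₀).target)
    (h0 : ∀ w, ∀ x ∉ K, γ w x = 0) (hs : s ∉ (ch ES s₀).symm '' K) :
    ∀ᶠ t in 𝓝 s, ∀ w, push s₀ γ w t = 0 := by
  have hc : IsCompact ((ch ES s₀).symm '' K) :=
    hK.image_of_continuousOn ((ch ES s₀).continuousOn_symm.mono hKt)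
  filter_upwards [hc.isClosed.isOpen_compl.mem_nhds hs] with t ht w
  by_cases hts : t ∈ (ch ES s₀).source
  · rw [push_of_mem hts, h0 w _ fun h => ht ⟨_, h, (ch ES s₀).left_inv hts⟩]
    rfl
  · simp [push, hts]

/-- Extension by zero is smooth: the image of `K` in the Hausdorff space `S` is compact, hence
closed, so the family vanishes near each point outside the chart domain. -/
theorem push_famSmooth {s₀ : S} {γ : EuFam P (Module.finrank ℝ ES) k}
    (hγ : ContDiff ℝ ∞ fun q : P × Eu (Module.finrank ℝ ES) => γ q.1 q.2)
    {K : Set (Eu (Module.finrank ℝ ES))} (hK : IsCompact K) (hKt : K ⊆ (ch ES s₀).target)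
    (h0 : ∀ w, ∀ x ∉ K, γ w x = 0) : FamSmooth (push (ES := ES) s₀ γ) := by
  intro w s
  by_cases hs : s ∈ (ch ES s₀).source
  · have hsym := (ch ES s).left_inv (mem_ch_source ES s)
    refine contDiffAt_spull_of_chart (s₀ := s₀) (ch ES s).open_target (ch_symm_smooth s)
      ((ch ES s).map_source (mem_ch_source ES s)) (by rwa [hsym]) ?_
    rw [hsym]
    refine (hγ.contDiffAt).congr_of_eventuallyEq ?_
    have h1 : ∀ᶠ q : P × Eu (Module.finrank ℝ ES) in 𝓝 (w, ch ES s₀ s),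
        q.2 ∈ (ch ES s₀).target :=
      (continuous_snd.tendsto (w, ch ES s₀ s)).eventually
        ((ch ES s₀).open_target.mem_nhds ((ch ES s₀).map_source hs))
    filter_upwards [h1] with q hq using spull_push γ q.1 hq
  · have h1 : ∀ᶠ t in 𝓝 s, ∀ w, push s₀ γ w t = 0 := by
      refine push_eventually_zero hK hKt h0 ?_
      rintro ⟨x, hx, rfl⟩
      exact hs ((ch ES s₀).map_target (hKt hx))
    have hc : ContinuousAt (ch ES s).symm (ch ES s s) :=
      (ch ES s).symm.continuousAt ((ch ES s).map_source (mem_ch_source ES s))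
    have h2 : ∀ᶠ x in 𝓝 (ch ES s s), ∀ w, push s₀ γ w ((ch ES s).symm x) = 0 := by
      refine hc.eventually (p := fun t => ∀ w, push s₀ γ w t = 0) ?_
      rwa [(ch ES s).left_inv (mem_ch_source ES s)]
    have h3 : ∀ᶠ q : P × Eu (Module.finrank ℝ ES) in 𝓝 (w, ch ES s s),
        ∀ w, push s₀ γ w ((ch ES s).symm q.2) = 0 :=
      (continuous_snd.tendsto (w, ch ES s s)).eventually h2
    refine (contDiffAt_const (c := 0)).congr_of_eventuallyEq ?_
    filter_upwards [h3] with q hq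
    ext v
    simp [hq]

theorem sD_push {s₀ : S} {γ : EuFam P (Module.finrank ℝ ES) k}
    (hγ : ContDiff ℝ ∞ fun q : P × Eu (Module.finrank ℝ ES) => γ q.1 q.2)
    {K : Set (Eu (Module.finrank ℝ ES))} (hK : IsCompact K) (hKt : K ⊆ (ch ES s₀).target)
    (h0 : ∀ w, ∀ x ∉ K, γ w x = 0) (w : P) : sD (push s₀ γ w) = push (ES := ES) s₀ (euD γ) w := by
  funext s
  by_cases hs : s ∈ (ch ES s₀).source
  · refine (push_eq_of_spull hs ?_).symm
    have hx := (ch ES s₀).map_source hs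
    rw [((push_famSmooth hγ hK hKt h0).slice w).spull_sD (ch ES s₀).open_target
      (ch_symm_smooth s₀) hx]
    refine Filter.EventuallyEq.extDeriv_eq ?_
    filter_upwards [(ch ES s₀).open_target.mem_nhds hx] with x hx using (spull_push γ w hx).symm
  · have h1 : ∀ᶠ t in 𝓝 s, ∀ w, push s₀ γ w t = 0 := by
      refine push_eventually_zero hK hKt h0 ?_
      rintro ⟨x, hx, rfl⟩
      exact hs ((ch ES s₀).map_target (hKt hx))
    rw [sD_eq_zero_of_eventually (by filter_upwards [h1] with t ht using ht w)]
    simp [push, hs]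

/-- The subset of `S` which is a box in the chart at `s₀`. -/
def chartBox (ES : Type*) [NormedAddCommGroup ES] [NormedSpace ℝ ES] [FiniteDimensional ℝ ES]
    {S : Type*} [TopologicalSpace S] [ChartedSpace ES S] (s₀ : S)
    (a b : Fin (Module.finrank ℝ ES) → ℝ) : Set S :=
  (ch ES s₀).source ∩ ch ES s₀ ⁻¹' openBox a b

theorem isOpen_chartBox (s₀ : S) (a b : Fin (Module.finrank ℝ ES) → ℝ) :
    IsOpen (chartBox ES s₀ a b) :=
  (ch ES s₀).isOpen_inter_preimage (isOpen_openBox a b)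

section

variable {s₀ : S} {a b : Fin (Module.finrank ℝ ES) → ℝ} (hab : openBox a b ⊆ (ch ES s₀).target)
include hab

theorem push_box {γ : EuFam P (Module.finrank ℝ ES) k} (hγ : γ ∈ boxM P k a b 0) :
    push (ES := ES) s₀ γ ∈ famOm P k (chartBox ES s₀ a b) ∧
      ∀ w, sD (push s₀ γ w) = push (ES := ES) s₀ (euD γ) w := by
  obtain ⟨hb, a', b', h1, h2, h3⟩ := hγ
  have hsub : closedBox a' b' ⊆ openBox a b := fun x hx i =>
    ⟨(h1 i).trans_le (hx i).1, (hx i).2.trans_lt (h2 i)⟩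
  have hKt := hsub.trans hab
  have h0 : ∀ w, ∀ x ∉ closedBox a' b', γ w x = 0 := by
    intro w x hx
    simp only [closedBox, mem_ofPred_eq, not_forall, not_and_or, not_le] at hx
    obtain ⟨i, hi⟩ := hx
    exact h3 w x i (Nat.zero_le _) hi
  have hK := isCompact_closedBox a' b'
  refine ⟨⟨push_famSmooth hb.smooth hK hKt h0, (ch ES s₀).symm '' closedBox a' b',
    hK.image_of_continuousOn ((ch ES s₀).continuousOn_symm.mono hKt), ?_, fun w s hs => ?_⟩,
    sD_push hb.smooth hK hKt h0⟩
  · rintro _ ⟨x, hx, rfl⟩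
    refine ⟨(ch ES s₀).map_target (hKt hx), ?_⟩
    rw [mem_preimage, (ch ES s₀).right_inv (hKt hx)]
    exact hsub hx
  · exact (push_eventually_zero hK hKt h0 hs).self_of_nhds w

theorem push_boxFin {γ : EuFam P (Module.finrank ℝ ES) k} (hγ : γ ∈ boxFin P k a b 0) :
    push (ES := ES) s₀ γ ∈ famFin ES P k (chartBox ES s₀ a b) := by
  induction hγ using Submodule.span_induction with
  | mem γ h =>
    obtain ⟨f, hf, c, hc, hcc, rfl⟩ := h
    obtain ⟨h1, h2⟩ := push_box hab hc
    refine Submodule.subset_span ⟨f, hf, push s₀ (fun _ : P => c) 0,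
      ⟨slice_mem_famOm h1 0, ?_⟩, ?_⟩
    · rw [h2, hcc, push_zero]
      rfl
    · rw [push_smul s₀ f (fun _ : P => c)]
      rfl
  | zero => rw [push_zero]; exact zero_mem _
  | add γ γ' _ _ h h' => rw [push_add]; exact add_mem h h'
  | smul c γ _ h =>
    have := push_smul (ES := ES) s₀ (fun _ => c) γ
    have e : push (ES := ES) s₀ (c • γ) = c • push s₀ γ := this
    rw [e]
    exact Submodule.smul_mem _ c h

theorem push_boxBd : ∀ {k : ℕ} {γ : EuFam P (Module.finrank ℝ ES) k}, γ ∈ boxBd P a b 0 k →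
    push (ES := ES) s₀ γ ∈ famBd P (chartBox ES s₀ a b) k
  | 0, γ, h => by
    have h : γ = 0 := h
    rw [h, push_zero]
    exact zero_mem _
  | k + 1, _, ⟨β, hβ, rfl⟩ => by
    obtain ⟨h1, h2⟩ := push_box hab hβ
    exact ⟨_, h1, funext h2⟩

open Classical in
-- Read in the chart and extended by zero, a family with compact support in the box lies in `boxM`
-- with `j = 0`, where being basic means only smoothness. The decomposition from `box_poincare` is
-- pushed back to `S`.
theorem kun_chartBox : Kun P ES (chartBox ES s₀ a b) := by
  by_cases hlt : ∀ i, a i < b i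
  swap
  · have : chartBox ES s₀ a b = ∅ := by
      rw [eq_empty_iff_forall_notMem]
      intro s hs
      exact hlt fun i => (hs.2 i).1.trans (hs.2 i).2
    rw [this]
    exact kun_empty
  intro k α hα hc
  obtain ⟨hs, K, hK, hKU, h0⟩ := hα
  set φ := ch ES s₀ with hφ
  have hKs : K ⊆ φ.source := fun s hs => (hKU hs).1
  have hφK : IsCompact (φ '' K) := hK.image_of_continuousOn (φ.continuousOn.mono hKs)
  let γ : EuFam P (Module.finrank ℝ ES) k := fun w x =>
    if x ∈ φ.target then spull φ.symm (α w) x else 0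
  have hγt : ∀ w, ∀ x ∈ φ.target, γ w x = spull φ.symm (α w) x := fun w x hx => if_pos hx
  have hγ0 : ∀ w, ∀ x ∉ φ '' K, γ w x = 0 := by
    intro w x hx
    by_cases hxt : x ∈ φ.target
    · rw [hγt w x hxt]
      have : φ.symm x ∉ K := fun h => hx ⟨_, h, φ.right_inv hxt⟩
      ext v
      simp [h0 w _ this]
    · exact if_neg hxt
  have hγs : ContDiff ℝ ∞ fun q : P × Eu (Module.finrank ℝ ES) => γ q.1 q.2 := by
    rw [contDiff_iff_contDiffAt]
    rintro ⟨w, x⟩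
    by_cases hxt : x ∈ φ.target
    · refine (hs.spull φ.open_target (ch_symm_smooth s₀) hxt w).congr_of_eventuallyEq ?_
      filter_upwards [(continuous_snd.tendsto (w, x)).eventually (φ.open_target.mem_nhds hxt)]
        with q hq using hγt q.1 q.2 hq
    · have hx : x ∉ φ '' K := by
        rintro ⟨s, hs, rfl⟩
        exact hxt (φ.map_source (hKs hs))
      refine (contDiffAt_const (c := 0)).congr_of_eventuallyEq ?_
      filter_upwards [(continuous_snd.tendsto (w, x)).eventually
        (hφK.isClosed.isOpen_compl.mem_nhds hx)] with q hq using hγ0 q.1 q.2 hq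
  have hγc : euD γ = 0 := by
    funext w x
    by_cases hxt : x ∈ φ.target
    · have h1 : γ w =ᶠ[𝓝 x] spull φ.symm (α w) := by
        filter_upwards [φ.open_target.mem_nhds hxt] with y hy using hγt w y hy
      change extDeriv (γ w) x = 0
      rw [h1.extDeriv_eq, ← (hs.slice w).spull_sD φ.open_target (ch_symm_smooth s₀) hxt, hc]
      ext v
      simp
    · refine euD_eq_zero ?_
      have hx : x ∉ φ '' K := by
        rintro ⟨s, hs, rfl⟩
        exact hxt (φ.map_source (hKs hs))
      filter_upwards [hφK.isClosed.isOpen_compl.mem_nhds hx] with y hy using hγ0 w y hy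
  have hγm : γ ∈ boxM P k a b 0 := by
    refine ⟨⟨hγs, fun i hi => absurd hi (Nat.not_lt_zero _),
      fun i hi => absurd hi (Nat.not_lt_zero _)⟩, ?_⟩
    obtain ⟨a', b', h1, h2, h3⟩ := exists_closedBox hφK
      (show φ '' K ⊆ openBox a b by rintro _ ⟨s, hs, rfl⟩; exact (hKU hs).2)
    refine ⟨a', b', h1, h2, fun w x i _ hx => hγ0 w x fun hxK => ?_⟩
    rcases hx with hx | hx
    · exact absurd (h3 hxK i).1 (not_le.2 hx)
    · exact absurd (h3 hxK i).2 (not_le.2 hx)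
  have hpush : push (ES := ES) s₀ γ = α := by
    funext w s
    by_cases hss : s ∈ φ.source
    · exact push_eq_of_spull hss (hγt w _ (φ.map_source hss))
    · rw [h0 w s fun h => hss (hKs h)]
      exact if_neg hss
  obtain ⟨r, hr, t, ht, hrt⟩ := Submodule.mem_sup.1
    (box_poincare hlt _ 0 (Nat.zero_add _) hγm hγc)
  rw [← hpush, ← hrt, push_add]
  exact add_mem (Submodule.mem_sup_left (push_boxFin hab hr))
    (Submodule.mem_sup_right (push_boxBd hab ht))

end

variable [SigmaCompactSpace S]

/-- Boxes in one fixed chart are closed under intersection and form a basis of the topology of its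
domain, so `kun_of_basis` applies. -/
theorem kun_of_subset_chart {U : Set S} (hU : IsOpen U) {s₀ : S} (h : U ⊆ (ch ES s₀).source) :
    Kun P ES U := by
  refine kun_of_basis (𝓑 := {B | ∃ a b, openBox a b ⊆ (ch ES s₀).target ∧ B = chartBox ES s₀ a b})
    ?_ ?_ ?_ ?_
  · rintro _ ⟨a, b, -, rfl⟩
    exact isOpen_chartBox s₀ a b
  · rintro _ ⟨a, b, hab, rfl⟩ _ ⟨a', b', -, rfl⟩
    refine ⟨fun i => max (a i) (a' i), fun i => min (b i) (b' i), fun x hx => hab fun i => ?_, ?_⟩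
    · exact ⟨(le_max_left _ _).trans_lt (hx i).1, (hx i).2.trans_le (min_le_left _ _)⟩
    · ext s
      simp only [chartBox, openBox, mem_inter_iff, mem_preimage, mem_ofPred_eq, max_lt_iff,
        lt_min_iff]
      exact ⟨fun h => ⟨h.1.1, fun i => ⟨⟨(h.1.2 i).1, (h.2.2 i).1⟩, (h.1.2 i).2, (h.2.2 i).2⟩⟩,
        fun h => ⟨⟨h.1, fun i => ⟨(h.2 i).1.1, (h.2 i).2.1⟩⟩,
          h.1, fun i => ⟨(h.2 i).1.2, (h.2 i).2.2⟩⟩⟩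
  · rintro _ ⟨a, b, hab, rfl⟩
    exact kun_chartBox hab
  · intro s hs
    have hO : IsOpen ((ch ES s₀).target ∩ (ch ES s₀).symm ⁻¹' U) :=
      (ch ES s₀).symm.isOpen_inter_preimage hU
    obtain ⟨a, b, hx, hab⟩ := exists_openBox hO (x := ch ES s₀ s)
      ⟨(ch ES s₀).map_source (h hs), by rwa [mem_preimage, (ch ES s₀).left_inv (h hs)]⟩
    refine ⟨_, ⟨a, b, hab.trans inter_subset_left, rfl⟩, ⟨h hs, hx⟩, fun t ht => ?_⟩
    have := (hab ht.2).2
    rwa [mem_preimage, (ch ES s₀).left_inv ht.1] at this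

variable (P ES S) in
/-- Künneth theorem: every closed family of forms with compact support in `S` is the sum of a
family of finite rank and an exact family. -/
theorem kun_univ : Kun P ES (univ : Set S) := by
  -- Boxes taken in different charts need not intersect in boxes. The class of all open subsets of
  -- chart domains is closed under intersection, hence this second application of `kun_of_basis`.
  refine kun_of_basis (𝓑 := {B | IsOpen B ∧ ∃ s₀ : S, B ⊆ (ch ES s₀).source}) ?_ ?_ ?_ ?_
  · exact fun U hU => hU.1
  · rintro U ⟨hU, s₀, hUs⟩ V ⟨hV, -⟩
    exact ⟨hU.inter hV, s₀, inter_subset_left.trans hUs⟩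
  · rintro U ⟨hU, s₀, hUs⟩
    exact kun_of_subset_chart hU hUs
  · intro s _
    exact ⟨_, ⟨(ch ES s).open_source, s, le_rfl⟩, mem_ch_source ES s, subset_univ _⟩

end ChartBoxes

/-! ### Forms on a fibre of `η` as forms on the typical fibre -/

section Bridge

variable {EF EZ ES : Type*} [NormedAddCommGroup EF] [NormedSpace ℝ EF]
  [NormedAddCommGroup EZ] [NormedSpace ℝ EZ]
  [NormedAddCommGroup ES] [NormedSpace ℝ ES] [FiniteDimensional ℝ ES]
  {F Z S : Type*} [TopologicalSpace F] [ChartedSpace EF F]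
  [TopologicalSpace Z] [ChartedSpace EZ Z]
  [TopologicalSpace S] [ChartedSpace ES S] [IsManifold 𝓘(ℝ, ES) ∞ S]
  {η : C^∞⟮𝓘(ℝ, EF), F; 𝓘(ℝ, EZ), Z⟯} {k n : ℕ} {z z₀ : Z}

theorem mem_vert_iff {p : F} {v : EF} : v ∈ Vert η p ↔ mder EF EZ η p v = 0 := Iff.rfl

/-- Tangent vectors at points that are only propositionally equal have different types; the
comparison is therefore made in the model space `EF`. -/
theorem FibForm.apply_congr (a : FibForm η z k ℂ) {p q : Fib η z} (h : p = q)
    {v : Fin k → Vert η p.1} {w : Fin k → Vert η q.1}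
    (hvw : ∀ i, ((v i : TangentSpace 𝓘(ℝ, EF) p.1) : EF) = (w i : TangentSpace 𝓘(ℝ, EF) q.1)) :
    a p v = a q w := by
  subst h
  exact congrArg (a p) (funext fun i => Subtype.ext (hvw i))

/-- The projection to the typical fibre. -/
def SmoothTriv.pr (e : SmoothTriv ES S η) (p : F) : S := (e.toOpenPartialHomeomorph p).2

/-- The inclusion of the typical fibre as the fibre over `z`. -/
def SmoothTriv.inj (e : SmoothTriv ES S η) (z : Z) (s : S) : F :=
  e.toOpenPartialHomeomorph.symm (z, s)

variable (e : SmoothTriv ES S η)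

theorem SmoothTriv.pr_smooth : ContMDiffOn 𝓘(ℝ, EF) 𝓘(ℝ, ES) ∞ e.pr e.toTrivialization.source :=
  contMDiff_snd.comp_contMDiffOn e.smooth_toFun

theorem SmoothTriv.inj_smooth (hz : z ∈ e.baseSet) :
    ContMDiff 𝓘(ℝ, ES) 𝓘(ℝ, EF) ∞ (e.inj z) := by
  rw [← contMDiffOn_univ]
  exact e.smooth_invFun.comp (contMDiffOn_const.prodMk contMDiffOn_id)
    fun s _ => e.mem_target hz s

theorem SmoothTriv.inj_smooth_prod :
    ContMDiffOn (𝓘(ℝ, EZ).prod 𝓘(ℝ, ES)) 𝓘(ℝ, EF) ∞ (fun q : Z × S => e.inj q.1 q.2)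
      (e.baseSet ×ˢ univ) :=
  e.smooth_invFun.mono (by rw [e.target_eq])

theorem SmoothTriv.map_inj (hz : z ∈ e.baseSet) (s : S) : η (e.inj z s) = z := by
  have h := e.mem_target hz s
  have h2 := e.proj_toFun _ (e.toOpenPartialHomeomorph.map_target h)
  rw [e.toOpenPartialHomeomorph.right_inv h] at h2
  exact h2.symm

theorem SmoothTriv.pr_inj (hz : z ∈ e.baseSet) (s : S) : e.pr (e.inj z s) = s := by
  unfold SmoothTriv.pr SmoothTriv.inj
  rw [e.toOpenPartialHomeomorph.right_inv (e.mem_target hz s)]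

theorem SmoothTriv.inj_pr (hz : z ∈ e.baseSet) {p : F} (hp : η p = z) :
    e.inj z (e.pr p) = p := by
  have hs := e.mem_source hz hp
  have : (z, e.pr p) = e.toOpenPartialHomeomorph p :=
    Prod.ext (by rw [e.proj_toFun p hs, hp]) rfl
  unfold SmoothTriv.inj
  rw [this, e.toOpenPartialHomeomorph.left_inv hs]

theorem SmoothTriv.inj_mem_source (hz : z ∈ e.baseSet) (s : S) :
    e.inj z s ∈ e.toTrivialization.source := e.mem_source hz (e.map_inj hz s)

theorem SmoothTriv.pr_mdiffAt (hz : z ∈ e.baseSet) {p : F} (hp : η p = z) :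
    MDifferentiableAt 𝓘(ℝ, EF) 𝓘(ℝ, ES) e.pr p :=
  ContMDiffOn.mdiffAt e.pr_smooth e.toTrivialization.open_source (e.mem_source hz hp)

theorem SmoothTriv.inj_mdiffAt (hz : z ∈ e.baseSet) (s : S) :
    MDifferentiableAt 𝓘(ℝ, ES) 𝓘(ℝ, EF) (e.inj z) s :=
  (e.inj_smooth hz s).mdifferentiableAt (by simp)

theorem SmoothTriv.mder_pr_inj (hz : z ∈ e.baseSet) (s : S) (v : ES) :
    mder EF ES e.pr (e.inj z s) (mder ES EF (e.inj z) s v) = v := by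
  have h := mder_comp (e.pr_mdiffAt hz (e.map_inj hz s)) (e.inj_mdiffAt hz s)
  have h2 : e.pr ∘ e.inj z = id := funext (e.pr_inj hz)
  rw [h2, mder_id] at h
  exact (congrArg (fun L => L v) h).symm

theorem SmoothTriv.mder_inj_mem_vert (hz : z ∈ e.baseSet) (s : S) (v : ES) :
    mder ES EF (e.inj z) s v ∈ Vert η (e.inj z s) :=
  mfderiv_mem_vert isOpen_univ (e.inj_smooth hz).contMDiffOn (fun s _ => e.map_inj hz s)
    (mem_univ s) v

/-- Differentiate `inj (η q) (pr q) = q` at `p`. A vertical vector has `dη v = 0`, so only the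
derivative in the `S`-direction contributes. -/
theorem SmoothTriv.mder_inj_pr (hz : z ∈ e.baseSet) {p : F} (hp : η p = z) {v : EF}
    (hv : v ∈ Vert η p) : mder ES EF (e.inj z) (e.pr p) (mder EF ES e.pr p v) = v := by
  have hs := e.mem_source hz hp
  set G : Z × S → F := fun q => e.inj q.1 q.2 with hG
  set B : F → Z × S := fun q => (η q, e.pr q) with hB
  have hη : MDifferentiableAt 𝓘(ℝ, EF) 𝓘(ℝ, EZ) η p := (η.contMDiff p).mdifferentiableAt (by simp)
  have hpr := e.pr_mdiffAt hz hp
  have hGd : MDifferentiableAt (𝓘(ℝ, EZ).prod 𝓘(ℝ, ES)) 𝓘(ℝ, EF) G (z, e.pr p) :=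
    (e.smooth_invFun.contMDiffAt (e.toOpenPartialHomeomorph.open_target.mem_nhds
      (e.mem_target hz (e.pr p)))).mdifferentiableAt (by simp)
  have hGd' : MDifferentiableAt (𝓘(ℝ, EZ).prod 𝓘(ℝ, ES)) 𝓘(ℝ, EF) G (B p) := by
    have : B p = (z, e.pr p) := by simp [hB, hp]
    rw [this]; exact hGd
  have h1 := mfderiv_comp p hGd' (hη.prodMk hpr)
  have h2 : G ∘ B =ᶠ[𝓝 p] id := by
    filter_upwards [e.toTrivialization.open_source.mem_nhds hs] with q hq
    refine e.inj_pr ?_ rfl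
    rw [e.source_eq] at hq
    exact hq
  have h3 : mfderiv 𝓘(ℝ, EF) 𝓘(ℝ, EF) (G ∘ B) p = ContinuousLinearMap.id ℝ _ := by
    rw [h2.mfderiv_eq, mfderiv_id]
  have hB' : mfderiv 𝓘(ℝ, EF) (𝓘(ℝ, EZ).prod 𝓘(ℝ, ES)) B p v =
      ((0 : EZ), mder EF ES e.pr p v) := by
    have := congrArg (fun L => L v) (mfderiv_prodMk hη hpr)
    exact this.trans (Prod.ext (mem_vert_iff (EF := EF).1 hv) rfl)
  have h4 : mfderiv (𝓘(ℝ, EZ).prod 𝓘(ℝ, ES)) 𝓘(ℝ, EF) G (B p)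
      ((0 : EZ), mder EF ES e.pr p v) = v := by
    have := congrArg (fun L => L v) h1
    rw [h3] at this
    refine (Eq.trans ?_ this.symm)
    exact congrArg (mfderiv (𝓘(ℝ, EZ).prod 𝓘(ℝ, ES)) 𝓘(ℝ, EF) G (B p)) hB'.symm
  have hpair : MDifferentiableAt 𝓘(ℝ, ES) (𝓘(ℝ, EZ).prod 𝓘(ℝ, ES)) (fun s : S => (z, s))
      (e.pr p) := mdifferentiableAt_const.prodMk mdifferentiableAt_id
  have h5 := mfderiv_comp (e.pr p) hGd hpair
  have h6 := congrArg (fun L => L (mder EF ES e.pr p v)) h5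
  have h7 : mfderiv 𝓘(ℝ, ES) (𝓘(ℝ, EZ).prod 𝓘(ℝ, ES)) (fun s : S => (z, s)) (e.pr p)
      (mder EF ES e.pr p v) = ((0 : EZ), mder EF ES e.pr p v) := by
    have := congrArg (fun L => L (mder EF ES e.pr p v))
      (mfderiv_prodMk (I := 𝓘(ℝ, ES)) (I' := 𝓘(ℝ, EZ)) (I'' := 𝓘(ℝ, ES)) (x := e.pr p)
        (f := fun _ : S => z) (g := fun s : S => s) mdifferentiableAt_const mdifferentiableAt_id)
    refine this.trans (Prod.ext ?_ ?_)
    · have : mfderiv 𝓘(ℝ, ES) 𝓘(ℝ, EZ) (fun _ : S => z) (e.pr p) = 0 := mfderiv_const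
      exact congrArg (fun L => L (mder EF ES e.pr p v)) this
    · exact congrArg (fun L => L (mder EF ES e.pr p v)) (mfderiv_id (I := 𝓘(ℝ, ES)) (x := e.pr p))
  have hBp : B p = (z, e.pr p) := by simp [hB, hp]
  rw [hBp] at h4
  refine h6.trans (Eq.trans ?_ h4)
  exact congrArg (mfderiv (𝓘(ℝ, EZ).prod 𝓘(ℝ, ES)) 𝓘(ℝ, EF) G (z, e.pr p)) h7

/-- The derivative of the inclusion of the fibre. -/
def SmoothTriv.injDeriv (hz : z ∈ e.baseSet) (s : S) : ES →L[ℝ] Vert η (e.inj z s) :=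
  ContinuousLinearMap.codRestrict (mder ES EF (e.inj z) s) (Vert η (e.inj z s))
    (e.mder_inj_mem_vert hz s)

/-- The derivative of the projection to the typical fibre, on vertical vectors. -/
def SmoothTriv.prDeriv (p : F) : Vert η p →L[ℝ] ES :=
  (mder EF ES e.pr p).comp (Vert η p).subtypeL

/-- The form on the fibre over `z` corresponding to a form on the typical fibre. -/
def SmoothTriv.fib (z : Z) : SForm ES S k →ₗ[ℂ] FibForm η z k ℂ where
  toFun c p := (c (e.pr p.1)).compContinuousLinearMap (e.prDeriv p.1)
  map_add' _ _ := rfl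
  map_smul' _ _ := rfl

open Classical in
/-- The form on the typical fibre corresponding to a form on the fibre over `z`. -/
def SmoothTriv.toS (z : Z) : FibForm η z k ℂ →ₗ[ℂ] SForm ES S k where
  toFun a s := if hz : z ∈ e.baseSet then
    (a ⟨e.inj z s, e.map_inj hz s⟩).compContinuousLinearMap (e.injDeriv hz s) else 0
  map_add' a b := by
    funext s
    by_cases hz : z ∈ e.baseSet
    · simp only [hz, dif_pos, Pi.add_apply]; rfl
    · simp [hz]
  map_smul' a b := by
    funext s
    by_cases hz : z ∈ e.baseSet
    · simp only [hz, dif_pos, Pi.smul_apply]; rfl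
    · simp only [hz, dif_neg, Pi.smul_apply, not_false_eq_true]; ext v; simp

theorem SmoothTriv.fib_apply (c : SForm ES S k) (p : Fib η z) (v : Fin k → Vert η p.1) :
    e.fib z c p v = c (e.pr p.1) fun i => mder EF ES e.pr p.1 (v i).1 := rfl

theorem SmoothTriv.toS_of_mem (hz : z ∈ e.baseSet) (a : FibForm η z k ℂ) (s : S) :
    e.toS z a s =
      (a ⟨e.inj z s, e.map_inj hz s⟩).compContinuousLinearMap (e.injDeriv hz s) := by
  simp [SmoothTriv.toS, hz]

theorem SmoothTriv.fib_toS (hz : z ∈ e.baseSet) (a : FibForm η z k ℂ) :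
    e.fib z (e.toS z a) = a := by
  funext p
  ext v
  rw [e.fib_apply, e.toS_of_mem hz, ContinuousAlternatingMap.compContinuousLinearMap_apply]
  refine a.apply_congr (Subtype.ext (e.inj_pr hz p.2)) fun i => ?_
  exact e.mder_inj_pr hz p.2 (v i).2

theorem SmoothTriv.toS_fib (hz : z ∈ e.baseSet) (c : SForm ES S k) :
    e.toS z (e.fib z c) = c := by
  funext s
  ext v
  rw [e.toS_of_mem hz, ContinuousAlternatingMap.compContinuousLinearMap_apply, e.fib_apply]
  have : ∀ (s' : S) (w : Fin k → ES), s' = s → w = v → c s' w = c s v := by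
    rintro _ _ rfl rfl; rfl
  exact this _ _ (e.pr_inj hz s) (funext fun i => e.mder_pr_inj hz s (v i))

theorem SmoothTriv.pull_fib (hz : z ∈ e.baseSet) (g : FibPlot η z n) (c : SForm ES S k)
    {x : Eu n} (hx : x ∈ g.dom) : g.pull (e.fib z c) x = spull (e.pr ∘ g.toFun) c x := by
  ext v
  simp only [FibPlot.pull, hx, dif_pos, spull_apply,
    ContinuousAlternatingMap.compContinuousLinearMap_apply]
  rw [e.fib_apply]
  refine congrArg (c (e.pr (g.toFun x))) (funext fun i => ?_)
  have h := mder_comp (e.pr_mdiffAt hz (g.mapsTo x hx))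
    (ContMDiffOn.mdiffAt g.contMDiffOn g.isOpen_dom hx)
  exact (congrArg (fun L => L (v i)) h).symm

theorem SmoothTriv.pr_comp_smooth (hz : z ∈ e.baseSet) (g : FibPlot η z n) :
    ContMDiffOn 𝓘(ℝ, Eu n) 𝓘(ℝ, ES) ∞ (e.pr ∘ g.toFun) g.dom :=
  e.pr_smooth.comp g.contMDiffOn fun x hx => e.mem_source hz (g.mapsTo x hx)

/-- Along a plot `g` the form pulls back to the pullback of `c` along `pr ∘ g`, and `d` is natural.
-/
theorem SmoothTriv.fib_hasExtDeriv (hz : z ∈ e.baseSet) {c : SForm ES S k} (hc : SmoothForm c) :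
    (e.fib z c).HasExtDeriv (e.fib z (sD c)) := by
  intro n g x hx
  have hg := e.pr_comp_smooth hz g
  have he : g.pull (e.fib z c) =ᶠ[𝓝 x] spull (e.pr ∘ g.toFun) c := by
    filter_upwards [g.isOpen_dom.mem_nhds hx] with y hy using e.pull_fib hz g c hy
  refine ⟨((hc.spull g.isOpen_dom hg hx).differentiableAt (by simp)).congr_of_eventuallyEq he, ?_⟩
  rw [he.extDeriv_eq, e.pull_fib hz g _ hx, hc.spull_sD g.isOpen_dom hg hx]

theorem SmoothTriv.fib_mem_omegaC (hz : z ∈ e.baseSet) {c : SForm ES S k}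
    (hc : (fun _ : ℝ => c) ∈ famOm ℝ k univ) : e.fib z c ∈ FibOmegaC η z k ℂ := by
  obtain ⟨h1, K, hK, -, h0⟩ := hc
  refine ⟨fun n g => ?_, ?_⟩
  · refine ContDiffOn.congr (f := spull (e.pr ∘ g.toFun) c) (fun x hx => ?_)
      fun x hx => e.pull_fib hz g c hx
    exact ((h1.slice 0).spull g.isOpen_dom (e.pr_comp_smooth hz g) hx).contDiffWithinAt
  · refine ⟨(fun s => (⟨e.inj z s, e.map_inj hz s⟩ : Fib η z)) '' K, hK.image
      ((e.inj_smooth hz).continuous.subtype_mk _), fun p hp => ?_⟩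
    have : e.pr p.1 ∉ K := fun h => hp ⟨_, h, Subtype.ext (e.inj_pr hz p.2)⟩
    ext v
    have h := h0 0 _ this
    rw [e.fib_apply]
    exact congrArg (fun A : ES [⋀^Fin k]→L[ℝ] ℂ => A fun i => mder EF ES e.pr p.1 (v i).1) h

theorem SmoothTriv.fib_mem_cocycles (hz : z ∈ e.baseSet) {c : SForm ES S k}
    (hc : c ∈ closedForms ES k (univ : Set S)) : e.fib z c ∈ FibCocycles η z k ℂ := by
  refine ⟨e.fib_mem_omegaC hz hc.1, ?_⟩
  have := e.fib_hasExtDeriv hz (hc.1.1.slice 0)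
  rwa [hc.2, map_zero] at this

theorem SmoothTriv.fib_mem_coboundaries (hz : z ∈ e.baseSet) : ∀ {k : ℕ} {c : SForm ES S k},
    c ∈ bdForms ES k (univ : Set S) → e.fib z c ∈ FibCoboundaries η z ℂ k
  | 0, c, h => by
    have h : (fun _ : ℝ => c) = 0 := h
    have h : c = 0 := congrFun h 0
    rw [h, map_zero]; exact zero_mem _
  | k + 1, c, h => by
    obtain ⟨b, hb, rfl⟩ := mem_bdForms_succ.1 h
    exact ⟨_, e.fib_mem_omegaC hz hb, e.fib_hasExtDeriv hz (hb.1.slice 0)⟩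

/-- The chart of `S` at `s`, as a plot of the fibre over `z`. -/
def SmoothTriv.chPlot (hz : z ∈ e.baseSet) (s : S) : FibPlot η z (Module.finrank ℝ ES) where
  dom := (ch ES s).target
  isOpen_dom := (ch ES s).open_target
  toFun := e.inj z ∘ (ch ES s).symm
  contMDiffOn := (e.inj_smooth hz).comp_contMDiffOn (ch_symm_smooth s)
  mapsTo _ _ := e.map_inj hz _

theorem SmoothTriv.spull_toS (hz : z ∈ e.baseSet) (a : FibForm η z k ℂ) (s : S)
    {x : Eu (Module.finrank ℝ ES)} (hx : x ∈ (ch ES s).target) :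
    spull (ch ES s).symm (e.toS z a) x = (e.chPlot hz s).pull a x := by
  rw [show a = e.fib z (e.toS z a) from (e.fib_toS hz a).symm, e.toS_fib hz,
    e.pull_fib hz (e.chPlot hz s) _ (show x ∈ (e.chPlot hz s).dom from hx)]
  have : e.pr ∘ (e.chPlot hz s).toFun = (ch ES s).symm := funext fun y => e.pr_inj hz _
  rw [this]

theorem SmoothTriv.eventually_spull_toS (hz : z ∈ e.baseSet) (a : FibForm η z k ℂ) (s : S) :
    spull (ch ES s).symm (e.toS z a) =ᶠ[𝓝 (ch ES s s)] (e.chPlot hz s).pull a := by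
  filter_upwards [eventually_target (ES := ES) s] with x hx using e.spull_toS hz a s hx

theorem SmoothTriv.toS_smoothForm (hz : z ∈ e.baseSet) {a : FibForm η z k ℂ} (ha : a.IsSmooth) :
    SmoothForm (e.toS z a) := fun s =>
  (((ha _ (e.chPlot hz s)).contDiffAt (eventually_target (ES := ES) s))).congr_of_eventuallyEq
    (e.eventually_spull_toS hz a s)

/-- Inverse charts of `S`, composed with `inj z`, are plots of the fibre, and `HasExtDeriv` is read
off along them. -/
theorem SmoothTriv.sD_toS (hz : z ∈ e.baseSet) {a : FibForm η z k ℂ} {b : FibForm η z (k + 1) ℂ}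
    (h : a.HasExtDeriv b) : sD (e.toS z a) = e.toS z b := by
  funext s
  have hm := (ch ES s).map_source (mem_ch_source ES s)
  have h1 := (h _ (e.chPlot hz s) _ hm).2
  unfold sD
  rw [(e.eventually_spull_toS hz a s).extDeriv_eq, h1, ← e.spull_toS hz b s hm]
  ext v
  simp only [ContinuousAlternatingMap.compContinuousLinearMap_apply, spull_apply]
  rw [(ch ES s).left_inv (mem_ch_source ES s)]
  refine congrArg (e.toS z b s) (funext fun i => ?_)
  exact congrArg (fun L => L (v i)) (mder_symm_comp_ch (mem_ch_source ES s))

theorem SmoothTriv.toS_mem_famOm (hz : z ∈ e.baseSet) {a : FibForm η z k ℂ}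
    (ha : a ∈ FibOmegaC η z k ℂ) : (fun _ : ℝ => e.toS z a) ∈ famOm ℝ k univ := by
  obtain ⟨h1, K, hK, h0⟩ := ha
  have hc : Continuous fun p : Fib η z => e.pr p.1 :=
    e.pr_smooth.continuousOn.comp_continuous continuous_subtype_val fun p => e.mem_source hz p.2
  refine ⟨(e.toS_smoothForm hz h1).famSmooth, _, hK.image hc, subset_univ _, fun w s hs => ?_⟩
  have : (⟨e.inj z s, e.map_inj hz s⟩ : Fib η z) ∉ K := fun h => hs ⟨_, h, e.pr_inj hz s⟩
  change e.toS z a s = 0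
  rw [e.toS_of_mem hz, h0 _ this]
  ext v; simp

theorem SmoothTriv.toS_mem_closedForms (hz : z ∈ e.baseSet) {a : FibForm η z k ℂ}
    (ha : a ∈ FibCocycles η z k ℂ) : e.toS z a ∈ closedForms ES k (univ : Set S) :=
  ⟨e.toS_mem_famOm hz ha.1, by rw [e.sD_toS hz ha.2, map_zero]⟩

theorem SmoothTriv.toS_mem_bdForms (hz : z ∈ e.baseSet) : ∀ {k : ℕ} {a : FibForm η z k ℂ},
    a ∈ FibCoboundaries η z ℂ k → e.toS z a ∈ bdForms ES k (univ : Set S)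
  | 0, a, h => by
    have h : a = 0 := h
    rw [h, map_zero]; exact zero_mem _
  | k + 1, a, ⟨b, hb, h⟩ => mem_bdForms_succ.2 ⟨_, e.toS_mem_famOm hz hb, e.sD_toS hz h⟩

/-- Since `pr ∘ move z = pr`, the diffeomorphism between two fibres is the identity of `S` in the
trivialization `e`. Hence `transport` keeps the form on `S` that represents a class. -/
theorem SmoothTriv.pullForm_fib (hz₀ : z₀ ∈ e.baseSet) (hz : z ∈ e.baseSet) (c : SForm ES S k) :
    e.pullForm hz₀ hz k ℂ (e.fib z c) = e.fib z₀ c := by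
  funext p
  ext v
  change e.fib z c ⟨e.move z p.1, e.map_move hz p.1⟩ (fun i => e.moveDeriv hz₀ hz p (v i)) = _
  rw [e.fib_apply, e.fib_apply]
  have hp : e.pr (e.move z p.1) = e.pr p.1 := e.pr_inj hz _
  have hs := e.mem_source hz₀ p.2
  have key : ∀ (s' s : S) (w w' : Fin k → ES), s' = s → w = w' → c s' w = c s w' := by
    rintro _ _ _ _ rfl rfl; rfl
  refine key _ _ _ _ hp (funext fun i => ?_)
  have h := mder_comp (g := e.pr) (f := e.move z) (e.pr_mdiffAt hz (e.map_move hz p.1))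
    (ContMDiffOn.mdiffAt (e.move_smooth hz) e.toTrivialization.open_source hs)
  have h2 : e.pr ∘ e.move z = e.pr := funext fun q => e.pr_inj hz _
  rw [h2] at h
  exact (congrArg (fun L => L (v i).1) h).symm

/-- The cohomology class of a closed form. -/
def fibClass (a : FibForm η z k ℂ) (h : a ∈ FibCocycles η z k ℂ) : FibHc η z k ℂ :=
  Submodule.Quotient.mk ⟨a, h⟩

theorem fibClass_eq_zero_iff {a : FibForm η z k ℂ} {h : a ∈ FibCocycles η z k ℂ} :
    fibClass a h = 0 ↔ a ∈ FibCoboundaries η z ℂ k := by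
  unfold fibClass
  rw [Submodule.Quotient.mk_eq_zero]
  rfl

theorem SmoothTriv.transport_fibClass (hz₀ : z₀ ∈ e.baseSet) (hz : z ∈ e.baseSet)
    {a : FibForm η z k ℂ} (h : a ∈ FibCocycles η z k ℂ) :
    e.transport k ℂ z₀ z (fibClass a h) =
      fibClass (e.pullForm hz₀ hz k ℂ a) (e.pullForm_cocycles hz₀ hz a h) := by
  unfold SmoothTriv.transport
  rw [dif_pos ⟨hz₀, hz⟩]
  rfl

theorem fibClass_congr {a b : FibForm η z k ℂ} {h : a ∈ FibCocycles η z k ℂ} (hab : a = b) :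
    fibClass a h = fibClass b (hab ▸ h) := by subst hab; rfl

theorem SmoothTriv.transport_fib (hz₀ : z₀ ∈ e.baseSet) (hz : z ∈ e.baseSet)
    {c : SForm ES S k} (hc : c ∈ closedForms ES k (univ : Set S)) :
    e.transport k ℂ z₀ z (fibClass (e.fib z c) (e.fib_mem_cocycles hz hc)) =
      fibClass (e.fib z₀ c) (e.fib_mem_cocycles hz₀ hc) := by
  rw [e.transport_fibClass hz₀ hz]
  exact fibClass_congr (e.pullForm_fib hz₀ hz c)

theorem SmoothTriv.exists_closedForm (hz : z ∈ e.baseSet) (h : FibHc η z k ℂ) :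
    ∃ c, ∃ hc : c ∈ closedForms ES k (univ : Set S),
      h = fibClass (e.fib z c) (e.fib_mem_cocycles hz hc) := by
  obtain ⟨⟨a, ha⟩, rfl⟩ := Submodule.Quotient.mk_surjective _ h
  exact ⟨e.toS z a, e.toS_mem_closedForms hz ha, (fibClass_congr (e.fib_toS hz a).symm)⟩

end Bridge

/-! ### Derivatives of smooth maps applied to vector fields -/

section TangentMap

variable {E E' EA M M' A : Type*} [NormedAddCommGroup E] [NormedSpace ℝ E]
  [NormedAddCommGroup E'] [NormedSpace ℝ E'] [NormedAddCommGroup EA] [NormedSpace ℝ EA]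
  [TopologicalSpace M] [ChartedSpace E M] [TopologicalSpace M'] [ChartedSpace E' M']
  [TopologicalSpace A] [ChartedSpace EA A] [IsManifold 𝓘(ℝ, E) ∞ M] [IsManifold 𝓘(ℝ, E') ∞ M']

/-- The derivative of a smooth map takes smooth vector fields to smooth vector fields. -/
theorem contMDiffOn_mder_apply {g : M → M'} {O : Set M} (hO : IsOpen O)
    (hg : ContMDiffOn 𝓘(ℝ, E) 𝓘(ℝ, E') ∞ g O) {b : A → M} {X : A → E} {s : Set A}
    (hX : ContMDiffOn 𝓘(ℝ, EA) 𝓘(ℝ, E).tangent ∞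
      (fun a => (⟨b a, X a⟩ : TangentBundle 𝓘(ℝ, E) M)) s) (hb : MapsTo b s O) :
    ContMDiffOn 𝓘(ℝ, EA) 𝓘(ℝ, E').tangent ∞
      (fun a => (⟨g (b a), mder E E' g (b a) (X a)⟩ : TangentBundle 𝓘(ℝ, E') M')) s := by
  have h := (hg.contMDiffOn_tangentMapWithin (m := ∞) (by simp) hO.uniqueMDiffOn).comp hX
    (fun a ha => hb ha)
  refine h.congr fun a ha => ?_
  change _ = (⟨g (b a), mfderivWithin 𝓘(ℝ, E) 𝓘(ℝ, E') g O (b a) (X a)⟩ :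
    TangentBundle 𝓘(ℝ, E') M')
  rw [mfderivWithin_of_isOpen hO (hb ha)]
  rfl

theorem contMDiffOn_mder_apply_vectorSpace {g : M → E'} {O : Set M} (hO : IsOpen O)
    (hg : ContMDiffOn 𝓘(ℝ, E) 𝓘(ℝ, E') ∞ g O) {X : M → E}
    (hX : ContMDiffOn 𝓘(ℝ, E) 𝓘(ℝ, E).tangent ∞
      (fun a => (⟨a, X a⟩ : TangentBundle 𝓘(ℝ, E) M)) O) :
    ContMDiffOn 𝓘(ℝ, E) 𝓘(ℝ, E') ∞ (fun a => mder E E' g a (X a)) O :=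
  (contMDiff_snd_tangentBundle_modelSpace E' 𝓘(ℝ, E')).comp_contMDiffOn
    (contMDiffOn_mder_apply hO hg hX fun _ h => h)

end TangentMap

/-! ### Multiplication of sections by functions, and extension of vertical fields -/

section Sections

variable {EF EZ : Type*} [NormedAddCommGroup EF] [NormedSpace ℝ EF]
  [NormedAddCommGroup EZ] [NormedSpace ℝ EZ]
  {F Z : Type*} [TopologicalSpace F] [ChartedSpace EF F] [IsManifold 𝓘(ℝ, EF) ∞ F]
  [TopologicalSpace Z] [ChartedSpace EZ Z]
  {η : C^∞⟮𝓘(ℝ, EF), F; 𝓘(ℝ, EZ), Z⟯} {k : ℕ}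
  {EV : Type*} [NormedAddCommGroup EV] [NormedSpace ℂ EV]
  {V : Z → Type*} [∀ z, AddCommGroup (V z)] [∀ z, Module ℂ (V z)]
  [∀ z, TopologicalSpace (V z)] [∀ z, IsTopologicalAddGroup (V z)]
  [∀ z, ContinuousSMul ℂ (V z)] [TopologicalSpace (TotalSpace EV V)]
  [FiberBundle EV V] [VectorBundle ℂ EV V]

theorem contMDiffAt_smul_fun {EM M : Type*} [NormedAddCommGroup EM] [NormedSpace ℝ EM]
    [TopologicalSpace M] [ChartedSpace EM M] {b : M → Z} {u : ∀ x, V (b x)} {x : M}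
    {f : M → ℂ} (hf : ContMDiffAt 𝓘(ℝ, EM) 𝓘(ℝ, ℂ) ∞ f x)
    (hu : ContMDiffAt 𝓘(ℝ, EM) (𝓘(ℝ, EZ).prod 𝓘(ℝ, EV)) ∞
      (fun x => (⟨b x, u x⟩ : TotalSpace EV V)) x) :
    ContMDiffAt 𝓘(ℝ, EM) (𝓘(ℝ, EZ).prod 𝓘(ℝ, EV)) ∞
      (fun x => (⟨b x, f x • u x⟩ : TotalSpace EV V)) x := by
  rw [contMDiffAt_totalSpace] at hu ⊢
  refine ⟨hu.1, ?_⟩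
  have hmem : ∀ᶠ y in 𝓝 x, b y ∈ (trivializationAt EV V (b x)).baseSet :=
    hu.1.continuousAt ((trivializationAt EV V (b x)).open_baseSet.mem_nhds
      (mem_baseSet_trivializationAt EV V (b x)))
  have hc : ContDiff ℝ ∞ fun q : ℂ × EV => q.1 • q.2 := contDiff_fst.smul contDiff_snd
  have key := hc.contMDiff.contMDiffAt.comp x (hf.prodMk_space hu.2)
  refine key.congr_of_eventuallyEq (hmem.mono fun y hy => ?_)
  exact ((trivializationAt EV V (b x)).linear ℂ hy).2 _ _

/-- A vertical vector field that is smooth near `p₀` agrees near `p₀` with a global one. -/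
theorem exists_vertical_extension [FiniteDimensional ℝ EF] [T2Space F] {O : Set F} (hO : IsOpen O)
    {X : F → EF}
    (hX : ContMDiffOn 𝓘(ℝ, EF) 𝓘(ℝ, EF).tangent ∞
      (fun p => (⟨p, X p⟩ : TangentBundle 𝓘(ℝ, EF) F)) O)
    (hv : ∀ p ∈ O, X p ∈ Vert η p) {p₀ : F} (hp₀ : p₀ ∈ O) :
    ∃ Y : ∀ p : F, Vert η p, ContMDiff 𝓘(ℝ, EF) 𝓘(ℝ, EF).tangent ∞
      (fun p => (⟨p, (Y p : TangentSpace 𝓘(ℝ, EF) p)⟩ : TangentBundle 𝓘(ℝ, EF) F)) ∧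
      ∀ᶠ p in 𝓝 p₀, ((Y p : TangentSpace 𝓘(ℝ, EF) p) : EF) = X p := by
  -- `RelForm.IsSmooth` tests a form on global vertical fields only, while coordinate fields are
  -- local; a bump function at `p₀` bridges the gap.
  obtain ⟨χ, -, hχ⟩ := (SmoothBumpFunction.nhds_basis_tsupport (I := 𝓘(ℝ, EF)) p₀).mem_iff.1
    (hO.mem_nhds hp₀)
  have hmem : ∀ p, χ p • X p ∈ Vert η p := fun p => by
    by_cases hp : p ∈ O
    · exact (Vert η p).smul_mem _ (hv p hp)
    · have : χ p = 0 := image_eq_zero_of_notMem_tsupport fun h => hp (hχ h)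
      rw [this, zero_smul]; exact (Vert η p).zero_mem
  refine ⟨fun p => ⟨χ p • X p, hmem p⟩, ?_, ?_⟩
  · exact ContMDiffOn.smul_section_of_tsupport (I := 𝓘(ℝ, EF)) (V := TangentSpace 𝓘(ℝ, EF))
      (s := X) χ.contMDiff.contMDiffOn hO hχ hX
  · filter_upwards [χ.eventuallyEq_one] with p hp
    change χ p • X p = X p
    rw [hp]; exact one_smul ℝ _

end Sections

/-! ### From families on the typical fibre to relative forms -/

section Bridge

variable {EF EZ ES : Type*} [NormedAddCommGroup EF] [NormedSpace ℝ EF] [FiniteDimensional ℝ EF]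
  [NormedAddCommGroup EZ] [NormedSpace ℝ EZ] [FiniteDimensional ℝ EZ]
  [NormedAddCommGroup ES] [NormedSpace ℝ ES] [FiniteDimensional ℝ ES]
  {F Z S : Type*} [TopologicalSpace F] [T2Space F] [ChartedSpace EF F] [IsManifold 𝓘(ℝ, EF) ∞ F]
  [TopologicalSpace Z] [T2Space Z] [ChartedSpace EZ Z] [IsManifold 𝓘(ℝ, EZ) ∞ Z]
  [TopologicalSpace S] [ChartedSpace ES S] [IsManifold 𝓘(ℝ, ES) ∞ S]
  {η : C^∞⟮𝓘(ℝ, EF), F; 𝓘(ℝ, EZ), Z⟯} {k : ℕ} {z₁ : Z}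
  {EV : Type*} [NormedAddCommGroup EV] [NormedSpace ℂ EV]
  {V : Z → Type*} [∀ z, AddCommGroup (V z)] [∀ z, Module ℂ (V z)]
  [∀ z, TopologicalSpace (V z)] [∀ z, IsTopologicalAddGroup (V z)]
  [∀ z, ContinuousSMul ℂ (V z)] [TopologicalSpace (TotalSpace EV V)]
  [FiberBundle EV V] [VectorBundle ℂ EV V]
  (e : SmoothTriv ES S η)

/-- The relative form with values in `V` whose restriction to the fibre over `z` corresponds to
`W z ⊗ b z`. -/
def SmoothTriv.relOf (W : Z → SForm ES S k) (b : ∀ z, V z) : RelForm V η k := fun p =>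
  ((ContinuousLinearMap.toSpanSingleton ℂ (b (η p))).restrictScalars
    ℝ).compContinuousAlternatingMap (e.fib (η p) (W (η p)) ⟨p, rfl⟩)

theorem SmoothTriv.relOf_apply (W : Z → SForm ES S k) (b : ∀ z, V z) (p : F)
    (v : Fin k → Vert η p) :
    e.relOf W b p v = W (η p) (e.pr p) (fun i => mder EF ES e.pr p (v i).1) • b (η p) := rfl

theorem SmoothTriv.relOf_restrict (W : Z → SForm ES S k) (b : ∀ z, V z) (l : ∀ z, V z →L[ℂ] ℂ)
    (z : Z) : (e.relOf W b).restrict l z = l z (b z) • e.fib z (W z) := by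
  funext p
  obtain ⟨p, rfl⟩ := p
  ext v
  change l (η p) (e.relOf W b p v) = l (η p) (b (η p)) * e.fib (η p) (W (η p)) ⟨p, rfl⟩ v
  rw [e.relOf_apply, map_smul, smul_eq_mul, mul_comm]
  rfl

/-- Near a point over `K`, the value on fields `X i` is the coordinate expression of `α` on the
vectors `d(ch ∘ pr)(X i)`, times `b`. A point not over `K` has a neighbourhood over which `b`
vanishes, so nothing is required outside the trivialization. -/
theorem SmoothTriv.relOf_isSmooth {α : EZ → SForm ES S k} (hα : FamSmooth α) {b : ∀ z, V z}
    (hb : ContMDiff 𝓘(ℝ, EZ) (𝓘(ℝ, EZ).prod 𝓘(ℝ, EV)) ∞ (fun z => (⟨z, b z⟩ : TotalSpace EV V)))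
    {K : Set Z} (hK : IsCompact K) (hKB : K ⊆ e.baseSet ∩ (chartAt EZ z₁).source)
    (h0 : ∀ z ∉ K, b z = 0) :
    RelForm.IsSmooth EV (e.relOf (fun z => α (chartAt EZ z₁ z)) b) := by
  intro X hX p₀
  by_cases hp : η p₀ ∈ K
  · obtain ⟨hpe, hpφ⟩ := hKB hp
    set s₀ := e.pr p₀ with hs₀
    have hps := e.mem_source hpe rfl
    set O : Set F := e.toTrivialization.source ∩ e.pr ⁻¹' (ch ES s₀).source with hOdef
    have hO : IsOpen O := e.pr_smooth.continuousOn.isOpen_inter_preimage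
      e.toTrivialization.open_source (ch ES s₀).open_source
    have hpO : p₀ ∈ O := ⟨hps, mem_ch_source ES s₀⟩
    have hh : ContMDiffOn 𝓘(ℝ, EF) 𝓘(ℝ, Eu (Module.finrank ℝ ES)) ∞ (ch ES s₀ ∘ e.pr) O :=
      (ch_smooth s₀).comp (e.pr_smooth.mono inter_subset_left) fun p hp => hp.2
    have h1 : ContMDiffAt 𝓘(ℝ, EF) 𝓘(ℝ, EZ × Eu (Module.finrank ℝ ES)) ∞
        (fun p => (chartAt EZ z₁ (η p), ch ES s₀ (e.pr p))) p₀ := by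
      refine ContMDiffAt.prodMk_space ?_ (hh.contMDiffAt (hO.mem_nhds hpO))
      exact ((contMDiffOn_chart (x := z₁)).contMDiffAt
        ((chartAt EZ z₁).open_source.mem_nhds hpφ)).comp p₀ (η.contMDiff p₀)
    have h2 : ContMDiffAt 𝓘(ℝ, EF) 𝓘(ℝ, Eu (Module.finrank ℝ ES) [⋀^Fin k]→L[ℝ] ℂ) ∞
        (fun p => spull (ch ES s₀).symm (α (chartAt EZ z₁ (η p))) (ch ES s₀ (e.pr p))) p₀ :=
      ContMDiffAt.comp (g := fun q : EZ × Eu (Module.finrank ℝ ES) =>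
        spull (ch ES s₀).symm (α q.1) q.2) p₀ (hα _ s₀).contMDiffAt h1
    have h3 : ∀ i, ContMDiffAt 𝓘(ℝ, EF) 𝓘(ℝ, Eu (Module.finrank ℝ ES)) ∞
        (fun p => mder EF (Eu (Module.finrank ℝ ES)) (ch ES s₀ ∘ e.pr) p (X i p).1) p₀ := fun i =>
      (contMDiffOn_mder_apply_vectorSpace hO hh (hX i).contMDiffOn).contMDiffAt (hO.mem_nhds hpO)
    have h4 : ContMDiffAt 𝓘(ℝ, EF) 𝓘(ℝ, ℂ) ∞
        (fun p => spull (ch ES s₀).symm (α (chartAt EZ z₁ (η p))) (ch ES s₀ (e.pr p))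
          fun i => mder EF (Eu (Module.finrank ℝ ES)) (ch ES s₀ ∘ e.pr) p (X i p).1) p₀ :=
      contDiff_altMap_apply.contMDiff.contMDiffAt.comp p₀
        (h2.prodMk_space (contMDiffAt_pi_space.2 h3))
    have h5 := contMDiffAt_smul_fun (EV := EV) (V := V) (b := η) (u := fun p => b (η p)) h4
      ((hb (η p₀)).comp p₀ (η.contMDiff p₀))
    refine h5.congr_of_eventuallyEq ?_
    filter_upwards [hO.mem_nhds hpO] with p hpO'
    rw [e.relOf_apply, spull_apply, (ch ES s₀).left_inv hpO'.2]
    refine congrArg (fun c : ℂ => (⟨η p, c • b (η p)⟩ : TotalSpace EV V)) ?_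
    refine congrArg (α (chartAt EZ z₁ (η p)) (e.pr p)) (funext fun i => ?_)
    have hc := mder_comp (ContMDiffOn.mdiffAt (ch_smooth s₀) (ch ES s₀).open_source hpO'.2)
      (ContMDiffOn.mdiffAt e.pr_smooth e.toTrivialization.open_source hpO'.1)
    rw [hc]
    exact (congrArg (fun L => L (mder EF ES e.pr p (X i p).1))
      (mder_symm_comp_ch hpO'.2)).symm
  · have hz := contMDiffWithinAt_zero EV (V := V) (x := p₀) (O := univ) (b := η)
      (η.contMDiff p₀).contMDiffWithinAt
    refine (contMDiffWithinAt_univ.1 hz).congr_of_eventuallyEq ?_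
    filter_upwards [η.contMDiff.continuous.continuousAt.preimage_mem_nhds
      (hK.isClosed.isOpen_compl.mem_nhds hp)] with p hp
    rw [e.relOf_apply, h0 _ hp, smul_zero]

end Bridge

/-! ### From relative forms to families on the typical fibre, and back -/

section Bridge

variable {EF EZ ES : Type*} [NormedAddCommGroup EF] [NormedSpace ℝ EF] [FiniteDimensional ℝ EF]
  [NormedAddCommGroup EZ] [NormedSpace ℝ EZ] [FiniteDimensional ℝ EZ]
  [NormedAddCommGroup ES] [NormedSpace ℝ ES] [FiniteDimensional ℝ ES]
  {F Z S : Type*} [TopologicalSpace F] [T2Space F] [ChartedSpace EF F] [IsManifold 𝓘(ℝ, EF) ∞ F]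
  [TopologicalSpace Z] [T2Space Z] [ChartedSpace EZ Z] [IsManifold 𝓘(ℝ, EZ) ∞ Z]
  [TopologicalSpace S] [ChartedSpace ES S] [IsManifold 𝓘(ℝ, ES) ∞ S]
  {η : C^∞⟮𝓘(ℝ, EF), F; 𝓘(ℝ, EZ), Z⟯} {k : ℕ} {z₁ : Z}
  {EV : Type*} [NormedAddCommGroup EV] [NormedSpace ℂ EV]
  {V : Z → Type*} [∀ z, AddCommGroup (V z)] [∀ z, Module ℂ (V z)]
  [∀ z, TopologicalSpace (V z)] [∀ z, IsTopologicalAddGroup (V z)]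
  [∀ z, ContinuousSMul ℂ (V z)] [TopologicalSpace (TotalSpace EV V)]
  [FiberBundle EV V] [VectorBundle ℂ EV V]
  (e : SmoothTriv ES S η)

section RelOf

variable {b : ∀ z, V z}
  (hb : ContMDiff 𝓘(ℝ, EZ) (𝓘(ℝ, EZ).prod 𝓘(ℝ, EV)) ∞ (fun z => (⟨z, b z⟩ : TotalSpace EV V)))
  {K : Set Z} (hK : IsCompact K) (hKB : K ⊆ e.baseSet ∩ (chartAt EZ z₁).source)
  (h0 : ∀ z ∉ K, b z = 0)

include hb hK hKB h0

theorem SmoothTriv.relOf_mem_omegaC {α : EZ → SForm ES S k} (hα : α ∈ famOm EZ k univ) :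
    e.relOf (fun z => α (chartAt EZ z₁ z)) b ∈ RelOmegaC EV V η k := by
  refine ⟨e.relOf_isSmooth hα.1 hb hK hKB h0, ?_⟩
  obtain ⟨-, L, hL, -, hL0⟩ := hα
  refine ⟨(fun q : Z × S => e.inj q.1 q.2) '' (K ×ˢ L), (hK.prod hL).image_of_continuousOn
    (e.inj_smooth_prod.continuousOn.mono (prod_mono (fun z hz => (hKB hz).1) (subset_univ L))),
    fun p hp => ?_⟩
  ext v
  rw [e.relOf_apply]
  by_cases hz : η p ∈ K
  · have hs : e.pr p ∉ L := fun h => hp ⟨(η p, e.pr p), ⟨hz, h⟩, e.inj_pr (hKB hz).1 rfl⟩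
    rw [hL0 _ _ hs]
    exact zero_smul ℂ (b (η p))
  · rw [h0 _ hz, smul_zero]
    rfl

theorem SmoothTriv.relOf_hasRelDeriv {α : EZ → SForm ES S k} (hα : α ∈ famOm EZ k univ) :
    RelForm.HasRelDeriv (e.relOf (fun z => α (chartAt EZ z₁ z)) b)
      (e.relOf (fun z => sD (α (chartAt EZ z₁ z))) b) := by
  intro l z
  rw [e.relOf_restrict, e.relOf_restrict]
  by_cases hz : z ∈ K
  · exact (e.fib_hasExtDeriv (hKB hz).1 (hα.1.slice _)).smul _
  · rw [h0 z hz, map_zero, zero_smul, zero_smul]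
    exact FibForm.hasExtDeriv_zero

theorem SmoothTriv.relOf_mem_cocycles {α : EZ → SForm ES S k} (hα : α ∈ famOm EZ k univ)
    (hd : ∀ w, sD (α w) = 0) :
    e.relOf (fun z => α (chartAt EZ z₁ z)) b ∈ RelCocycles EV V η k := by
  refine ⟨e.relOf_mem_omegaC hb hK hKB h0 hα, ?_⟩
  have h := e.relOf_hasRelDeriv hb hK hKB h0 hα
  have h1 : e.relOf (fun z => sD (α (chartAt EZ z₁ z))) b = 0 := by
    funext p
    ext v
    rw [e.relOf_apply, hd]
    exact zero_smul ℂ (b (η p))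
  rwa [h1] at h

end RelOf

theorem SmoothTriv.relOf_mem_coboundaries {b : ∀ z, V z}
    (hb : ContMDiff 𝓘(ℝ, EZ) (𝓘(ℝ, EZ).prod 𝓘(ℝ, EV)) ∞ (fun z => (⟨z, b z⟩ : TotalSpace EV V)))
    {K : Set Z} (hK : IsCompact K) (hKB : K ⊆ e.baseSet ∩ (chartAt EZ z₁).source)
    (h0 : ∀ z ∉ K, b z = 0) : ∀ {k : ℕ} {α : EZ → SForm ES S k}, α ∈ famBd EZ univ k →
      e.relOf (fun z => α (chartAt EZ z₁ z)) b ∈ RelCoboundaries EV V η k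
  | 0, α, h => by
    have h : α = 0 := h
    have h1 : e.relOf (fun z => α (chartAt EZ z₁ z)) b = 0 := by
      funext p
      ext v
      rw [e.relOf_apply, h]
      exact zero_smul ℂ (b (η p))
    rw [h1]
    exact zero_mem _
  | k + 1, _, ⟨β, hβ, rfl⟩ =>
    ⟨_, e.relOf_mem_omegaC hb hK hKB h0 hβ, e.relOf_hasRelDeriv hb hK hKB h0 hβ⟩

/-- The family of functionals on the fibres of `V` given by a functional on the model fibre. -/
def linAt (t : Trivialization EV (π EV V)) [MemTrivializationAtlas t] (f : EV →L[ℂ] ℂ) (z : Z) :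
    V z →L[ℂ] ℂ := f.comp (t.continuousLinearMapAt ℂ z)

theorem linAt_apply (t : Trivialization EV (π EV V)) [MemTrivializationAtlas t] (f : EV →L[ℂ] ℂ)
    {z : Z} (hz : z ∈ t.baseSet) (v : V z) : linAt t f z v = f (t ⟨z, v⟩).2 := by
  change f (t.continuousLinearMapAt ℂ z v) = _
  rw [Trivialization.continuousLinearMapAt_apply, t.coe_linearMapAt_of_mem hz]

open Classical in
/-- The family of forms on the typical fibre corresponding to a family of forms on the fibres,
cut off by the function `ρ` and expressed in the chart at `z₁`. -/
def SmoothTriv.famOf (z₁ : Z) (ρ : Z → ℝ) (a : ∀ z, FibForm η z k ℂ) : EZ → SForm ES S k := fun w =>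
  if w ∈ (chartAt EZ z₁).target then
    ((ρ ((chartAt EZ z₁).symm w) : ℝ) : ℂ) •
      e.toS ((chartAt EZ z₁).symm w) (a ((chartAt EZ z₁).symm w)) else 0

theorem SmoothTriv.famOf_of_mem {ρ : Z → ℝ} {a : ∀ z, FibForm η z k ℂ} {w : EZ}
    (hw : w ∈ (chartAt EZ z₁).target) : e.famOf z₁ ρ a w =
      ((ρ ((chartAt EZ z₁).symm w) : ℝ) : ℂ) •
      e.toS ((chartAt EZ z₁).symm w) (a ((chartAt EZ z₁).symm w)) := by
  rw [SmoothTriv.famOf, if_pos hw]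

theorem SmoothTriv.famOf_chart {ρ : Z → ℝ} {a : ∀ z, FibForm η z k ℂ} {z : Z}
    (hz : z ∈ (chartAt EZ z₁).source) :
    e.famOf z₁ ρ a (chartAt EZ z₁ z) = ((ρ z : ℝ) : ℂ) • e.toS z (a z) := by
  rw [e.famOf_of_mem ((chartAt EZ z₁).map_source hz), (chartAt EZ z₁).left_inv hz]

theorem SmoothTriv.famOf_eq_zero {ρ : Z → ℝ} {a : ∀ z, FibForm η z k ℂ} {K : Set Z}
    (h0 : ∀ z ∉ K, ρ z = 0) {w : EZ} (hw : w ∉ chartAt EZ z₁ '' K) : e.famOf z₁ ρ a w = 0 := by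
  by_cases hw' : w ∈ (chartAt EZ z₁).target
  · have : (chartAt EZ z₁).symm w ∉ K := fun h => hw ⟨_, h, (chartAt EZ z₁).right_inv hw'⟩
    rw [e.famOf_of_mem hw', h0 _ this]
    exact zero_smul (M₀ := ℂ) (A := SForm ES S k) _
  · rw [SmoothTriv.famOf, if_neg hw']

/-- The parametrization of `F` given by the chart of the base at `z₁` and the chart of the typical
fibre at `s₀`. -/
def SmoothTriv.param (z₁ : Z) (s₀ : S) (q : EZ × Eu (Module.finrank ℝ ES)) : F :=
  e.inj ((chartAt EZ z₁).symm q.1) ((ch ES s₀).symm q.2)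

/-- The chart of `F` given by the chart of the base at `z₁` and the chart of the typical
fibre at `s₀`. -/
def SmoothTriv.coor (z₁ : Z) (s₀ : S) (p : F) : EZ × Eu (Module.finrank ℝ ES) :=
  (chartAt EZ z₁ (η p), ch ES s₀ (e.pr p))

/-- The domain of `param`. -/
def SmoothTriv.paramDom (z₁ : Z) (s₀ : S) : Set (EZ × Eu (Module.finrank ℝ ES)) :=
  ((chartAt EZ z₁).target ∩ (chartAt EZ z₁).symm ⁻¹' e.baseSet) ×ˢ (ch ES s₀).target

/-- The domain of `coor`. -/
def SmoothTriv.coorDom (z₁ : Z) (s₀ : S) : Set F :=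
  (e.toTrivialization.source ∩ e.pr ⁻¹' (ch ES s₀).source) ∩ η ⁻¹' (chartAt EZ z₁).source

theorem SmoothTriv.isOpen_paramDom (s₀ : S) : IsOpen (e.paramDom z₁ s₀) :=
  ((chartAt EZ z₁).isOpen_inter_preimage_symm e.open_baseSet).prod (ch ES s₀).open_target

theorem SmoothTriv.isOpen_coorDom (s₀ : S) : IsOpen (e.coorDom z₁ s₀) :=
  (e.pr_smooth.continuousOn.isOpen_inter_preimage e.toTrivialization.open_source
    (ch ES s₀).open_source).inter ((chartAt EZ z₁).open_source.preimage η.contMDiff.continuous)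

theorem SmoothTriv.param_smooth (s₀ : S) : ContMDiffOn 𝓘(ℝ, EZ × Eu (Module.finrank ℝ ES))
    𝓘(ℝ, EF) ∞ (e.param z₁ s₀) (e.paramDom z₁ s₀) := by
  have h1 : ContMDiffOn 𝓘(ℝ, EZ × Eu (Module.finrank ℝ ES)) 𝓘(ℝ, EZ) ∞
      (fun q : EZ × Eu (Module.finrank ℝ ES) => (chartAt EZ z₁).symm q.1) (e.paramDom z₁ s₀) :=
    (contMDiffOn_chart_symm (x := z₁)).comp contDiff_fst.contMDiff.contMDiffOn
      fun q hq => hq.1.1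
  have h2 : ContMDiffOn 𝓘(ℝ, EZ × Eu (Module.finrank ℝ ES)) 𝓘(ℝ, ES) ∞
      (fun q : EZ × Eu (Module.finrank ℝ ES) => (ch ES s₀).symm q.2) (e.paramDom z₁ s₀) :=
    (ch_symm_smooth s₀).comp contDiff_snd.contMDiff.contMDiffOn fun q hq => hq.2
  exact e.inj_smooth_prod.comp (h1.prodMk h2) fun q hq => ⟨hq.1.2, trivial⟩

theorem SmoothTriv.coor_smooth (s₀ : S) : ContMDiffOn 𝓘(ℝ, EF)
    𝓘(ℝ, EZ × Eu (Module.finrank ℝ ES)) ∞ (e.coor z₁ s₀) (e.coorDom z₁ s₀) := by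
  refine ContMDiffOn.prodMk_space ?_ ?_
  · exact (contMDiffOn_chart (x := z₁)).comp η.contMDiff.contMDiffOn fun p hp => hp.2
  · exact (ch_smooth s₀).comp (e.pr_smooth.mono fun p hp => hp.1.1) fun p hp => hp.1.2

theorem SmoothTriv.map_source_baseSet {p : F} (hp : p ∈ e.toTrivialization.source) :
    η p ∈ e.baseSet := by rw [e.source_eq] at hp; exact hp

theorem SmoothTriv.coor_mem {s₀ : S} {p : F} (hp : p ∈ e.coorDom z₁ s₀) :
    e.coor z₁ s₀ p ∈ e.paramDom z₁ s₀ := by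
  refine ⟨⟨(chartAt EZ z₁).map_source hp.2, ?_⟩, (ch ES s₀).map_source hp.1.2⟩
  change (chartAt EZ z₁).symm (chartAt EZ z₁ (η p)) ∈ e.baseSet
  rw [(chartAt EZ z₁).left_inv hp.2]
  exact e.map_source_baseSet hp.1.1

theorem SmoothTriv.param_coor {s₀ : S} {p : F} (hp : p ∈ e.coorDom z₁ s₀) :
    e.param z₁ s₀ (e.coor z₁ s₀ p) = p := by
  change e.inj ((chartAt EZ z₁).symm (chartAt EZ z₁ (η p))) ((ch ES s₀).symm (ch ES s₀ (e.pr p))) = p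
  rw [(chartAt EZ z₁).left_inv hp.2, (ch ES s₀).left_inv hp.1.2]
  exact e.inj_pr (e.map_source_baseSet hp.1.1) rfl

theorem SmoothTriv.map_param {s₀ : S} {q : EZ × Eu (Module.finrank ℝ ES)}
    (hq : q ∈ e.paramDom z₁ s₀) : η (e.param z₁ s₀ q) = (chartAt EZ z₁).symm q.1 :=
  e.map_inj hq.1.2 _

theorem SmoothTriv.coor_param {s₀ : S} {q : EZ × Eu (Module.finrank ℝ ES)}
    (hq : q ∈ e.paramDom z₁ s₀) : e.coor z₁ s₀ (e.param z₁ s₀ q) = q := by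
  refine Prod.ext ?_ ?_
  · change chartAt EZ z₁ (η (e.param z₁ s₀ q)) = _
    rw [e.map_param hq, (chartAt EZ z₁).right_inv hq.1.1]
  · change ch ES s₀ (e.pr (e.inj _ _)) = _
    rw [e.pr_inj hq.1.2, (ch ES s₀).right_inv hq.2]

theorem SmoothTriv.param_mem {s₀ : S} {q : EZ × Eu (Module.finrank ℝ ES)}
    (hq : q ∈ e.paramDom z₁ s₀) : e.param z₁ s₀ q ∈ e.coorDom z₁ s₀ := by
  refine ⟨⟨e.inj_mem_source hq.1.2 _, ?_⟩, ?_⟩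
  · change e.pr (e.inj _ _) ∈ (ch ES s₀).source
    rw [e.pr_inj hq.1.2]
    exact (ch ES s₀).map_target hq.2
  · change η (e.param z₁ s₀ q) ∈ (chartAt EZ z₁).source
    rw [e.map_param hq]
    exact (chartAt EZ z₁).map_target hq.1.1

theorem SmoothTriv.mder_param {s₀ : S} {q : EZ × Eu (Module.finrank ℝ ES)}
    (hq : q ∈ e.paramDom z₁ s₀) (v : Eu (Module.finrank ℝ ES)) :
    mder (EZ × Eu (Module.finrank ℝ ES)) EF (e.param z₁ s₀) q ((0 : EZ), v) =
      mder ES EF (e.inj ((chartAt EZ z₁).symm q.1)) ((ch ES s₀).symm q.2)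
        (mder (Eu (Module.finrank ℝ ES)) ES (ch ES s₀).symm q.2 v) := by
  obtain ⟨w, x⟩ := q
  have hd : HasFDerivAt (fun x : Eu (Module.finrank ℝ ES) => (w, x))
    (ContinuousLinearMap.inr ℝ EZ (Eu (Module.finrank ℝ ES))) x := hasFDerivAt_prodMk_right w x
  have h1 := mder_comp (x := x) (f := fun x : Eu (Module.finrank ℝ ES) => (w, x))
    (ContMDiffOn.mdiffAt (e.param_smooth s₀) (e.isOpen_paramDom s₀) hq)
    hd.differentiableAt.mdifferentiableAt
  have h2 := mder_comp (x := x) (e.inj_mdiffAt hq.1.2 ((ch ES s₀).symm x))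
    (ContMDiffOn.mdiffAt (ch_symm_smooth s₀) (ch ES s₀).open_target hq.2)
  rw [mder_eq_fderiv, hd.fderiv] at h1
  have h3 := congrArg (fun L => L v) (h1.symm.trans h2)
  exact h3

/-- The vertical vector field with constant coefficients `v`. -/
def SmoothTriv.vertField (z₁ : Z) (s₀ : S) (v : Eu (Module.finrank ℝ ES)) (p : F) : EF :=
  mder (EZ × Eu (Module.finrank ℝ ES)) EF (e.param z₁ s₀) (e.coor z₁ s₀ p) ((0 : EZ), v)

theorem SmoothTriv.vertField_smooth (s₀ : S) (v : Eu (Module.finrank ℝ ES)) :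
    ContMDiffOn 𝓘(ℝ, EF) 𝓘(ℝ, EF).tangent ∞
      (fun p => (⟨p, e.vertField z₁ s₀ v p⟩ : TangentBundle 𝓘(ℝ, EF) F)) (e.coorDom z₁ s₀) := by
  have hc : ContMDiff 𝓘(ℝ, EZ × Eu (Module.finrank ℝ ES))
      𝓘(ℝ, EZ × Eu (Module.finrank ℝ ES)).tangent ∞
      (fun q : EZ × Eu (Module.finrank ℝ ES) => (⟨q, ((0 : EZ), v)⟩ :
        TangentBundle 𝓘(ℝ, EZ × Eu (Module.finrank ℝ ES)) (EZ × Eu (Module.finrank ℝ ES)))) :=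
    contMDiff_vectorSpace_iff_contDiff.2 (contDiff_const (c := ((0 : EZ), v)))
  have h := contMDiffOn_mder_apply (e.isOpen_paramDom s₀) (e.param_smooth (z₁ := z₁) s₀)
    (b := e.coor z₁ s₀) (X := fun _ => ((0 : EZ), v))
    (hc.comp_contMDiffOn (e.coor_smooth s₀)) (fun p hp => e.coor_mem hp)
  refine h.congr fun p hp => ?_
  have key : ∀ (q : F) (x : EF), q = p → (⟨p, x⟩ : TangentBundle 𝓘(ℝ, EF) F) = ⟨q, x⟩ := by
    rintro _ _ rfl; rfl
  exact key _ _ (e.param_coor hp)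

theorem SmoothTriv.vertField_mem {s₀ : S} (v : Eu (Module.finrank ℝ ES)) {p : F}
    (hp : p ∈ e.coorDom z₁ s₀) : e.vertField z₁ s₀ v p ∈ Vert η p := by
  unfold SmoothTriv.vertField
  rw [e.mder_param (e.coor_mem hp)]
  have h := e.mder_inj_mem_vert (e.coor_mem hp).1.2 ((ch ES s₀).symm (e.coor z₁ s₀ p).2)
    (mder (Eu (Module.finrank ℝ ES)) ES (ch ES s₀).symm (e.coor z₁ s₀ p).2 v)
  have key : ∀ (q : F) (x : EF), q = p → x ∈ Vert η q → x ∈ Vert η p := by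
    rintro _ _ rfl h; exact h
  exact key _ _ (e.param_coor hp) h

section FamOf

variable [VectorBundle ℝ EV V] [ContMDiffVectorBundle ∞ EV V 𝓘(ℝ, EZ)]
  (t : Trivialization EV (π EV V)) [MemTrivializationAtlas t] (f : EV →L[ℂ] ℂ)

/-- The vectors `y` are left free, subject to having the right components: in `famOf_famSmooth` they
are values of global fields that agree with the coordinate fields only near one point. -/
theorem SmoothTriv.spull_famOf {s₀ : S} {q : EZ × Eu (Module.finrank ℝ ES)}
    (hq : q ∈ e.paramDom z₁ s₀) (ρ : Z → ℝ) (α : RelForm V η k) (l : ∀ z, V z →L[ℂ] ℂ)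
    (v : Fin k → Eu (Module.finrank ℝ ES)) (y : Fin k → Vert η (e.param z₁ s₀ q))
    (hy : ∀ i, ((y i : TangentSpace 𝓘(ℝ, EF) (e.param z₁ s₀ q)) : EF) =
      mder (EZ × Eu (Module.finrank ℝ ES)) EF (e.param z₁ s₀) q ((0 : EZ), v i)) :
    spull (ch ES s₀).symm (e.famOf z₁ ρ (α.restrict l) q.1) q.2 v =
      ((ρ ((chartAt EZ z₁).symm q.1) : ℝ) : ℂ) *
        l (η (e.param z₁ s₀ q)) (α (e.param z₁ s₀ q) y) := by
  rw [spull_apply, e.famOf_of_mem hq.1.1]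
  change ((ρ ((chartAt EZ z₁).symm q.1) : ℝ) : ℂ) * _ = _
  refine congrArg _ ?_
  rw [e.toS_of_mem hq.1.2]
  change α.restrict l ((chartAt EZ z₁).symm q.1) ⟨e.param z₁ s₀ q, e.map_param hq⟩
    (fun i => e.injDeriv hq.1.2 ((ch ES s₀).symm q.2)
      (mder (Eu (Module.finrank ℝ ES)) ES (ch ES s₀).symm q.2 (v i))) =
    α.restrict l ((chartAt EZ z₁).symm q.1) ⟨e.param z₁ s₀ q, e.map_param hq⟩ y
  refine FibForm.apply_congr _ rfl fun i => ?_
  rw [hy i, e.mder_param hq]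
  rfl

theorem SmoothTriv.famOf_famSmooth {α : RelForm V η k} (hα : RelForm.IsSmooth EV α) {ρ : Z → ℝ}
    (hρ : ContMDiff 𝓘(ℝ, EZ) 𝓘(ℝ, ℝ) ∞ ρ) {K : Set Z} (hK : IsCompact K)
    (hKB : K ⊆ e.baseSet ∩ (chartAt EZ z₁).source) (hKt : K ⊆ t.baseSet)
    (h0 : ∀ z ∉ K, ρ z = 0) : FamSmooth (e.famOf z₁ ρ (α.restrict (linAt t f))) := by
  intro w₀ s₀
  by_cases hw : w₀ ∈ chartAt EZ z₁ '' K
  · obtain ⟨z₀, hz₀, rfl⟩ := hw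
    set q₀ : EZ × Eu (Module.finrank ℝ ES) := (chartAt EZ z₁ z₀, ch ES s₀ s₀) with hq₀
    have hsymm : (chartAt EZ z₁).symm (chartAt EZ z₁ z₀) = z₀ :=
      (chartAt EZ z₁).left_inv (hKB hz₀).2
    have hq : q₀ ∈ e.paramDom z₁ s₀ := by
      refine ⟨⟨(chartAt EZ z₁).map_source (hKB hz₀).2, ?_⟩,
        (ch ES s₀).map_source (mem_ch_source ES s₀)⟩
      change (chartAt EZ z₁).symm (chartAt EZ z₁ z₀) ∈ e.baseSet
      rw [hsymm]
      exact (hKB hz₀).1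
    set p₀ := e.param z₁ s₀ q₀ with hp₀
    have hηp : η p₀ = z₀ := (e.map_param hq).trans hsymm
    rw [← contDiffWithinAt_univ, contDiffWithinAt_altMap_iff]
    intro v
    rw [contDiffWithinAt_univ]
    -- The coordinate fields with constant coefficients `v i` are replaced by global vertical fields
    -- equal to them near `p₀`, so that the smoothness of `α` can be applied.
    choose Y hY hYe using fun i => exists_vertical_extension (η := η) (e.isOpen_coorDom s₀)
      (e.vertField_smooth (z₁ := z₁) s₀ (v i)) (fun p hp => e.vertField_mem (v i) hp)
      (e.param_mem hq)
    have h1 := hα Y hY p₀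
    have hmem : (⟨η p₀, α p₀ fun i => Y i p₀⟩ : TotalSpace EV V) ∈ t.source := by
      rw [t.mem_source]
      change η p₀ ∈ t.baseSet
      rw [hηp]
      exact hKt hz₀
    have h2 := (t.contMDiffAt_iff (IB := 𝓘(ℝ, EZ)) (n := ∞)
      (f := fun p => (⟨η p, α p fun i => Y i p⟩ : TotalSpace EV V)) (x₀ := p₀) hmem).1 h1
    have hG : ContMDiffAt 𝓘(ℝ, EZ × Eu (Module.finrank ℝ ES)) 𝓘(ℝ, EF) ∞ (e.param z₁ s₀) q₀ :=
      (e.param_smooth s₀).contMDiffAt ((e.isOpen_paramDom s₀).mem_nhds hq)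
    have h3 : ContMDiffAt 𝓘(ℝ, EZ × Eu (Module.finrank ℝ ES)) 𝓘(ℝ, ℂ) ∞
        (fun q => f (t ⟨η (e.param z₁ s₀ q),
          α (e.param z₁ s₀ q) fun i => Y i (e.param z₁ s₀ q)⟩).2) q₀ :=
      ((f.restrictScalars ℝ).contDiff.contMDiff).contMDiffAt.comp q₀
        (ContMDiffAt.comp (f := e.param z₁ s₀) q₀ h2.2 hG)
    have h4 : ContMDiffAt 𝓘(ℝ, EZ × Eu (Module.finrank ℝ ES)) 𝓘(ℝ, ℝ) ∞
        (fun q => ρ (η (e.param z₁ s₀ q))) q₀ :=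
      ContMDiffAt.comp (f := e.param z₁ s₀) q₀ ((hρ.comp η.contMDiff) p₀) hG
    have h5 : ContDiffAt ℝ ∞ (fun q => ((ρ (η (e.param z₁ s₀ q)) : ℝ) : ℂ) *
        f (t ⟨η (e.param z₁ s₀ q),
          α (e.param z₁ s₀ q) fun i => Y i (e.param z₁ s₀ q)⟩).2) q₀ :=
      (Complex.ofRealCLM.contDiff.contDiffAt.comp q₀ h4.contDiffAt).mul h3.contDiffAt
    refine h5.congr_of_eventuallyEq ?_
    have hYe' := hG.continuousAt.eventually (eventually_all.2 hYe)
    have ht : ∀ᶠ q in 𝓝 q₀, η (e.param z₁ s₀ q) ∈ t.baseSet :=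
      (η.contMDiff.continuous.continuousAt.comp hG.continuousAt).preimage_mem_nhds
        (t.open_baseSet.mem_nhds (by
          change η p₀ ∈ _
          rw [hηp]; exact hKt hz₀))
    filter_upwards [hYe', ht, (e.isOpen_paramDom s₀).mem_nhds hq] with q hq1 hq2 hq3
    rw [e.spull_famOf hq3 ρ α (linAt t f) v (fun i => Y i (e.param z₁ s₀ q)) fun i => ?_,
      linAt_apply t f hq2]
    · refine congrArg (fun r : ℝ => (r : ℂ) * _) ?_
      rw [e.map_param hq3]
    rw [hq1 i, SmoothTriv.vertField, e.coor_param hq3]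
  · have hcl : IsClosed (chartAt EZ z₁ '' K) := (hK.image_of_continuousOn
      ((chartAt EZ z₁).continuousOn.mono fun z hz => (hKB hz).2)).isClosed
    refine (contDiffAt_const (c := 0)).congr_of_eventuallyEq ?_
    filter_upwards [(continuous_fst.tendsto (w₀, ch ES s₀ s₀)).eventually
      (hcl.isOpen_compl.mem_nhds hw)] with q hq
    ext v
    rw [spull_apply, e.famOf_eq_zero h0 hq]
    rfl

theorem SmoothTriv.famOf_mem_famOm {α : RelForm V η k} (hα : α ∈ RelOmegaC EV V η k) {ρ : Z → ℝ}
    (hρ : ContMDiff 𝓘(ℝ, EZ) 𝓘(ℝ, ℝ) ∞ ρ) {K : Set Z} (hK : IsCompact K)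
    (hKB : K ⊆ e.baseSet ∩ (chartAt EZ z₁).source) (hKt : K ⊆ t.baseSet)
    (h0 : ∀ z ∉ K, ρ z = 0) : e.famOf z₁ ρ (α.restrict (linAt t f)) ∈ famOm EZ k univ := by
  obtain ⟨L, hL, hL0⟩ := hα.2
  refine ⟨e.famOf_famSmooth t f hα.1 hρ hK hKB hKt h0, e.pr '' (L ∩ η ⁻¹' K), ?_, subset_univ _, ?_⟩
  · refine (hL.inter_right (hK.isClosed.preimage η.contMDiff.continuous)).image_of_continuousOn
      (e.pr_smooth.continuousOn.mono fun p hp => e.mem_source (hKB hp.2).1 rfl)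
  · intro w s hs
    by_cases hw : w ∈ chartAt EZ z₁ '' K
    · obtain ⟨z, hz, rfl⟩ := hw
      rw [e.famOf_chart (hKB hz).2]
      have hp : e.inj z s ∉ L := fun h => hs ⟨_, ⟨h, by
        rw [mem_preimage, e.map_inj (hKB hz).1]; exact hz⟩, e.pr_inj (hKB hz).1 s⟩
      change ((ρ z : ℝ) : ℂ) • e.toS z (α.restrict (linAt t f) z) s = 0
      rw [e.toS_of_mem (hKB hz).1]
      ext v
      change ((ρ z : ℝ) : ℂ) * linAt t f (η (e.inj z s)) (α (e.inj z s) fun i =>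
        e.injDeriv (hKB hz).1 s (v i)) = (0 : ℂ)
      rw [hL0 _ hp]
      change ((ρ z : ℝ) : ℂ) * linAt t f (η (e.inj z s)) 0 = (0 : ℂ)
      rw [map_zero, mul_zero]
    · rw [e.famOf_eq_zero h0 hw]; rfl

theorem SmoothTriv.sD_famOf {α : RelForm V η k} (hα : α.HasRelDeriv 0)
    {ρ : Z → ℝ} {K : Set Z} (hKB : K ⊆ e.baseSet ∩ (chartAt EZ z₁).source)
    (h0 : ∀ z ∉ K, ρ z = 0) {l : ∀ z, V z →L[ℂ] ℂ}
    (hs : ∀ z ∈ K, (α.restrict l z).IsSmooth) (w : EZ) :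
    sD (e.famOf z₁ ρ (α.restrict l) w) = 0 := by
  by_cases hw : w ∈ chartAt EZ z₁ '' K
  · obtain ⟨z, hz, rfl⟩ := hw
    rw [e.famOf_chart (hKB hz).2, sD_smul (e.toS_smoothForm (hKB hz).1 (hs z hz)),
      e.sD_toS (hKB hz).1 (hα l z)]
    have : RelForm.restrict (0 : RelForm V η (k + 1)) l z = 0 := by
      funext p; ext v; simp [RelForm.restrict]
    rw [this, map_zero]
    exact smul_zero (M := ℂ) (A := SForm ES S (k + 1)) _
  · rw [e.famOf_eq_zero h0 hw, sD_zero]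

end FamOf

end Bridge

/-! ### Cutoff functions and finite partitions of unity on the base -/

section Cutoffs

variable {EZ Z : Type*} [NormedAddCommGroup EZ] [NormedSpace ℝ EZ] [FiniteDimensional ℝ EZ]
  [TopologicalSpace Z] [T2Space Z] [SigmaCompactSpace Z] [ChartedSpace EZ Z]
  [IsManifold 𝓘(ℝ, EZ) ∞ Z]

variable (EZ) in
theorem exists_cutoff_one {B K : Set Z} (hB : IsOpen B) (hK : IsCompact K) (hKB : K ⊆ B) :
    ∃ ρ : Z → ℝ, ContMDiff 𝓘(ℝ, EZ) 𝓘(ℝ, ℝ) ∞ ρ ∧ ∃ L : Set Z, IsCompact L ∧ L ⊆ B ∧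
      (∀ z ∉ L, ρ z = 0) ∧ ∀ z ∈ K, ρ z = 1 := by
  obtain ⟨ρ, hρ, L, L', hL, hLB, -, hL', h0, h1⟩ := exists_cutoff (ES := EZ) hB isOpen_empty hK
    (by simpa using hKB)
  exact ⟨ρ, hρ, L, hL, hLB, h0, fun z hz => h1 z hz fun h => hL' h⟩

variable (EZ) in
theorem exists_cutoff_nhds {B : Set Z} (hB : IsOpen B) {z : Z} (hz : z ∈ B) :
    ∃ ρ : Z → ℝ, ContMDiff 𝓘(ℝ, EZ) 𝓘(ℝ, ℝ) ∞ ρ ∧ ∃ L : Set Z, IsCompact L ∧ L ⊆ B ∧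
      (∀ z ∉ L, ρ z = 0) ∧ ∀ᶠ z' in 𝓝 z, z' ∈ L ∧ ρ z' = 1 := by
  have : LocallyCompactSpace Z := ChartedSpace.locallyCompactSpace EZ Z
  obtain ⟨K, hK, hzK, hKB⟩ := exists_compact_subset hB hz
  obtain ⟨ρ, hρ, L, hL, hLB, h0, h1⟩ := exists_cutoff_one EZ hB hK hKB
  refine ⟨ρ, hρ, L, hL, hLB, h0, ?_⟩
  filter_upwards [mem_interior_iff_mem_nhds.1 hzK] with z' hz'
  refine ⟨?_, h1 z' hz'⟩
  by_contra h
  have := h0 z' h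
  rw [h1 z' hz'] at this
  exact one_ne_zero this

variable (EZ) in
theorem exists_finite_partition {K : Set Z} (hK : IsCompact K) {B : Z → Set Z}
    (hB : ∀ z, IsOpen (B z)) (hz : ∀ z, z ∈ B z) :
    ∃ (t : Finset Z) (ρ : t → Z → ℝ), (∀ i : t, ContMDiff 𝓘(ℝ, EZ) 𝓘(ℝ, ℝ) ∞ (ρ i)) ∧
      (∀ i : t, ∃ L : Set Z, IsCompact L ∧ L ⊆ B i ∧ ∀ z ∉ L, ρ i z = 0) ∧
      ∀ z ∈ K, ∑ i, ρ i z = 1 := by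
  have : LocallyCompactSpace Z := ChartedSpace.locallyCompactSpace EZ Z
  choose C hC hzC hCB using fun z => exists_compact_subset (hB z) (hz z)
  obtain ⟨t, ht⟩ := hK.elim_finite_subcover (fun z => interior (C z)) (fun z => isOpen_interior)
    fun z _ => mem_iUnion.2 ⟨z, hzC z⟩
  obtain ⟨f, hf⟩ := SmoothPartitionOfUnity.exists_isSubordinate 𝓘(ℝ, EZ) hK.isClosed
    (fun i : t => interior (C i)) (fun i => isOpen_interior) (fun z hz => by
      obtain ⟨i, hi, hzi⟩ := mem_iUnion₂.1 (ht hz)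
      exact mem_iUnion.2 ⟨⟨i, hi⟩, hzi⟩)
  refine ⟨t, fun i => f i, fun i => (f i).contMDiff, fun i : t => ⟨C i, hC i, hCB i, fun z hz => ?_⟩,
    fun z hz => ?_⟩
  · exact image_eq_zero_of_notMem_tsupport fun h => hz (interior_subset (hf i h))
  · rw [← finsum_eq_sum_of_fintype]
    exact f.sum_eq_one hz

end Cutoffs

/-! ### Restriction of relative forms to fibres -/

section Classes

variable {EF EZ ES : Type*} [NormedAddCommGroup EF] [NormedSpace ℝ EF] [FiniteDimensional ℝ EF]
  [NormedAddCommGroup EZ] [NormedSpace ℝ EZ] [FiniteDimensional ℝ EZ]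
  [NormedAddCommGroup ES] [NormedSpace ℝ ES] [FiniteDimensional ℝ ES]
  {F Z S : Type*} [TopologicalSpace F] [T2Space F] [ChartedSpace EF F] [IsManifold 𝓘(ℝ, EF) ∞ F]
  [TopologicalSpace Z] [T2Space Z] [SigmaCompactSpace Z] [ChartedSpace EZ Z]
  [IsManifold 𝓘(ℝ, EZ) ∞ Z]
  [TopologicalSpace S] [ChartedSpace ES S] [IsManifold 𝓘(ℝ, ES) ∞ S]
  {η : C^∞⟮𝓘(ℝ, EF), F; 𝓘(ℝ, EZ), Z⟯} {k : ℕ}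
  {EV : Type*} [NormedAddCommGroup EV] [NormedSpace ℂ EV]
  {V : Z → Type*} [∀ z, AddCommGroup (V z)] [∀ z, Module ℂ (V z)]
  [∀ z, TopologicalSpace (V z)] [∀ z, IsTopologicalAddGroup (V z)]
  [∀ z, ContinuousSMul ℂ (V z)] [TopologicalSpace (TotalSpace EV V)]
  [FiberBundle EV V] [VectorBundle ℂ EV V] [VectorBundle ℝ EV V]
  [ContMDiffVectorBundle ∞ EV V 𝓘(ℝ, EZ)]

theorem RelForm.restrict_congr (α : RelForm V η k) {l l' : ∀ z, V z →L[ℂ] ℂ} {z : Z}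
    (h : l z = l' z) : α.restrict l z = α.restrict l' z := by
  funext p
  obtain ⟨p, rfl⟩ := p
  ext v
  exact congrArg (fun L : V (η p) →L[ℂ] ℂ => L (α p v)) h

theorem RelForm.restrict_zero (l : ∀ z, V z →L[ℂ] ℂ) (z : Z) :
    RelForm.restrict (0 : RelForm V η k) l z = 0 := by
  funext p; ext v; simp [RelForm.restrict]

/-- The part of `e.baseSet` on which both the chart of `Z` and the trivialization of `V` at `z₁`
are defined. -/
def SmoothTriv.nice (e : SmoothTriv ES S η) (t : Trivialization EV (π EV V)) (z₁ : Z) : Set Z :=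
  (e.baseSet ∩ (chartAt EZ z₁).source) ∩ t.baseSet

theorem SmoothTriv.isOpen_nice (e : SmoothTriv ES S η) (t : Trivialization EV (π EV V)) (z₁ : Z) :
    IsOpen (e.nice t z₁) :=
  (e.open_baseSet.inter (chartAt EZ z₁).open_source).inter t.open_baseSet

/-- Every functional on a single fibre `V z` arises in this way, so results on the smooth families
`linAt t f` cover arbitrary functionals. -/
theorem linAt_symmL (t : Trivialization EV (π EV V)) [MemTrivializationAtlas t] {z : Z}
    (hz : z ∈ t.baseSet) (f : V z →L[ℂ] ℂ) : linAt t (f.comp (t.symmL ℂ z)) z = f := by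
  ext v
  change f (t.symmL ℂ z (t.continuousLinearMapAt ℂ z v)) = f v
  rw [t.symmL_continuousLinearMapAt hz]

/-- With a cutoff equal to `1` at `z`, the restriction corresponds to one member of the smooth
family `famOf`. This links smoothness tested on vector fields of `F` to smoothness tested on plots
of the fibre. -/
theorem restrict_mem_omegaC (hη : IsSmoothFibreBundle ES S η) {α : RelForm V η k}
    (hα : α ∈ RelOmegaC EV V η k) (l : ∀ z, V z →L[ℂ] ℂ) (z : Z) :
    α.restrict l z ∈ FibOmegaC η z k ℂ := by
  obtain ⟨e, hz⟩ := hη z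
  set t := trivializationAt EV V z
  have hzt : z ∈ t.baseSet := mem_baseSet_trivializationAt EV V z
  obtain ⟨ρ, hρ, L, hL, hLB, h0, h1⟩ := exists_cutoff_nhds EZ (e.isOpen_nice t z)
    (z := z) ⟨⟨hz, mem_chart_source EZ z⟩, hzt⟩
  have h := slice_mem_famOm (P' := ℝ) (e.famOf_mem_famOm t ((l z).comp (t.symmL ℂ z)) hα hρ hL
    (hLB.trans inter_subset_left) (hLB.trans inter_subset_right) h0) (chartAt EZ z z)
  rw [e.famOf_chart (mem_chart_source EZ z), h1.self_of_nhds.2,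
    α.restrict_congr (linAt_symmL t hzt (l z))] at h
  have h2 : ((1 : ℝ) : ℂ) • e.toS z (α.restrict l z) = e.toS z (α.restrict l z) := by
    rw [Complex.ofReal_one]; exact one_smul ℂ _
  rw [h2] at h
  have h3 := e.fib_mem_omegaC hz h
  rwa [e.fib_toS hz] at h3

theorem restrict_mem_cocycles (hη : IsSmoothFibreBundle ES S η) {α : RelForm V η k}
    (hα : α ∈ RelCocycles EV V η k) (l : ∀ z, V z →L[ℂ] ℂ) (z : Z) :
    α.restrict l z ∈ FibCocycles η z k ℂ := by
  refine ⟨restrict_mem_omegaC hη hα.1 l z, ?_⟩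
  have := hα.2 l z
  rwa [RelForm.restrict_zero] at this

theorem restrict_mem_coboundaries (hη : IsSmoothFibreBundle ES S η) : ∀ {k : ℕ} {α : RelForm V η k},
    α ∈ RelCoboundaries EV V η k → ∀ (l : ∀ z, V z →L[ℂ] ℂ) (z : Z),
    α.restrict l z ∈ FibCoboundaries η z ℂ k
  | 0, α, h, l, z => by
    have h : α = 0 := h
    rw [h, RelForm.restrict_zero]
    exact zero_mem _
  | _ + 1, _, ⟨_, h1, h2⟩, l, z => ⟨_, restrict_mem_omegaC hη h1 l z, h2 l z⟩

/-- The class of the restriction of a closed relative form to the fibre over `z`. -/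
def restrictClass (hη : IsSmoothFibreBundle ES S η) (l : ∀ z, V z →L[ℂ] ℂ) (z : Z) :
    RelCocycles EV V η k →ₗ[ℂ] FibHc η z k ℂ :=
  Submodule.mkQ _ ∘ₗ
    { toFun := fun α => (⟨α.1.restrict l z, restrict_mem_cocycles hη α.2 l z⟩ : FibCocycles η z k ℂ)
      map_add' := fun α β => Subtype.ext (RelForm.restrict_add α.1 β.1 l z)
      map_smul' := fun c α => Subtype.ext (RelForm.restrict_smul c α.1 l z) }

theorem restrictClass_apply (hη : IsSmoothFibreBundle ES S η) (l : ∀ z, V z →L[ℂ] ℂ) (z : Z)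
    (α : RelCocycles EV V η k) : restrictClass hη l z α =
      fibClass (α.1.restrict l z) (restrict_mem_cocycles hη α.2 l z) := rfl

theorem restrictClass_eq_zero_iff (hη : IsSmoothFibreBundle ES S η) (l : ∀ z, V z →L[ℂ] ℂ) (z : Z)
    (α : RelCocycles EV V η k) : restrictClass hη l z α = 0 ↔
      α.1.restrict l z ∈ FibCoboundaries η z ℂ k := by
  rw [restrictClass_apply, fibClass_eq_zero_iff]

theorem restrictClass_sum (hη : IsSmoothFibreBundle ES S η) {ι : Type*} [Fintype ι]
    {l : ∀ z, V z →L[ℂ] ℂ} {l' : ι → ∀ z, V z →L[ℂ] ℂ} {c : ι → ℂ} {z : Z}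
    (h : ∀ v, l z v = ∑ i, c i * l' i z v) (α : RelCocycles EV V η k) :
    restrictClass hη l z α = ∑ i, c i • restrictClass hη (l' i) z α := by
  have h1 : ∀ i, c i • restrictClass hη (l' i) z α =
      Submodule.mkQ _ (c i • (⟨α.1.restrict (l' i) z, restrict_mem_cocycles hη α.2 (l' i) z⟩ :
        FibCocycles η z k ℂ)) := fun i => rfl
  rw [Finset.sum_congr rfl fun i _ => h1 i, ← map_sum]
  refine congrArg (Submodule.mkQ _) (Subtype.ext ?_)
  rw [Submodule.coe_sum]
  funext p
  have h2 : (∑ i, ((c i • (⟨α.1.restrict (l' i) z, restrict_mem_cocycles hη α.2 (l' i) z⟩ :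
        FibCocycles η z k ℂ) : FibCocycles η z k ℂ) : FibForm η z k ℂ)) p =
      ∑ i, c i • α.1.restrict (l' i) z p :=
    Finset.sum_apply (M := fun p : Fib η z => Vert η p.1 [⋀^Fin k]→L[ℝ] ℂ) p _ _
  refine Eq.trans ?_ h2.symm
  obtain ⟨p, rfl⟩ := p
  ext v
  rw [ContinuousAlternatingMap.sum_apply]
  exact h (α.1 p v)

end Classes

variable {EF EZ ES : Type*} [NormedAddCommGroup EF] [NormedSpace ℝ EF] [FiniteDimensional ℝ EF]
  [NormedAddCommGroup EZ] [NormedSpace ℝ EZ] [FiniteDimensional ℝ EZ]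
  [NormedAddCommGroup ES] [NormedSpace ℝ ES] [FiniteDimensional ℝ ES]
  {F Z S : Type*} [TopologicalSpace F] [T2Space F] [ChartedSpace EF F] [IsManifold 𝓘(ℝ, EF) ∞ F]
  [TopologicalSpace Z] [T2Space Z] [SigmaCompactSpace Z] [ChartedSpace EZ Z]
  [IsManifold 𝓘(ℝ, EZ) ∞ Z]
  [TopologicalSpace S] [ChartedSpace ES S] [IsManifold 𝓘(ℝ, ES) ∞ S]
  {η : C^∞⟮𝓘(ℝ, EF), F; 𝓘(ℝ, EZ), Z⟯} {k : ℕ}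
  {EV : Type*} [NormedAddCommGroup EV] [NormedSpace ℂ EV]
  {V : Z → Type*} [∀ z, AddCommGroup (V z)] [∀ z, Module ℂ (V z)]
  [∀ z, TopologicalSpace (V z)] [∀ z, IsTopologicalAddGroup (V z)]
  [∀ z, ContinuousSMul ℂ (V z)] [TopologicalSpace (TotalSpace EV V)]
  [FiberBundle EV V] [VectorBundle ℂ EV V] [VectorBundle ℝ EV V]
  [ContMDiffVectorBundle ∞ EV V 𝓘(ℝ, EZ)]

/-! ### Local frames of `V` and the section of cohomology classes -/

section Frames

variable [FiniteDimensional ℂ EV] (t : Trivialization EV (π EV V)) [MemTrivializationAtlas t]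

variable (EV) in
/-- The coordinate functionals of a fixed basis of the model fibre. -/
def modelCoord (a : Fin (Module.finrank ℂ EV)) : EV →L[ℂ] ℂ :=
  LinearMap.toContinuousLinearMap ((Module.finBasis ℂ EV).coord a)

/-- The local frame of `V` given by a trivialization and a fixed basis of the model fibre. -/
def frame (a : Fin (Module.finrank ℂ EV)) (z : Z) : V z := t.symmL ℂ z (Module.finBasis ℂ EV a)

theorem eq_sum_frame {z : Z} (hz : z ∈ t.baseSet) (v : V z) :
    v = ∑ a, linAt t (modelCoord EV a) z v • frame t a z := by
  have h := (Module.finBasis ℂ EV).sum_repr (t.continuousLinearMapAt ℂ z v)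
  have h2 := congrArg (t.symmL ℂ z) h
  rw [t.symmL_continuousLinearMapAt hz, map_sum] at h2
  refine h2.symm.trans (Finset.sum_congr rfl fun a _ => ?_)
  rw [map_smul]
  rfl

theorem triv_sum_frame {z : Z} (hz : z ∈ t.baseSet) (c : Fin (Module.finrank ℂ EV) → ℂ) :
    (t ⟨z, ∑ a, c a • frame t a z⟩).2 = ∑ a, c a • Module.finBasis ℂ EV a := by
  have h : t.continuousLinearMapAt ℂ z (∑ a, c a • frame t a z) =
      (t ⟨z, ∑ a, c a • frame t a z⟩).2 := by
    rw [Trivialization.continuousLinearMapAt_apply, t.coe_linearMapAt_of_mem hz]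
  rw [← h, map_sum]
  refine Finset.sum_congr rfl fun a _ => ?_
  rw [map_smul, frame, t.continuousLinearMapAt_symmL hz]

theorem contMDiffOn_frame (a : Fin (Module.finrank ℂ EV)) :
    ContMDiffOn 𝓘(ℝ, EZ) (𝓘(ℝ, EZ).prod 𝓘(ℝ, EV)) ∞
      (fun z => (⟨z, frame t a z⟩ : TotalSpace EV V)) t.baseSet := by
  intro z hz
  refine ContMDiffAt.contMDiffWithinAt ?_
  rw [t.contMDiffAt_iff (IB := 𝓘(ℝ, EZ)) (n := ∞) (by rw [t.mem_source]; exact hz)]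
  refine ⟨contMDiffAt_id, ?_⟩
  refine (contMDiffAt_const (c := Module.finBasis ℂ EV a)).congr_of_eventuallyEq ?_
  filter_upwards [t.open_baseSet.mem_nhds hz] with z' hz'
  have h : t.continuousLinearMapAt ℂ z' (frame t a z') = (t ⟨z', frame t a z'⟩).2 := by
    rw [Trivialization.continuousLinearMapAt_apply, t.coe_linearMapAt_of_mem hz']
  rw [← h, frame, t.continuousLinearMapAt_symmL hz']

theorem tsupport_subset_of_isCompact {ρ : Z → ℝ} {L : Set Z} (hL : IsCompact L)
    (h0 : ∀ z ∉ L, ρ z = 0) : tsupport ρ ⊆ L :=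
  closure_minimal (fun z hz => by_contra fun h => hz (h0 z h)) hL.isClosed

/-- A local smooth section times a cutoff function is a smooth section. -/
theorem contMDiff_cutoff_section {B : Set Z} (hB : IsOpen B) {u : ∀ z, V z}
    (hu : ContMDiffOn 𝓘(ℝ, EZ) (𝓘(ℝ, EZ).prod 𝓘(ℝ, EV)) ∞
      (fun z => (⟨z, u z⟩ : TotalSpace EV V)) B) {ρ : Z → ℝ}
    (hρ : ContMDiff 𝓘(ℝ, EZ) 𝓘(ℝ, ℝ) ∞ ρ) {L : Set Z} (hL : IsCompact L) (hLB : L ⊆ B)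
    (h0 : ∀ z ∉ L, ρ z = 0) : ContMDiff 𝓘(ℝ, EZ) (𝓘(ℝ, EZ).prod 𝓘(ℝ, EV)) ∞
      (fun z => (⟨z, ((ρ z : ℝ) : ℂ) • u z⟩ : TotalSpace EV V)) := by
  have h := ContMDiffOn.smul_section_of_tsupport (I := 𝓘(ℝ, EZ)) (V := V) (s := u)
    (hρ.contMDiffOn (s := B)) hB ((tsupport_subset_of_isCompact hL h0).trans hLB) hu
  exact h

theorem contractV_tmul (z : Z) (l : V z →L[ℂ] ℂ) (h : FibHc η z k ℂ) (v : V z) :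
    contractV z l (h ⊗ₜ[ℂ] v) = l v • h := by
  simp [contractV]

theorem chartCoord_tmul (e : SmoothTriv ES S η) {z₀ : Z} (l : FibHc η z₀ k ℂ →ₗ[ℂ] ℂ) (z : Z)
    (h : FibHc η z k ℂ) (v : V z) :
    chartCoord e l z (h ⊗ₜ[ℂ] v) = l (e.transport k ℂ z₀ z h) • v := by
  simp [chartCoord]

theorem tensor_eq_sum_frame {z : Z} (hz : z ∈ t.baseSet) (u : FibHc η z k ℂ ⊗[ℂ] V z) :
    u = ∑ a, contractV z (linAt t (modelCoord EV a) z) u ⊗ₜ[ℂ] frame t a z := by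
  induction u using TensorProduct.induction_on with
  | zero => simp
  | tmul h v =>
    simp only [contractV_tmul, TensorProduct.smul_tmul]
    rw [← TensorProduct.tmul_sum, ← eq_sum_frame t hz v]
  | add u v hu hv =>
    simp only [map_add, TensorProduct.add_tmul, Finset.sum_add_distrib]
    rw [← hu, ← hv]

include EV in
-- Contraction with the coordinate functionals of a frame recovers the coefficients of a tensor in
-- that frame.
theorem tensor_ext {z : Z} {u v : FibHc η z k ℂ ⊗[ℂ] V z}
    (h : ∀ l : ∀ z, V z →L[ℂ] ℂ, contractV z (l z) u = contractV z (l z) v) : u = v := by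
  have hz := mem_baseSet_trivializationAt EV V z
  rw [tensor_eq_sum_frame _ hz u, tensor_eq_sum_frame _ hz v]
  exact Finset.sum_congr rfl fun a _ => by rw [h (linAt (trivializationAt EV V z) (modelCoord EV a))]

/-- Fibrewise restriction of closed relative forms, as a section of `H^k_c ⊗ V`. -/
def restrictSection (hη : IsSmoothFibreBundle ES S η) :
    RelCocycles EV V η k →ₗ[ℂ] ∀ z, FibHc η z k ℂ ⊗[ℂ] V z :=
  LinearMap.pi fun z => ∑ a,
    (TensorProduct.mk ℂ (FibHc η z k ℂ) (V z)).flip (frame (trivializationAt EV V z) a z) ∘ₗ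
      restrictClass hη (linAt (trivializationAt EV V z) (modelCoord EV a)) z

/-- Together with `tensor_ext` this characterizes `restrictSection` without reference to the frame
used to define it. -/
theorem contractV_restrictSection (hη : IsSmoothFibreBundle ES S η) (α : RelCocycles EV V η k)
    (l : ∀ z, V z →L[ℂ] ℂ) (z : Z) :
    contractV z (l z) (restrictSection hη α z) = restrictClass hη l z α := by
  have h1 : restrictSection hη α z = ∑ a,
      restrictClass hη (linAt (trivializationAt EV V z) (modelCoord EV a)) z α ⊗ₜ[ℂ]
        frame (trivializationAt EV V z) a z := by
    simp [restrictSection]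
  rw [h1, map_sum]
  simp only [contractV_tmul]
  refine (restrictClass_sum hη (fun v => ?_) α).symm
  conv_lhs => rw [eq_sum_frame _ (mem_baseSet_trivializationAt EV V z) v]
  rw [map_sum]
  refine Finset.sum_congr rfl fun a _ => ?_
  rw [map_smul, smul_eq_mul, mul_comm]

theorem restrictSection_eq_sum (hη : IsSmoothFibreBundle ES S η) (α : RelCocycles EV V η k) {z : Z}
    (hz : z ∈ t.baseSet) : restrictSection hη α z = ∑ a,
      restrictClass hη (linAt t (modelCoord EV a)) z α ⊗ₜ[ℂ] frame t a z := by
  conv_lhs => rw [tensor_eq_sum_frame t hz (restrictSection hη α z)]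
  exact Finset.sum_congr rfl fun a _ => by
    rw [contractV_restrictSection hη α (linAt t (modelCoord EV a)) z]

theorem restrictSection_eq_zero_iff (hη : IsSmoothFibreBundle ES S η) (α : RelCocycles EV V η k) :
    restrictSection hη α = 0 ↔
      ∀ (l : ∀ z, V z →L[ℂ] ℂ) (z : Z), α.1.restrict l z ∈ FibCoboundaries η z ℂ k := by
  constructor
  · intro h l z
    rw [← restrictClass_eq_zero_iff hη, ← contractV_restrictSection, h]
    exact map_zero _
  · intro h
    funext z
    refine tensor_ext (EV := EV) fun l => ?_
    rw [contractV_restrictSection hη α l z, (restrictClass_eq_zero_iff hη _ z α).2 (h _ z)]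
    exact (map_zero _).symm

end Frames

variable {EF EZ ES : Type*} [NormedAddCommGroup EF] [NormedSpace ℝ EF] [FiniteDimensional ℝ EF]
  [NormedAddCommGroup EZ] [NormedSpace ℝ EZ] [FiniteDimensional ℝ EZ]
  [NormedAddCommGroup ES] [NormedSpace ℝ ES] [FiniteDimensional ℝ ES]
  {F Z S : Type*} [TopologicalSpace F] [T2Space F] [ChartedSpace EF F] [IsManifold 𝓘(ℝ, EF) ∞ F]
  [TopologicalSpace Z] [T2Space Z] [SigmaCompactSpace Z] [ChartedSpace EZ Z]
  [IsManifold 𝓘(ℝ, EZ) ∞ Z]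
  [TopologicalSpace S] [T2Space S] [SigmaCompactSpace S] [ChartedSpace ES S]
  [IsManifold 𝓘(ℝ, ES) ∞ S]
  {η : C^∞⟮𝓘(ℝ, EF), F; 𝓘(ℝ, EZ), Z⟯} {k : ℕ}
  {EV : Type*} [NormedAddCommGroup EV] [NormedSpace ℂ EV]
  {V : Z → Type*} [∀ z, AddCommGroup (V z)] [∀ z, Module ℂ (V z)]
  [∀ z, TopologicalSpace (V z)] [∀ z, IsTopologicalAddGroup (V z)]
  [∀ z, ContinuousSMul ℂ (V z)] [TopologicalSpace (TotalSpace EV V)]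
  [FiberBundle EV V] [VectorBundle ℂ EV V] [VectorBundle ℝ EV V]
  [ContMDiffVectorBundle ∞ EV V 𝓘(ℝ, EZ)]

/-! ### Smooth dependence of classes for families of finite rank -/

section Classes

variable {P : Type*} [NormedAddCommGroup P] [NormedSpace ℝ P]

theorem famFin_closed {U : Set S} {r : P → SForm ES S k} (hr : r ∈ famFin ES P k U) (w : P) :
    r w ∈ closedForms ES k U := by
  refine ⟨slice_mem_famOm (famFin_le_famOm U hr) w, ?_⟩
  unfold famFin at hr
  induction hr using Submodule.span_induction with
  | mem x h =>
    obtain ⟨f, -, c, hc, rfl⟩ := h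
    rw [sD_smul (hc.1.1.slice 0), hc.2]
    exact smul_zero (M := ℂ) (A := SForm ES S (k + 1)) _
  | zero => exact sD_zero
  | add x y hx hy h1 h2 =>
    have := sD_add ((famFin_le_famOm U hx).1.slice w) ((famFin_le_famOm U hy).1.slice w)
    rw [h1, h2, add_zero] at this
    exact this
  | smul c x hx h1 =>
    have := sD_smul ((famFin_le_famOm U hx).1.slice w) c
    rw [h1] at this
    exact this.trans (smul_zero (M := ℂ) (A := SForm ES S (k + 1)) _)

theorem fibClass_smul {z : Z} {a : FibForm η z k ℂ} (c : ℂ) (ha : a ∈ FibCocycles η z k ℂ) :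
    fibClass (c • a) (Submodule.smul_mem _ c ha) = c • fibClass a ha := rfl

theorem fibClass_eq_iff {z : Z} {a b : FibForm η z k ℂ} {ha : a ∈ FibCocycles η z k ℂ}
    {hb : b ∈ FibCocycles η z k ℂ} :
    fibClass a ha = fibClass b hb ↔ a - b ∈ FibCoboundaries η z ℂ k := by
  unfold fibClass
  rw [Submodule.Quotient.eq]
  rfl

/-- For `r = Σ fᵢ cᵢ` the function is `Σ fᵢ l[cᵢ]`. Smooth dependence of cohomology classes on the
base point comes from here. -/
theorem SmoothTriv.contDiff_class (e : SmoothTriv ES S η) {z₀ : Z} (hz₀ : z₀ ∈ e.baseSet)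
    (l : FibHc η z₀ k ℂ →ₗ[ℂ] ℂ) {r : P → SForm ES S k} (hr : r ∈ famFin ES P k univ) :
    ContDiff ℝ ∞ fun w => l (fibClass (e.fib z₀ (r w))
      (e.fib_mem_cocycles hz₀ (famFin_closed hr w))) := by
  unfold famFin at hr
  induction hr using Submodule.span_induction with
  | mem x h =>
    obtain ⟨f, hf, c, hc, rfl⟩ := h
    have : ∀ w, l (fibClass (e.fib z₀ (f w • c)) (e.fib_mem_cocycles hz₀
        (famFin_closed (Submodule.subset_span ⟨f, hf, c, hc, rfl⟩) w))) =
        f w * l (fibClass (e.fib z₀ c) (e.fib_mem_cocycles hz₀ hc)) := fun w => by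
      rw [← smul_eq_mul, ← map_smul, ← fibClass_smul]
      rfl
    simp only [this]
    exact hf.mul contDiff_const
  | zero =>
    have : ∀ w : P, l (fibClass (e.fib z₀ ((0 : P → SForm ES S k) w)) (e.fib_mem_cocycles hz₀
        (famFin_closed (Submodule.zero_mem _) w))) = 0 := fun w => by
      rw [fibClass_eq_zero_iff.2, map_zero]
      exact (map_zero (e.fib z₀ (k := k))) ▸ zero_mem _
    simp only [this]
    exact contDiff_const
  | add x y hx hy h1 h2 =>
    have : (fun w => l (fibClass (e.fib z₀ ((x + y) w))
        (e.fib_mem_cocycles hz₀ (famFin_closed (Submodule.add_mem _ hx hy) w)))) =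
        fun w => l (fibClass (e.fib z₀ (x w)) (e.fib_mem_cocycles hz₀ (famFin_closed hx w))) +
          l (fibClass (e.fib z₀ (y w)) (e.fib_mem_cocycles hz₀ (famFin_closed hy w))) :=
      funext fun w => map_add l
        (fibClass (e.fib z₀ (x w)) (e.fib_mem_cocycles hz₀ (famFin_closed hx w)))
        (fibClass (e.fib z₀ (y w)) (e.fib_mem_cocycles hz₀ (famFin_closed hy w)))
    rw [this]
    exact h1.add h2
  | smul c x hx h1 =>
    have : (fun w => l (fibClass (e.fib z₀ ((c • x) w))
        (e.fib_mem_cocycles hz₀ (famFin_closed (Submodule.smul_mem _ c hx) w)))) =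
        fun w => c * l (fibClass (e.fib z₀ (x w)) (e.fib_mem_cocycles hz₀ (famFin_closed hx w))) :=
      funext fun w => map_smul l c
        (fibClass (e.fib z₀ (x w)) (e.fib_mem_cocycles hz₀ (famFin_closed hx w)))
    rw [this]
    exact contDiff_const.mul h1

end Classes

/-! ### The Künneth theorem applied to localized relative forms -/

section Local

variable (e : SmoothTriv ES S η) (t : Trivialization EV (π EV V)) [MemTrivializationAtlas t]
  (f : EV →L[ℂ] ℂ)

theorem SmoothTriv.exists_decomp (hη : IsSmoothFibreBundle ES S η) {z₁ : Z} {α : RelForm V η k}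
    (hα : α ∈ RelCocycles EV V η k) {ρ : Z → ℝ}
    (hρ : ContMDiff 𝓘(ℝ, EZ) 𝓘(ℝ, ℝ) ∞ ρ) {L : Set Z} (hL : IsCompact L)
    (hLB : L ⊆ e.nice t z₁) (h0 : ∀ z ∉ L, ρ z = 0) :
    ∃ r ∈ famFin ES EZ k (univ : Set S), ∃ β ∈ famBd EZ (univ : Set S) k,
      r + β = e.famOf z₁ ρ (α.restrict (linAt t f)) :=
  Submodule.mem_sup.1 (kun_univ ES S EZ k _ (e.famOf_mem_famOm t f hα.1 hρ hL
    (hLB.trans inter_subset_left) (hLB.trans inter_subset_right) h0)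
    (e.sD_famOf hα.2 (hLB.trans inter_subset_left) h0
      fun z _ => (restrict_mem_omegaC hη hα.1 _ z).1))

/-- In the charts of the cohomology bundle, the class of the restriction of a closed relative form
is smooth. -/
theorem SmoothTriv.contMDiffAt_class (hη : IsSmoothFibreBundle ES S η) {z₀ z₁ : Z}
    (hz₀ : z₀ ∈ e.baseSet) (hz₁ : z₁ ∈ e.baseSet) (hzt : z₁ ∈ t.baseSet)
    (l : FibHc η z₀ k ℂ →ₗ[ℂ] ℂ) (α : RelCocycles EV V η k) :
    ContMDiffAt 𝓘(ℝ, EZ) 𝓘(ℝ, ℂ) ∞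
      (fun z => l (e.transport k ℂ z₀ z (restrictClass hη (linAt t f) z α))) z₁ := by
  obtain ⟨ρ, hρ, L, hL, hLB, h0, h1⟩ := exists_cutoff_nhds EZ (e.isOpen_nice t z₁)
    (z := z₁) ⟨⟨hz₁, mem_chart_source EZ z₁⟩, hzt⟩
  obtain ⟨r, hr, β, hβ, hrβ⟩ := e.exists_decomp t f hη α.2 hρ hL hLB h0
  have h2 := (e.contDiff_class hz₀ l hr).contMDiff.contMDiffAt.comp z₁
    ((contMDiffOn_chart (I := 𝓘(ℝ, EZ)) (n := ∞) (x := z₁)).contMDiffAt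
      ((chartAt EZ z₁).open_source.mem_nhds (mem_chart_source EZ z₁)))
  refine h2.congr_of_eventuallyEq ?_
  filter_upwards [h1] with z ⟨hzL, hz1⟩
  have hze := (hLB hzL).1.1
  change l _ = l _
  rw [← e.transport_fib hz₀ hze (famFin_closed hr _), restrictClass_apply]
  refine congrArg (fun x => l (e.transport k ℂ z₀ z x)) (fibClass_eq_iff.2 ?_)
  -- Near `z₁` the cutoff is `1`, so the form on the fibre over `z` corresponds to `r + β`; as `β`
  -- is exact for each parameter, the class is that of `r`.
  have h3 := congrFun hrβ (chartAt EZ z₁ z)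
  rw [e.famOf_chart (hLB hzL).1.2, hz1, Complex.ofReal_one] at h3
  have h4 : e.toS z (α.1.restrict (linAt t f) z) =
      r (chartAt EZ z₁ z) + β (chartAt EZ z₁ z) := (h3.trans (one_smul ℂ _)).symm
  have h5 := congrArg (e.fib z) h4
  rw [e.fib_toS hze, map_add] at h5
  rw [h5, add_sub_cancel_left]
  exact e.fib_mem_coboundaries hze (slice_mem_bdForms hβ _)

/-- The finite-rank part is the difference of two families that are exact for each parameter. By
`mem_famBd_of_slices` it has a smooth family of primitives. -/
theorem SmoothTriv.famOf_mem_famBd (hη : IsSmoothFibreBundle ES S η) {z₁ : Z} {α : RelForm V η k}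
    (hα : α ∈ RelCocycles EV V η k)
    (hex : ∀ z, α.restrict (linAt t f) z ∈ FibCoboundaries η z ℂ k) {ρ : Z → ℝ}
    (hρ : ContMDiff 𝓘(ℝ, EZ) 𝓘(ℝ, ℝ) ∞ ρ) {L : Set Z} (hL : IsCompact L)
    (hLB : L ⊆ e.nice t z₁) (h0 : ∀ z ∉ L, ρ z = 0) :
    e.famOf z₁ ρ (α.restrict (linAt t f)) ∈ famBd EZ (univ : Set S) k := by
  obtain ⟨r, hr, β, hβ, hrβ⟩ := e.exists_decomp t f hη hα hρ hL hLB h0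
  rw [← hrβ]
  refine add_mem (mem_famBd_of_slices hr fun w => ?_) hβ
  have h1 : r w = e.famOf z₁ ρ (α.restrict (linAt t f)) w - β w := by
    rw [← hrβ, Pi.add_apply, add_sub_cancel_right]
  rw [h1]
  refine sub_mem ?_ (slice_mem_bdForms hβ w)
  by_cases hw : w ∈ chartAt EZ z₁ '' L
  · obtain ⟨z, hz, rfl⟩ := hw
    rw [e.famOf_chart (hLB hz).1.2]
    exact Submodule.smul_mem _ _ (e.toS_mem_bdForms (hLB hz).1.1 (hex z))
  · rw [e.famOf_eq_zero h0 hw]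
    exact zero_mem _

end Local

/-! ### The kernel of fibrewise restriction -/

section Kernel

variable [FiniteDimensional ℂ EV]

theorem RelForm.sum_apply {ι : Type*} (s : Finset ι) (g : ι → RelForm V η k) (p : F) :
    (∑ i ∈ s, g i) p = ∑ i ∈ s, g i p :=
  Finset.sum_apply (M := fun p : F => Vert η p [⋀^Fin k]→L[ℝ] V (η p)) p s g

/-- Expansion of `ρα` in the local frame. The second cutoff `σ` turns the frame into global
compactly supported sections, as the membership lemmas for `relOf` require; it is harmless because
`σ = 1` wherever `ρ` is nonzero. -/
theorem SmoothTriv.sum_relOf_famOf (e : SmoothTriv ES S η) (t : Trivialization EV (π EV V))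
    [MemTrivializationAtlas t] {z₁ : Z} (α : RelForm V η k) {ρ σ : Z → ℝ} {L L' : Set Z}
    (h0 : ∀ z ∉ L, ρ z = 0) (hL' : L' ⊆ e.nice t z₁)
    (h0' : ∀ z ∉ L', σ z = 0) (h1 : ∀ z ∈ L, σ z = 1) (p : F) (v : Fin k → Vert η p) :
    ∑ a, e.relOf (fun z => e.famOf z₁ ρ (α.restrict (linAt t (modelCoord EV a))) (chartAt EZ z₁ z))
      (fun z => ((σ z : ℝ) : ℂ) • frame t a z) p v = ((ρ (η p) : ℝ) : ℂ) • α p v := by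
  by_cases hp : η p ∈ L'
  · have hb := hL' hp
    have h2 : ∀ a, e.relOf (fun z => e.famOf z₁ ρ (α.restrict (linAt t (modelCoord EV a)))
        (chartAt EZ z₁ z)) (fun z => ((σ z : ℝ) : ℂ) • frame t a z) p v =
        (((ρ (η p) : ℝ) : ℂ) * ((σ (η p) : ℝ) : ℂ)) •
          linAt t (modelCoord EV a) (η p) (α p v) • frame t a (η p) := fun a => by
      have h3 : e.fib (η p) (e.toS (η p) (α.restrict (linAt t (modelCoord EV a)) (η p)))
          ⟨p, rfl⟩ v = linAt t (modelCoord EV a) (η p) (α p v) := by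
        rw [e.fib_toS hb.1.1]; rfl
      rw [e.relOf_apply, e.famOf_chart hb.1.2, ← h3, smul_smul, smul_smul]
      congr 1
      rw [mul_right_comm]
      rfl
    rw [Finset.sum_congr rfl fun a _ => h2 a, ← Finset.smul_sum, ← eq_sum_frame t hb.2]
    by_cases hpL : η p ∈ L
    · rw [h1 _ hpL, Complex.ofReal_one, mul_one]
    · rw [h0 _ hpL, Complex.ofReal_zero, zero_mul]
  · have hpL : η p ∉ L := fun h => by
      have := h0' _ hp
      rw [h1 _ h] at this
      exact one_ne_zero this
    rw [h0 _ hpL, Complex.ofReal_zero, zero_smul]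
    refine Finset.sum_eq_zero fun a _ => ?_
    rw [e.relOf_apply, h0' _ hp, Complex.ofReal_zero, zero_smul, smul_zero]

/-- A closed relative form that is exact on every fibre is exact. -/
theorem mem_relCoboundaries_of_restrict (hη : IsSmoothFibreBundle ES S η) {α : RelForm V η k}
    (hα : α ∈ RelCocycles EV V η k)
    (hex : ∀ (l : ∀ z, V z →L[ℂ] ℂ) z, α.restrict l z ∈ FibCoboundaries η z ℂ k) :
    α ∈ RelCoboundaries EV V η k := by
  choose e he using hη
  obtain ⟨K, hK, hK0⟩ := hα.1.2
  -- The partition of unity lives on the base, so its functions are constant on the fibres and the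
  -- localized pieces remain closed and fibrewise exact.
  obtain ⟨T, ρ, hρ, hL, hsum⟩ := exists_finite_partition EZ (hK.image η.contMDiff.continuous)
    (B := fun z => (e z).nice (trivializationAt EV V z) z) (fun z => SmoothTriv.isOpen_nice _ _ _)
    (fun z => ⟨⟨he z, mem_chart_source EZ z⟩, mem_baseSet_trivializationAt EV V z⟩)
  choose L hLc hLB hL0 using hL
  choose σ hσ L' hL'c hL'B hL'0 hσ1 using fun i =>
    exists_cutoff_one EZ (SmoothTriv.isOpen_nice _ _ _) (hLc i) (hLB i)
  have key : α = ∑ i : T, ∑ a, (e i).relOf (fun z => (e i).famOf (i : Z) (ρ i)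
      (α.restrict (linAt (trivializationAt EV V (i : Z)) (modelCoord EV a))) (chartAt EZ (i : Z) z))
      (fun z => ((σ i z : ℝ) : ℂ) • frame (trivializationAt EV V (i : Z)) a z) := by
    funext p
    ext v
    rw [RelForm.sum_apply, ContinuousAlternatingMap.sum_apply]
    have h1 : ∀ i : T, (∑ a, (e i).relOf (fun z => (e i).famOf (i : Z) (ρ i)
      (α.restrict (linAt (trivializationAt EV V (i : Z)) (modelCoord EV a))) (chartAt EZ (i : Z) z))
      (fun z => ((σ i z : ℝ) : ℂ) • frame (trivializationAt EV V (i : Z)) a z)) p v =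
        ((ρ i (η p) : ℝ) : ℂ) • α p v := fun i => by
      rw [RelForm.sum_apply, ContinuousAlternatingMap.sum_apply]
      exact (e i).sum_relOf_famOf _ α (hL0 i) (hL'B i) (hL'0 i) (hσ1 i) p v
    rw [Finset.sum_congr rfl fun i _ => h1 i, ← Finset.sum_smul]
    by_cases hp : p ∈ K
    · rw [← Complex.ofReal_sum, hsum _ ⟨p, hp, rfl⟩, Complex.ofReal_one, one_smul]
    · rw [hK0 p hp]
      exact (smul_zero _).symm
  rw [key]
  refine sum_mem fun i _ => sum_mem fun a _ => ?_
  refine (e i).relOf_mem_coboundaries (contMDiff_cutoff_section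
    (trivializationAt EV V (i : Z)).open_baseSet (contMDiffOn_frame _ a) (hσ i) (hL'c i)
    ((hL'B i).trans inter_subset_right) (hL'0 i)) (hL'c i) ((hL'B i).trans inter_subset_left)
    (fun z hz => by rw [hL'0 i z hz, Complex.ofReal_zero, zero_smul]) ?_
  exact (e i).famOf_mem_famBd _ _ (fun z => ⟨e z, he z⟩) hα (hex _) (hρ i) (hLc i) (hLB i) (hL0 i)

end Kernel

variable {EF EZ ES : Type*} [NormedAddCommGroup EF] [NormedSpace ℝ EF] [FiniteDimensional ℝ EF]
  [NormedAddCommGroup EZ] [NormedSpace ℝ EZ] [FiniteDimensional ℝ EZ]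
  [NormedAddCommGroup ES] [NormedSpace ℝ ES] [FiniteDimensional ℝ ES]
  {F Z S : Type*} [TopologicalSpace F] [T2Space F] [ChartedSpace EF F] [IsManifold 𝓘(ℝ, EF) ∞ F]
  [TopologicalSpace Z] [T2Space Z] [SigmaCompactSpace Z] [ChartedSpace EZ Z]
  [IsManifold 𝓘(ℝ, EZ) ∞ Z]
  [TopologicalSpace S] [T2Space S] [SigmaCompactSpace S] [ChartedSpace ES S]
  [IsManifold 𝓘(ℝ, ES) ∞ S]
  {η : C^∞⟮𝓘(ℝ, EF), F; 𝓘(ℝ, EZ), Z⟯} {k : ℕ}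

/-! ### Smoothness of the cohomology bundle -/

section Bundle

/-- Products with a fixed closed form on the typical fibre. -/
theorem SmoothTriv.relOf_const_mem_cocycles {EV : Type*} [NormedAddCommGroup EV] [NormedSpace ℂ EV]
    {V : Z → Type*} [∀ z, AddCommGroup (V z)] [∀ z, Module ℂ (V z)]
    [∀ z, TopologicalSpace (V z)] [∀ z, IsTopologicalAddGroup (V z)]
    [∀ z, ContinuousSMul ℂ (V z)] [TopologicalSpace (TotalSpace EV V)]
    [FiberBundle EV V] [VectorBundle ℂ EV V] (e : SmoothTriv ES S η) {z₁ : Z} {c : SForm ES S k}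
    (hc : c ∈ closedForms ES k (univ : Set S)) {b : ∀ z, V z}
    (hb : ContMDiff 𝓘(ℝ, EZ) (𝓘(ℝ, EZ).prod 𝓘(ℝ, EV)) ∞ (fun z => (⟨z, b z⟩ : TotalSpace EV V)))
    {K : Set Z} (hK : IsCompact K) (hKB : K ⊆ e.baseSet ∩ (chartAt EZ z₁).source)
    (h0 : ∀ z ∉ K, b z = 0) : e.relOf (fun _ => c) b ∈ RelCocycles EV V η k :=
  e.relOf_mem_cocycles (z₁ := z₁) (α := fun _ => c) hb hK hKB h0 (const_mem_famOm hc.1)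
    fun _ => hc.2

variable (k) in
/-- The cohomology spaces of the fibres form a smooth vector bundle. -/
theorem hcIsSmoothBundle (hη : IsSmoothFibreBundle ES S η) : HcIsSmoothBundle ES S η k := by
  intro e e' z₀ z₁ hz₀ hz₁ c l z hz
  refine ContMDiffAt.contMDiffWithinAt ?_
  obtain ⟨c', hc', rfl⟩ := e'.exists_closedForm hz₁ c
  obtain ⟨ρ, hρ, L, hL, hLB, h0, h1⟩ := exists_cutoff_nhds EZ
    (e'.open_baseSet.inter (chartAt EZ z).open_source) (z := z) ⟨hz.2, mem_chart_source EZ z⟩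
  -- A section constant in the chart `e'` is, near `z`, the restriction of a closed relative form
  -- with values in the trivial line bundle: the fixed form `c'` times a cutoff of the base. Its
  -- smoothness in the chart `e` is then a case of `SmoothTriv.contMDiffAt_class`.
  have hb : ContMDiff 𝓘(ℝ, EZ) (𝓘(ℝ, EZ).prod 𝓘(ℝ, ℂ)) ∞
      (fun z => (⟨z, ((ρ z : ℝ) : ℂ)⟩ : TotalSpace ℂ (Bundle.Trivial Z ℂ))) := by
    intro z'
    rw [contMDiffAt_section]
    exact (Complex.ofRealCLM.contDiff.contMDiff.comp hρ) z'
  have hmem := e'.relOf_const_mem_cocycles (V := Bundle.Trivial Z ℂ) hc' hb hL hLB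
    (fun z hz => by rw [h0 z hz]; exact Complex.ofReal_zero)
  have h2 := e.contMDiffAt_class (trivializationAt ℂ (Bundle.Trivial Z ℂ) z) (ContinuousLinearMap.id ℂ ℂ) hη
    hz₀ hz.1 (mem_univ z) l ⟨_, hmem⟩
  refine h2.congr_of_eventuallyEq ?_
  filter_upwards [h1] with z' ⟨hzL, hz1⟩
  have hze := (hLB hzL).1
  rw [e'.transport_fib hze hz₁ hc', restrictClass_apply]
  refine congrArg (fun x => l (e.transport k ℂ z₀ z' x)) (fibClass_congr ?_)
  rw [e'.relOf_restrict, linAt_apply _ _ (mem_univ z')]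
  change _ = ((ρ z' : ℝ) : ℂ) • e'.fib z' c'
  rw [hz1, Complex.ofReal_one, one_smul]

end Bundle

/-! ### The image of fibrewise restriction, and the isomorphism -/

variable {EV : Type*} [NormedAddCommGroup EV] [NormedSpace ℂ EV] [FiniteDimensional ℂ EV]
  {V : Z → Type*} [∀ z, AddCommGroup (V z)] [∀ z, Module ℂ (V z)]
  [∀ z, TopologicalSpace (V z)] [∀ z, IsTopologicalAddGroup (V z)]
  [∀ z, ContinuousSMul ℂ (V z)] [TopologicalSpace (TotalSpace EV V)]
  [FiberBundle EV V] [VectorBundle ℂ EV V] [VectorBundle ℝ EV V]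
  [ContMDiffVectorBundle ∞ EV V 𝓘(ℝ, EZ)]

theorem restrictSection_mem (hη : IsSmoothFibreBundle ES S η) (α : RelCocycles EV V η k) :
    restrictSection hη α ∈ CohSectionsC EV V η k ES S := by
  refine ⟨fun e z₀ hz₀ l z hz => ContMDiffAt.contMDiffWithinAt ?_, ?_⟩
  · set t := trivializationAt EV V z with ht
    have hzt : z ∈ t.baseSet := mem_baseSet_trivializationAt EV V z
    rw [contMDiffAt_section]
    have h1 : ContMDiffAt 𝓘(ℝ, EZ) 𝓘(ℝ, EV) ∞ (fun z' => ∑ a,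
        l (e.transport k ℂ z₀ z' (restrictClass hη (linAt t (modelCoord EV a)) z' α)) •
          Module.finBasis ℂ EV a) z := by
      refine ContDiff.contMDiff (f := fun c : Fin (Module.finrank ℂ EV) → ℂ =>
        ∑ a, c a • Module.finBasis ℂ EV a) ?_ |>.contMDiffAt.comp z
        (contMDiffAt_pi_space.2 fun a => e.contMDiffAt_class t (modelCoord EV a) hη hz₀ hz hzt l α)
      exact ContDiff.sum fun a _ => (contDiff_apply ℝ ℂ a).smul contDiff_const
    refine h1.congr_of_eventuallyEq ?_
    filter_upwards [t.open_baseSet.mem_nhds hzt] with z' hz'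
    rw [← triv_sum_frame t hz', restrictSection_eq_sum t hη α hz', map_sum]
    simp only [chartCoord_tmul]
    rfl
  · obtain ⟨K, hK, hK0⟩ := α.2.1.2
    refine ⟨η '' K, hK.image η.contMDiff.continuous, fun z hz => ?_⟩
    refine tensor_ext (EV := EV) fun l => ?_
    rw [contractV_restrictSection, map_zero, restrictClass_eq_zero_iff]
    have : α.1.restrict l z = 0 := by
      funext p
      ext v
      change l (η p.1) (α.1 p.1 v) = 0
      rw [hK0 p.1 fun h => hz ⟨p.1, h, p.2⟩]
      exact map_zero _
    rw [this]
    exact zero_mem _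

theorem restrictSection_relOf (hη : IsSmoothFibreBundle ES S η) (e : SmoothTriv ES S η)
    {c : SForm ES S k} (hc : c ∈ closedForms ES k (univ : Set S)) {b : ∀ z, V z}
    (hmem : e.relOf (fun _ => c) b ∈ RelCocycles EV V η k) {z : Z} (hz : z ∈ e.baseSet) :
    restrictSection hη ⟨_, hmem⟩ z =
      fibClass (e.fib z c) (e.fib_mem_cocycles hz hc) ⊗ₜ[ℂ] b z := by
  refine tensor_ext (EV := EV) fun l => ?_
  rw [contractV_restrictSection, contractV_tmul, restrictClass_apply, ← fibClass_smul]
  exact fibClass_congr (e.relOf_restrict _ b l z)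

theorem restrictSection_relOf_of_eq_zero (hη : IsSmoothFibreBundle ES S η) (e : SmoothTriv ES S η)
    {c : SForm ES S k} {b : ∀ z, V z} (hmem : e.relOf (fun _ => c) b ∈ RelCocycles EV V η k) {z : Z}
    (hb : b z = 0) : restrictSection hη ⟨_, hmem⟩ z = 0 := by
  refine tensor_ext (EV := EV) fun l => ?_
  rw [contractV_restrictSection, map_zero, restrictClass_eq_zero_iff]
  change (e.relOf (fun _ => c) b).restrict l z ∈ _
  rw [e.relOf_restrict, hb, map_zero, zero_smul]
  exact zero_mem _

theorem SmoothTriv.transport_injective (e : SmoothTriv ES S η) {z₀ z : Z} (hz₀ : z₀ ∈ e.baseSet)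
    (hz : z ∈ e.baseSet) : Function.Injective (e.transport k ℂ z₀ z) := by
  refine Function.LeftInverse.injective (g := e.transport k ℂ z z₀) fun h => ?_
  obtain ⟨c, hc, rfl⟩ := e.exists_closedForm hz h
  rw [e.transport_fib hz₀ hz hc, e.transport_fib hz hz₀ hc]

/-- The closed forms `c i` on `S` represent a basis over `z₀`. Over every other `z` in the base set
they represent a basis too, which `transport` carries to `B`, and the coefficients of `u` in it are
its chart coordinates. -/
theorem SmoothTriv.eq_sum_chartCoord (e : SmoothTriv ES S η) {z₀ z : Z} (hz₀ : z₀ ∈ e.baseSet)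
    (hz : z ∈ e.baseSet) {ι : Type*} [Fintype ι] (B : Module.Basis ι ℂ (FibHc η z₀ k ℂ))
    {c : ι → SForm ES S k} (hc : ∀ i, c i ∈ closedForms ES k (univ : Set S))
    (hB : ∀ i, B i = fibClass (e.fib z₀ (c i)) (e.fib_mem_cocycles hz₀ (hc i)))
    (u : FibHc η z k ℂ ⊗[ℂ] V z) :
    ∑ i, fibClass (e.fib z (c i)) (e.fib_mem_cocycles hz (hc i)) ⊗ₜ[ℂ]
      chartCoord e (B.coord i) z u = u := by
  induction u using TensorProduct.induction_on with
  | zero => simp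
  | tmul h v =>
    simp only [chartCoord_tmul, ← TensorProduct.smul_tmul]
    rw [← TensorProduct.sum_tmul]
    congr 1
    refine e.transport_injective hz₀ hz ?_
    rw [map_sum]
    conv_rhs => rw [← B.sum_repr (e.transport k ℂ z₀ z h)]
    refine Finset.sum_congr rfl fun i _ => ?_
    rw [map_smul, e.transport_fib hz₀ hz (hc i), hB]
    rfl
  | add u v hu hv =>
    simp only [map_add, TensorProduct.tmul_add, Finset.sum_add_distrib]
    rw [hu, hv]

/-- Finite-dimensionality provides a finite basis of each chosen fibre cohomology, represented by
closed forms `c i j` on `S`. The localized section `ρ i • s` is `Σⱼ [c i j] ⊗ g i j` with smooth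
compactly supported `g i j`, and `Σⱼ c i j ⊗ g i j` is a closed relative form restricting to it. -/
theorem restrictSection_surjective (hη : IsSmoothFibreBundle ES S η)
    (hfin : ∀ z : Z, FiniteDimensional ℂ (FibHc η z k ℂ))
    {s : ∀ z, FibHc η z k ℂ ⊗[ℂ] V z} (hs : s ∈ CohSectionsC EV V η k ES S) :
    ∃ α : RelCocycles EV V η k, restrictSection hη α = s := by
  have hη' := hη
  choose e he using hη'
  obtain ⟨hs1, K, hK, hK0⟩ := hs
  obtain ⟨T, ρ, hρ, hL, hsum⟩ := exists_finite_partition EZ hK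
    (B := fun z => (e z).baseSet ∩ (chartAt EZ z).source)
    (fun z => (e z).open_baseSet.inter (chartAt EZ z).open_source)
    (fun z => ⟨he z, mem_chart_source EZ z⟩)
  choose L hLc hLB hL0 using hL
  choose c hc hcB using fun (z : Z) (j : Fin (Module.finrank ℂ (FibHc η z k ℂ))) =>
    (e z).exists_closedForm (he z) (Module.finBasis ℂ (FibHc η z k ℂ) j)
  set g : ∀ i : T, Fin (Module.finrank ℂ (FibHc η (i : Z) k ℂ)) → ∀ z, V z := fun i j z =>
    ((ρ i z : ℝ) : ℂ) • chartCoord (e i) ((Module.finBasis ℂ (FibHc η (i : Z) k ℂ)).coord j) z (s z)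
    with hg
  have hmem : ∀ (i : T) j, (e i).relOf (fun _ => c i j) (g i j) ∈ RelCocycles EV V η k := fun i j =>
    (e i).relOf_const_mem_cocycles (hc i j)
      (contMDiff_cutoff_section (e i).open_baseSet (hs1 (e i) i (he i) _) (hρ i) (hLc i)
        ((hLB i).trans inter_subset_left) (hL0 i)) (hLc i) (hLB i)
      (fun z hz => by simp only [hg]; rw [hL0 i z hz, Complex.ofReal_zero, zero_smul])
  refine ⟨∑ i, ∑ j, ⟨_, hmem i j⟩, ?_⟩
  funext z
  have h1 : ∀ i : T, ∑ j, restrictSection hη ⟨_, hmem i j⟩ z = ((ρ i z : ℝ) : ℂ) • s z := fun i => by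
    by_cases hz : z ∈ L i
    · have hze := (hLB i hz).1
      rw [← (e i).eq_sum_chartCoord (he i) hze (Module.finBasis ℂ (FibHc η (i : Z) k ℂ)) (hc i)
        (hcB i) (s z), Finset.smul_sum]
      refine Finset.sum_congr rfl fun j _ => ?_
      rw [restrictSection_relOf hη (e i) (hc i j) (hmem i j) hze, ← TensorProduct.tmul_smul]
    · rw [hL0 i z hz, Complex.ofReal_zero, zero_smul]
      refine Finset.sum_eq_zero fun j _ => restrictSection_relOf_of_eq_zero hη (e i) (hmem i j) ?_
      simp only [hg]
      rw [hL0 i z hz, Complex.ofReal_zero, zero_smul]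
  simp only [map_sum, Finset.sum_apply]
  rw [Finset.sum_congr rfl fun i _ => h1 i, ← Finset.sum_smul, ← Complex.ofReal_sum]
  by_cases hz : z ∈ K
  · rw [hsum z hz, Complex.ofReal_one, one_smul]
  · rw [hK0 z hz, smul_zero]

/-- Fibrewise restriction of closed relative forms, as a map to the smooth compactly supported
sections. -/
def restriction (hη : IsSmoothFibreBundle ES S η) :
    RelCocycles EV V η k →ₗ[ℂ] CohSectionsC EV V η k ES S :=
  (restrictSection hη).codRestrict _ (restrictSection_mem hη)

theorem ker_restriction (hη : IsSmoothFibreBundle ES S η) :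
    LinearMap.ker (restriction (EV := EV) (V := V) (k := k) hη) =
      (RelCoboundaries EV V η k).submoduleOf (RelCocycles EV V η k) := by
  ext α
  have h1 : restriction hη α = 0 ↔ restrictSection hη α = 0 := Subtype.ext_iff
  rw [LinearMap.mem_ker, h1, restrictSection_eq_zero_iff]
  exact ⟨fun h => mem_relCoboundaries_of_restrict hη α.2 h,
    fun h l z => restrict_mem_coboundaries hη h l z⟩

theorem restriction_surjective (hη : IsSmoothFibreBundle ES S η)
    (hfin : ∀ z : Z, FiniteDimensional ℂ (FibHc η z k ℂ)) :
    Function.Surjective (restriction (EV := EV) (V := V) (k := k) hη) := fun s => by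
  obtain ⟨α, hα⟩ := restrictSection_surjective hη hfin s.2
  exact ⟨α, Subtype.ext hα⟩

/-- A surjective linear map to a module over an additive monoid induces an isomorphism from the
quotient by its kernel. -/
theorem exists_quotient_equiv {M N : Type*} [AddCommGroup M] [Module ℂ M] [AddCommMonoid N]
    [Module ℂ N] (p : Submodule ℂ M) (f : M →ₗ[ℂ] N) (hp : LinearMap.ker f = p)
    (hf : Function.Surjective f) :
    ∃ Φ : (M ⧸ p) ≃ₗ[ℂ] N, ∀ x, Φ (Submodule.Quotient.mk x) = f x := by
  -- The tensor products enter `CohSectionsC` as additive monoids only; negation is recovered from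
  -- the scalar `-1`.
  let : AddCommGroup N := Module.addCommMonoidToAddCommGroup ℂ
  subst hp
  exact ⟨f.quotKerEquivOfSurjective hf, fun _ => rfl⟩

/-- Fibrewise restriction, as an isomorphism. -/
theorem exists_restriction_equiv (hη : IsSmoothFibreBundle ES S η)
    (hfin : ∀ z : Z, FiniteDimensional ℂ (FibHc η z k ℂ)) :
    ∃ Φ : RelHc EV V η k ≃ₗ[ℂ] CohSectionsC EV V η k ES S,
      ∀ α : RelCocycles EV V η k, Φ (Submodule.Quotient.mk α) = restriction hη α :=
  exists_quotient_equiv _ _ (ker_restriction hη) (restriction_surjective hη hfin)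

end RelDeRham

end

/-- Let `η : F → Z` be a smooth fibre bundle whose fibres have finite-dimensional compactly
supported de Rham cohomology, and `V → Z` a smooth complex vector bundle. Then the spaces
`H^k_c(η⁻¹(z))` form a smooth vector bundle over `Z`, and fibrewise restriction of relative forms
induces an isomorphism `H^k_{C,c}(F, η^*V) ≅ Γ_c(Z, H^k_c ⊗ V)`. -/
theorem mainTheorem5
    {EF EZ ES EV : Type*}
    [NormedAddCommGroup EF] [NormedSpace ℝ EF] [FiniteDimensional ℝ EF]
    [NormedAddCommGroup EZ] [NormedSpace ℝ EZ] [FiniteDimensional ℝ EZ]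
    [NormedAddCommGroup ES] [NormedSpace ℝ ES] [FiniteDimensional ℝ ES]
    [NormedAddCommGroup EV] [NormedSpace ℂ EV] [FiniteDimensional ℂ EV]
    {F Z S : Type*}
    [TopologicalSpace F] [T2Space F] [SigmaCompactSpace F]
    [ChartedSpace EF F] [IsManifold 𝓘(ℝ, EF) ∞ F]
    [TopologicalSpace Z] [T2Space Z] [SigmaCompactSpace Z]
    [ChartedSpace EZ Z] [IsManifold 𝓘(ℝ, EZ) ∞ Z]
    [TopologicalSpace S] [T2Space S] [SigmaCompactSpace S]
    [ChartedSpace ES S] [IsManifold 𝓘(ℝ, ES) ∞ S]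
    (η : C^∞⟮𝓘(ℝ, EF), F; 𝓘(ℝ, EZ), Z⟯)
    (hη : RelDeRham.IsSmoothFibreBundle ES S η)
    (hfin : ∀ (z : Z) (j : ℕ), FiniteDimensional ℂ (RelDeRham.FibHc η z j ℂ))
    {V : Z → Type*} [∀ z, AddCommGroup (V z)] [∀ z, Module ℂ (V z)]
    [∀ z, TopologicalSpace (V z)] [∀ z, IsTopologicalAddGroup (V z)]
    [∀ z, ContinuousSMul ℂ (V z)] [TopologicalSpace (Bundle.TotalSpace EV V)]
    [FiberBundle EV V] [VectorBundle ℂ EV V] [VectorBundle ℝ EV V]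
    [ContMDiffVectorBundle ∞ EV V 𝓘(ℝ, EZ)]
    (k : ℕ) :
    RelDeRham.HcIsSmoothBundle ES S η k ∧
    ∃ Φ : RelDeRham.RelHc EV V η k ≃ₗ[ℂ] RelDeRham.CohSectionsC EV V η k ES S,
      ∀ (α : RelDeRham.RelCocycles EV V η k) (l : ∀ z, V z →L[ℂ] ℂ) (z : Z),
        ∃ h : RelDeRham.RelForm.restrict α.1 l z ∈ RelDeRham.FibCocycles η z k ℂ,
          RelDeRham.contractV z (l z) ((Φ (Submodule.Quotient.mk α)).1 z) =
            (Submodule.Quotient.mk ⟨RelDeRham.RelForm.restrict α.1 l z, h⟩ :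
              RelDeRham.FibHc η z k ℂ) := by
  refine ⟨RelDeRham.hcIsSmoothBundle k hη, ?_⟩
  obtain ⟨Φ, hΦ⟩ := RelDeRham.exists_restriction_equiv (EV := EV) (V := V) (k := k) hη
    (fun z => hfin z k)
  -- By `RelDeRham.tensor_ext`, the contractions with all functionals determine the value of the
  -- section at `z`, so this identity says that it is the class of the restricted form.
  refine ⟨Φ, fun α l z => ⟨RelDeRham.restrict_mem_cocycles hη α.2 l z, ?_⟩⟩
  rw [hΦ]
  exact RelDeRham.contractV_restrictSection hη α l z
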